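/- **Setting.** For $n\ge 2$ the Parenthesis recurrence asks for the table $D_{i,j}$, $0\le i<j\le n$, where $D_{i,i+1}$ is given and $$D_{i,j}=\min_{i<k<j}\{D_{i,k}+D_{k,j}+w(i,k,j)\}\qquad(j>i+1).$$ The table is stored in row-major order. A *program* for size $n$ is a nested-parallel (series-parallel) computation DAG, independent of the input values, of unit-cost instructions on an unbounded memory: evaluate the cell $(i,k,j)$ on the words at two addresses and combine the result by $\min$ into the word at a third one; combine one word into another; copy a word. It *computes* the recurrence if it evaluates each cell $(i,k,j)$, $0\le i<k<j\le n$, exactly once and its sequential execution leaves all $D_{i,j}$ in the table, the cells and the operation $\min$ being atomic (the result is correct for every semilattice operation in place of $\min$ and all cell functions $g_{i,k,j}(D_{i,k},D_{k,j})$ in place of $D_{i,k}+D_{k,j}+w(i,k,j)$). Work is the number of operations (including forks) and span the number of operations on a longest path of the DAG. With a cache of $M$ words and lines of $B$ words, operands must be in the cache, and the cache is empty at the start and at the end (so the results are in main memory). For the sequential execution under an optimal offline replacement policy, the symmetric cache complexity is the least number of line transfers, and the asymmetric cache complexity with write cost $\omega\ge1$ is the least value of (line reads) $+\ \omega\cdot$(line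 writes). A constant-branching cache-oblivious (CBCO) algorithm is a divide-and-conquer algorithm, independent of the input values and of $M$ and $B$ (but possibly aware of $\omega$), with a bounded number of kinds of tasks, bounded fan-out and base cases of bounded size, in which the partition of each task is decided by the ratio of its ranges (and by which ranges cannot be split further). **Theorem.** There are absolute constants $c,C>0$ and $F$ such that the following hold. 1. (Symmetric upper bound.) There is a CBCO algorithm with constant $F$ which, for every $n\ge2$, gives a race-free program that computes the Parenthesis recurrence with work between $cn^3$ and $Cn^3$ and span at most $Cn^{\log_23}$, and whose symmetric cache complexity lies between $c\,\frac{n^3}{B\sqrt M}$ and $C\,\frac{n^3}{B\sqrt M}$ for all $B\ge1$ and $M\ge\max(B^2,3B)$ with $\sqrt M\le n$. 2. (Symmetric optimality.) For all $n\ge2$ and $M,B\ge1$, every program that computes the recurrence, even one chosen in terms of $M$ and $B$, has symmetric cache complexity at least $c\,\frac{n^3}{B\sqrt M}$. 3. (Asymmetric upper bound.) For every $\omega\ge1$ there is a CBCO algorithm with constant $F$ which, for every $n\ge2$, gives a race-free program that computes the recurrence with work between $cn^3$ and $Cn^3$ and span at most $Cn^{\log_23}$, and whose asymmetric cache complexity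 lies between $c\,\frac{\omega^{1/3}n^3}{B\sqrt M}$ and $C\,\frac{\omega^{1/3}n^3}{B\sqrt M}$ for all $B\ge1$ and $M\ge\max(B^2,3B)$ with $\omega\sqrt M\le n$. 4. (Asymmetric optimality.) No cache-oblivious program, in particular none of a CBCO algorithm, has a better bound at any scale of cache sizes: for all $\omega\ge1$, $n\ge2$, every program that computes the recurrence, and all $M,B\ge1$, there is $M'$ with $M\le M'\le\lceil\omega^{2/3}M\rceil$ such that its asymmetric cache complexity for a cache of size $M'$ with lines of size $B$ is at least $c\,\frac{\omega^{1/3}n^3}{B\sqrt{M'}}$. -/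

import Mathlib

open scoped ENNReal

/-! ## Nested-parallel computations -/

/-- A nested-parallel computation over elementary steps of type `α`: the series-parallel DAG
obtained by unfolding a run. `par p q` forks into the tasks `p` and `q`, which then join. -/
inductive SP (α : Type) : Type where
  | done : SP α
  | op : α → SP α
  | seq : SP α → SP α → SP α
  | par : SP α → SP α → SP α

namespace SP

variable {α β : Type}

/-- Work: the number of operations of the DAG, a FORK being one operation. -/
def work : SP α → ℕ
  | done => 0
  | op _ => 1
  | seq p q => p.work + q.work
  | par p q => p.work + q.work + 1

/-- Span (depth): the number of operations on a longest path of the DAG. -/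
def span : SP α → ℕ
  | done => 0
  | op _ => 1
  | seq p q => p.span + q.span
  | par p q => max p.span q.span + 1

/-- The elementary steps in the order of the sequential (depth-first, left-to-right) execution. -/
def ops : SP α → List α
  | done => []
  | op a => [a]
  | seq p q => p.ops ++ q.ops
  | par p q => p.ops ++ q.ops

/-- Replace every elementary step by a computation. -/
def bind : SP α → (α → SP β) → SP β
  | done, _ => done
  | op a, f => f a
  | seq p q, f => seq (p.bind f) (q.bind f)
  | par p q, f => par (p.bind f) (q.bind f)

end SP

/-! ## Instructions on an unbounded memory -/

/-- The operations on data. Memory is addressed by `ℕ`.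
* `cell i k j x y z`: apply the atomic cell function `g i k j` to the words at `x` and `y` and
  combine ("add") the result into the word at `z`;
* `merge x z`: combine the word at `x` into the word at `z`;
* `copy x z`: copy the word at `x` to `z`. -/
inductive Instr : Type where
  | cell (i k j x y z : ℕ) : Instr
  | merge (x z : ℕ) : Instr
  | copy (x z : ℕ) : Instr

namespace Instr

/-- The addresses read. -/
def sources : Instr → Finset ℕ
  | cell _ _ _ x y z => {x, y, z}
  | merge x z => {x, z}
  | copy x _ => {x}

/-- The address written. -/
def target : Instr → ℕ
  | cell _ _ _ _ _ z => z
  | merge _ z => z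
  | copy _ z => z

/-- The grid cell that is evaluated, if any. -/
def label : Instr → Option (ℕ × ℕ × ℕ)
  | cell i k j _ _ _ => some (i, k, j)
  | merge _ _ => none
  | copy _ _ => none

/-- Effect on the memory. The associative operation is `⊓` (the minimum); `⊤` (that is, `∞`) is the
content of an uninitialised word, and a cell with an input `⊤` produces `⊤`. -/
def exec {V : Type} [SemilatticeInf V] (g : ℕ → ℕ → ℕ → V → V → V) (m : ℕ → WithTop V) :
    Instr → ℕ → WithTop V
  | cell i k j x y z => Function.update m z (m z ⊓ WithTop.map₂ (g i k j) (m x) (m y))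
  | merge x z => Function.update m z (m z ⊓ m x)
  | copy x z => Function.update m z (m x)

end Instr

/-- No two logically parallel parts access the same memory location with one access a write. -/
def RaceFree : SP Instr → Prop
  | .done => True
  | .op _ => True
  | .seq p q => RaceFree p ∧ RaceFree q
  | .par p q => RaceFree p ∧ RaceFree q ∧
      ∀ a ∈ p.ops, ∀ b ∈ q.ops,
        a.target ≠ b.target ∧ a.target ∉ b.sources ∧ b.target ∉ a.sources

/-! ## The Parenthesis recurrence -/

/-- `D` solves the recurrence `D i j = min_{i < k < j} g i k j (D i k) (D k j)`, `0 ≤ i < j ≤ n`,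
with initial values `D i (i+1) = d i`. The Parenthesis recurrence is the case where the values are
real numbers and `g i k j x y = x + y + w i k j`. -/
def IsParenSolution {V : Type} [SemilatticeInf V] (n : ℕ) (g : ℕ → ℕ → ℕ → V → V → V)
    (d : ℕ → V) (D : ℕ → ℕ → V) : Prop :=
  (∀ i, i < n → D i (i + 1) = d i) ∧
  ∀ i j (h : i + 1 < j), j ≤ n →
    D i j = (Finset.Ioo i j).inf' ⟨i + 1, Finset.mem_Ioo.2 ⟨Nat.lt_succ_self i, h⟩⟩
      (fun k => g i k j (D i k) (D k j))

/-- The table `D` (indices `0, …, n`) is stored in row-major order. -/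
def addr (n i j : ℕ) : ℕ := i * (n + 1) + j

/-- The initial memory: `d i` at the address of `D i (i+1)`, and nothing anywhere else. -/
def initMem {V : Type} (n : ℕ) (d : ℕ → V) : ℕ → WithTop V := fun a =>
  if a / (n + 1) < n ∧ a % (n + 1) = a / (n + 1) + 1 then (d (a / (n + 1)) : WithTop V) else ⊤

/-- Started on the initial values, `P` ends with the solution in the table, for the cell
functions `g`. -/
def ComputesFor {V : Type} [SemilatticeInf V] (n : ℕ) (P : SP Instr)
    (g : ℕ → ℕ → ℕ → V → V → V) : Prop :=
  ∀ (d : ℕ → V) (D : ℕ → ℕ → V), IsParenSolution n g d D →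
    ∀ i j, i < j → j ≤ n →
      P.ops.foldl (Instr.exec g) (initMem n d) (addr n i j) = (D i j : WithTop V)

/-- `P` computes the recurrence as a grid computation: each cell `(i, k, j)` of the grid is
evaluated exactly once, and the result is correct with the operation `⊓` and the cell
functions treated as atomic, that is, whatever they are. -/
def Computes (n : ℕ) (P : SP Instr) : Prop :=
  (∀ i k j, i < k → k < j → j ≤ n → (P.ops.filterMap Instr.label).count (i, k, j) = 1) ∧
  ∀ (V : Type) [SemilatticeInf V] (g : ℕ → ℕ → ℕ → V → V → V), ComputesFor n P g

/-! ## The ideal cache with read and write costs -/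

/-- `CacheRun M B res dirty t R W`: with a cache of `M` words, lines of `B` words, the lines `res`
resident and the lines `dirty` modified since they were loaded, the instructions `t` can be executed
with `R` line reads from and `W` line writes to the main memory, ending with an empty cache (all
results are in the main memory). Replacement decisions are free, so that minimizing over all runs
gives the optimal offline policy. An instruction needs its operands in the cache. -/
inductive CacheRun (M B : ℕ) : Finset ℕ → Finset ℕ → List Instr → ℕ → ℕ → Prop where
  | finish : CacheRun M B ∅ ∅ [] 0 0
  | load {res dirty : Finset ℕ} {t : List Instr} {R W : ℕ} (l : ℕ) :
      l ∉ res → (res.card + 1) * B ≤ M →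
      CacheRun M B (insert l res) dirty t R W → CacheRun M B res dirty t (R + 1) W
  | drop {res dirty : Finset ℕ} {t : List Instr} {R W : ℕ} (l : ℕ) :
      l ∈ res → l ∉ dirty →
      CacheRun M B (res.erase l) dirty t R W → CacheRun M B res dirty t R W
  | writeBack {res dirty : Finset ℕ} {t : List Instr} {R W : ℕ} (l : ℕ) :
      l ∈ res → l ∈ dirty →
      CacheRun M B (res.erase l) (dirty.erase l) t R W → CacheRun M B res dirty t R (W + 1)
  | exec {res dirty : Finset ℕ} {t : List Instr} {R W : ℕ} (a : Instr) :
      (∀ x ∈ a.sources, x / B ∈ res) → a.target / B ∈ res →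
      CacheRun M B res (insert (a.target / B) dirty) t R W → CacheRun M B res dirty (a :: t) R W

/-- Sequential asymmetric cache complexity of `P`: line reads plus `ω` times line writes, under
optimal replacement, starting with an empty cache (`∞` if the cache is too small to run `P`). -/
noncomputable def asymCacheCost (ω : ℝ) (M B : ℕ) (P : SP Instr) : ℝ≥0∞ :=
  ⨅ (R : ℕ) (W : ℕ) (_ : CacheRun M B ∅ ∅ P.ops R W), ((R : ℝ≥0∞) + ENNReal.ofReal ω * (W : ℝ≥0∞))

/-- Sequential symmetric cache complexity: the number of lines transferred. -/
noncomputable def symCacheCost (M B : ℕ) (P : SP Instr) : ℝ≥0∞ :=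
  ⨅ (R : ℕ) (W : ℕ) (_ : CacheRun M B ∅ ∅ P.ops R W), ((R : ℝ≥0∞) + (W : ℝ≥0∞))

/-! ## Divide-and-conquer algorithms and the CBCO paradigm -/

/-- The ranges `[lo d, lo d + len d)` of a (sub)problem in the three dimensions. -/
structure Box where
  lo : Fin 3 → ℕ
  len : Fin 3 → ℕ

/-- A recursive subtask relative to its parent: its kind, and for each of its dimensions `d` the
part between the fractions `lower d` and `upper d` (rounded) of the range `src d` of the parent. -/
structure Piece (κ : ℕ) where
  kind : Fin κ
  src : Fin 3 → Fin 3
  lower : Fin 3 → ℚ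
  upper : Fin 3 → ℚ

/-- The ranges of the subtask, given those of the parent. -/
def Piece.box {κ : ℕ} (q : Piece κ) (X : Box) : Box where
  lo d := X.lo (q.src d) + ⌊q.lower d * (X.len (q.src d) : ℚ)⌋₊
  len d := ⌊q.upper d * (X.len (q.src d) : ℚ)⌋₊ - ⌊q.lower d * (X.len (q.src d) : ℚ)⌋₊

/-- A divide-and-conquer algorithm with finitely many kinds of tasks. `divide t s` says how a task of
kind `t` whose ranges have the lengths `s` is composed of recursive subtasks; `base n t X` solves a
base case for a table of size `n`. Neither knows the input values or the cache parameters. -/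
structure DivideConquer where
  kinds : ℕ
  root : Fin kinds
  divide : Fin kinds → (Fin 3 → ℕ) → SP (Piece kinds)
  base : ℕ → Fin kinds → Box → SP Instr

/-- `A.Unfolds n t X P`: on the task of kind `t` with ranges `X`, the recursion ends, and its DAG is
`P`. The base cases are the tasks none of whose ranges can be split. -/
inductive DivideConquer.Unfolds (A : DivideConquer) (n : ℕ) :
    Fin A.kinds → Box → SP Instr → Prop where
  | base (t : Fin A.kinds) (X : Box) :
      (∀ d, X.len d ≤ 1) → DivideConquer.Unfolds A n t X (A.base n t X)
  | step (t : Fin A.kinds) (X : Box) (f : Piece A.kinds → SP Instr) :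
      (¬ ∀ d, X.len d ≤ 1) →
      (∀ q ∈ (A.divide t X.len).ops, DivideConquer.Unfolds A n q.kind (q.box X) (f q)) →
      DivideConquer.Unfolds A n t X ((A.divide t X.len).bind f)

/-- `A` run on a problem of size `n` (all indices range over `0, …, n`) has the DAG `P`. -/
def DivideConquer.Runs (A : DivideConquer) (n : ℕ) (P : SP Instr) : Prop :=
  A.Unfolds n A.root ⟨fun _ => 0, fun _ => n + 1⟩ P

/-- The constant-branching cache-oblivious (CBCO) paradigm with constant `F`: boundedly many kinds
of tasks, bounded fan-out, base cases of bounded size, and the partition of a task is decided by the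
ratio of its ranges (and by which of them are too short to be split). -/
structure DivideConquer.IsCBCO (A : DivideConquer) (F : ℕ) : Prop where
  kinds_le : A.kinds ≤ F
  fanout_le : ∀ t s, (A.divide t s).work ≤ F
  base_le : ∀ n t X, (A.base n t X).work ≤ F
  cuts : ∀ t s, ∀ q ∈ (A.divide t s).ops, ∀ d,
    0 ≤ q.lower d ∧ q.lower d ≤ q.upper d ∧ q.upper d ≤ 1
  ratio : ∀ t (s s' : Fin 3 → ℕ), (∀ d e, s d * s' e = s' d * s e) → (∀ d, s d ≤ 1 ↔ s' d ≤ 1) →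
    A.divide t s = A.divide t s'

/-! ## The algorithm

`D k j` is kept both at `addr n k j` and, once complete, at the transposed address `addr n j k`, so
that the operands of a product box are contiguous along the middle range. -/

/-! Upper bounds. A triangle of entries consists of two half-size triangles and the square joining
them. A square is completed quadrant by quadrant, starting with the one nearest the diagonal, with
matrix-product-like tasks in between. The critical path of a square meets three of its four
quadrants, whence the exponent `log₂ 3`. The cache behaviour is decided in the product tasks on `a ×
K × c` boxes: the outer ranges are quartered while `K ≤ σ ^ 2 * max a c`, and otherwise the middle
range is halved, with `σ = ω ^ (1 / 3)`. Let `s` be about `√M`. An output block of side `s` stays in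
the cache while about `σ ^ 2 * s` middle indices are processed, so a cell costs about `1 / (σ ^ 2 *
s)` written words. Inside, subtasks with outer side about `s / σ` and middle length about `σ * s`
load `s ^ 2` operand words for `s ^ 3 / σ` cells, so a cell costs about `σ / s` read words. As `ω =
σ ^ 3`, reads and weighted writes both cost `σ * n ^ 3 / (B * s)` up to constants. Each recursion
level of squares and triangles above the cache scale adds `O(n ^ 2 / B)`; this is absorbed when `ω *
√M ≤ n`. The steps are `mulProg_held`, `mulProg_runsIn`, `sqProg_runsIn`, `triProg_runsIn` and
`exists_cacheRun`.

Lower bounds. A correct program is correct in particular for sets of tokens under union, where a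
cell creates its own token from exact inputs only. Tracing tokens backwards shows that, however the
program moves data, different entries occupy different words. Hence, in a segment of the execution,
the number of entries produced or consumed is bounded by the words of the lines it touches, and the
Loomis–Whitney inequality bounds the number of cells. The same instruction sequence is observed in
two caches of sizes `M₁ ≤ M₂`: a segment with somewhat more than `M₂ * √M₁` cells forces either `M₁`
words of writes in the small cache or `M₂` words of reads in the large one (`labels_le_of_cacheRun`,
`cube_le_of_cacheRun`). For `M₂ = σ ^ 2 * M₁` the asymmetric cost cannot be low at both sizes
(`exists_cacheSize_le`); `σ = 1` is the symmetric bound. For the algorithm itself at a given `M`,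
its own read bound at a size `M₂` that is a large constant times `σ ^ 2 * M` excludes the
alternative of many reads, so the writes at `M` must be many (`le_asymCacheCost_triProg`). -/

namespace Paren

/-- The cell `(i, k, j)`, with its right operand read from the transposed copy. -/
def cellI (n i k j : ℕ) : Instr := .cell i k j (addr n i k) (addr n j k) (addr n i j)

/-- Copy the entry `(i, j)` to its transposed position. -/
def copyI (n i j : ℕ) : Instr := .copy (addr n i j) (addr n j i)

open Classical in
/-- The product task on `[i, i+a) × [k, k+K) × [j, j+c)`: the middle range is halved once it exceeds
`ρ` times the outer ones. -/
noncomputable def mulProg (n : ℕ) (ρ : ℝ) (i a k K j c : ℕ) : SP Instr :=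
  if a = 0 ∨ K = 0 ∨ c = 0 then .done
  else if h1 : a ≤ 1 ∧ K ≤ 1 ∧ c ≤ 1 then .op (cellI n i k j)
  else if h2 : 1 < max a c ∧ (K : ℝ) ≤ ρ * (max a c : ℕ) then
    .par (.par (mulProg n ρ i (a / 2) k K j (c / 2))
               (mulProg n ρ i (a / 2) k K (j + c / 2) (c - c / 2)))
         (.par (mulProg n ρ (i + a / 2) (a - a / 2) k K j (c / 2))
               (mulProg n ρ (i + a / 2) (a - a / 2) k K (j + c / 2) (c - c / 2)))
  else if h3 : 1 < K then
    .seq (mulProg n ρ i a k (K / 2) j c) (mulProg n ρ i a (k + K / 2) (K - K / 2) j c)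
  else .done
termination_by a + K + c
decreasing_by all_goals omega

/-- The square task on `[i, i+p) × [j, j+q)`: complete the entries, given all contributions from
middle indices between the two ranges. -/
noncomputable def sqProg (n : ℕ) (ρ : ℝ) (i p j q : ℕ) : SP Instr :=
  if p = 0 ∨ q = 0 then .done
  else if p ≤ 1 ∧ q ≤ 1 then .op (copyI n i j)
  else
    .seq (sqProg n ρ (i + p / 2) (p - p / 2) j (q / 2))
    (.seq
      (.par
        (.seq (mulProg n ρ i (p / 2) (i + p / 2) (p - p / 2) j (q / 2))
              (sqProg n ρ i (p / 2) j (q / 2)))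
        (.seq (mulProg n ρ (i + p / 2) (p - p / 2) j (q / 2) (j + q / 2) (q - q / 2))
              (sqProg n ρ (i + p / 2) (p - p / 2) (j + q / 2) (q - q / 2))))
    (.seq (mulProg n ρ i (p / 2) (i + p / 2) (p - p / 2) (j + q / 2) (q - q / 2))
    (.seq (mulProg n ρ i (p / 2) j (q / 2) (j + q / 2) (q - q / 2))
          (sqProg n ρ i (p / 2) (j + q / 2) (q - q / 2)))))
termination_by p + q
decreasing_by all_goals omega

/-- The triangle task: complete all entries `(i', j')` with `i ≤ i' < j' < i + L`. -/
noncomputable def triProg (n : ℕ) (ρ : ℝ) (i L : ℕ) : SP Instr :=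
  if L ≤ 1 then .done
  else .seq (.par (triProg n ρ i (L / 2)) (triProg n ρ (i + L / 2) (L - L / 2)))
            (sqProg n ρ i (L / 2) (i + L / 2) (L - L / 2))
termination_by L
decreasing_by all_goals omega

/-! ### The program as a run of a divide-and-conquer algorithm -/

/-- The subtask of kind `t` in whose dimension `d` there is the lower (`h d = 0`), upper (`h d = 1`)
half, or the whole (otherwise) of the parent's range `src d`. -/
def part (t : Fin 3) (src h : Fin 3 → Fin 3) : Piece 3 where
  kind := t
  src := src
  lower d := if h d = 1 then 1 / 2 else 0
  upper d := if h d = 0 then 1 / 2 else 1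

open Classical in
/-- How tasks of the kinds `0` (triangle), `1` (square) and `2` (product) are divided. -/
noncomputable def divideParen (ρ : ℝ) (t : Fin 3) (s : Fin 3 → ℕ) : SP (Piece 3) :=
  if ∀ d, s d ≤ 1 then .done
  else if t = 0 then
    .seq (.par (.op (part 0 ![0, 0, 0] ![0, 0, 0])) (.op (part 0 ![0, 0, 0] ![1, 1, 1])))
         (.op (part 1 ![0, 0, 0] ![0, 0, 1]))
  else if t = 1 then
    if s 0 = 0 ∨ s 2 = 0 then .done else
    .seq (.op (part 1 ![0, 0, 2] ![1, 1, 0]))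
    (.seq
      (.par
        (.seq (.op (part 2 ![0, 0, 2] ![0, 1, 0])) (.op (part 1 ![0, 0, 2] ![0, 0, 0])))
        (.seq (.op (part 2 ![0, 2, 2] ![1, 0, 1])) (.op (part 1 ![0, 0, 2] ![1, 1, 1]))))
    (.seq (.op (part 2 ![0, 0, 2] ![0, 1, 1]))
    (.seq (.op (part 2 ![0, 2, 2] ![0, 0, 1])) (.op (part 1 ![0, 0, 2] ![0, 0, 1])))))
  else
    if s 0 = 0 ∨ s 1 = 0 ∨ s 2 = 0 then .done
    else if 1 < max (s 0) (s 2) ∧ (s 1 : ℝ) ≤ ρ * (max (s 0) (s 2) : ℕ) then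
      .par (.par (.op (part 2 ![0, 1, 2] ![0, 2, 0])) (.op (part 2 ![0, 1, 2] ![0, 2, 1])))
           (.par (.op (part 2 ![0, 1, 2] ![1, 2, 0])) (.op (part 2 ![0, 1, 2] ![1, 2, 1])))
    else
      .seq (.op (part 2 ![0, 1, 2] ![2, 0, 2])) (.op (part 2 ![0, 1, 2] ![2, 1, 2]))

/-- The base cases. -/
def baseParen (n : ℕ) (t : Fin 3) (X : Box) : SP Instr :=
  if t = 0 then .done
  else if t = 1 then
    if X.len 0 = 0 ∨ X.len 2 = 0 then .done else .op (copyI n (X.lo 0) (X.lo 2))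
  else
    if X.len 0 = 0 ∨ X.len 1 = 0 ∨ X.len 2 = 0 then .done
    else .op (cellI n (X.lo 0) (X.lo 1) (X.lo 2))

/-- The algorithm with threshold `ρ` for the aspect ratio of the product tasks. -/
noncomputable def algorithm (ρ : ℝ) : DivideConquer where
  kinds := 3
  root := 0
  divide := divideParen ρ
  base := baseParen

/-- A rational cut at one half rounds to the natural-number half, so the boxes agree exactly with
the arguments `a / 2` and `a - a / 2` of the programs. -/
theorem part_box (t : Fin 3) (src h : Fin 3 → Fin 3) (X : Box) :
    (part t src h).box X =
      ⟨fun d => X.lo (src d) + if h d = 1 then X.len (src d) / 2 else 0,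
       fun d => (if h d = 0 then X.len (src d) / 2 else X.len (src d)) -
        if h d = 1 then X.len (src d) / 2 else 0⟩ := by
  have half : ∀ L : ℕ, ⌊(1 / 2 : ℚ) * L⌋₊ = L / 2 := fun L => by
    rw [one_div, mul_comm, ← div_eq_mul_inv]; exact_mod_cast Nat.floor_div_eq_div (K := ℚ) L 2
  simp only [Piece.box, part]
  congr 1 <;> funext d <;> split_ifs <;> simp [half, -one_div]

/-- Equal ratios mean `s' = l * s` with `l > 0`. The comparison of `s 1` with `ρ * max (s 0) (s 2)`
is homogeneous, and emptiness of a range is decided by its ratio to a range longer than one. -/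
theorem divideParen_ratio {ρ : ℝ} {t : Fin 3} {s s' : Fin 3 → ℕ}
    (hr : ∀ d e, s d * s' e = s' d * s e) (h1 : ∀ d, s d ≤ 1 ↔ s' d ≤ 1) :
    divideParen ρ t s = divideParen ρ t s' := by
  by_cases hs : ∀ d, s d ≤ 1
  · have hs' : ∀ d, s' d ≤ 1 := fun d => (h1 d).1 (hs d)
    simp [divideParen, hs, hs']
  have hs' : ¬ ∀ d, s' d ≤ 1 := fun h => hs fun d => (h1 d).2 (h d)
  obtain ⟨e, he⟩ := not_forall.1 hs
  have he' : ¬ s' e ≤ 1 := fun h => he ((h1 e).2 h)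
  have zero : ∀ d, s d = 0 ↔ s' d = 0 := fun d => by
    have := hr d e
    constructor <;> intro h <;> rw [h] at this <;> simp at this <;> omega
  have big : 1 < max (s 0) (s 2) ↔ 1 < max (s' 0) (s' 2) := by
    have h0 := h1 0
    have h2 := h1 2
    simp only [lt_max_iff]
    omega
  have e0 : (0 : ℝ) < s e := by exact_mod_cast (by omega : 0 < s e)
  have e0' : (0 : ℝ) < s' e := by exact_mod_cast (by omega : 0 < s' e)
  obtain ⟨l, hl, hsl⟩ : ∃ l : ℝ, 0 < l ∧ ∀ d, (s' d : ℝ) = l * s d := by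
    refine ⟨s' e / s e, by positivity, fun d => ?_⟩
    have : (s d : ℝ) * s' e = s' d * s e := by exact_mod_cast hr d e
    field_simp
    linarith
  have thr : ((s 1 : ℝ) ≤ ρ * (max (s 0) (s 2) : ℕ)) ↔
      ((s' 1 : ℝ) ≤ ρ * (max (s' 0) (s' 2) : ℕ)) := by
    push_cast
    rw [hsl, hsl, hsl, ← mul_max_of_nonneg _ _ hl.le, mul_left_comm]
    exact (mul_le_mul_iff_right₀ hl).symm
  simp only [divideParen, hs, hs', zero, big, thr]

theorem divideParen_cuts {ρ : ℝ} {t : Fin 3} {s : Fin 3 → ℕ} {q : Piece 3}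
    (hq : q ∈ (divideParen ρ t s).ops) (d : Fin 3) :
    0 ≤ q.lower d ∧ q.lower d ≤ q.upper d ∧ q.upper d ≤ 1 := by
  have key : ∀ (t : Fin 3) (src h : Fin 3 → Fin 3), 0 ≤ (part t src h).lower d ∧
      (part t src h).lower d ≤ (part t src h).upper d ∧ (part t src h).upper d ≤ 1 := by
    intro t src h
    simp only [part]
    split_ifs with h1 h2 h2
    · rw [h1] at h2; exact absurd h2 (by decide)
    all_goals norm_num
  revert hq
  simp only [divideParen]
  split_ifs <;> simp only [SP.ops, List.not_mem_nil, List.cons_append, List.nil_append,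
    List.mem_cons, or_false, IsEmpty.forall_iff]
  all_goals intro hq
  · rcases hq with rfl | rfl | rfl <;> apply key
  · rcases hq with rfl | rfl | rfl | rfl | rfl | rfl | rfl | rfl <;> apply key
  · rcases hq with rfl | rfl | rfl | rfl <;> apply key
  · rcases hq with rfl | rfl <;> apply key

theorem algorithm_isCBCO (ρ : ℝ) : (algorithm ρ).IsCBCO 9 where
  kinds_le := by simp [algorithm]
  fanout_le t s := by
    simp only [algorithm, divideParen]
    split_ifs <;> simp [SP.work]
  base_le n t X := by
    simp only [algorithm, baseParen]
    split_ifs <;> simp [SP.work]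
  cuts t s q hq d := divideParen_cuts hq d
  ratio t s s' := divideParen_ratio

/-- The program of a task. -/
noncomputable def taskProg (n : ℕ) (ρ : ℝ) (t : Fin 3) (X : Box) : SP Instr :=
  if t = 0 then triProg n ρ (X.lo 0) (X.len 0)
  else if t = 1 then sqProg n ρ (X.lo 0) (X.len 0) (X.lo 2) (X.len 2)
  else mulProg n ρ (X.lo 0) (X.len 0) (X.lo 1) (X.len 1) (X.lo 2) (X.len 2)

/-- This makes the last branch of `mulProg` unreachable: a middle range of length one never exceeds
`ρ` times an outer range longer than one. -/
theorem one_lt_middle {ρ : ℝ} (hρ : 1 ≤ ρ) {a K c : ℕ} (_h0 : ¬ (a = 0 ∨ K = 0 ∨ c = 0))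
    (h1 : ¬ (a ≤ 1 ∧ K ≤ 1 ∧ c ≤ 1)) (h2 : ¬ (1 < max a c ∧ (K : ℝ) ≤ ρ * (max a c : ℕ))) :
    1 < K := by
  by_contra hK
  have hm : 1 < max a c := by rw [lt_max_iff]; omega
  refine h2 ⟨hm, ?_⟩
  have hK1 : (K : ℝ) ≤ (max a c : ℕ) := by exact_mod_cast (by omega : K ≤ max a c)
  nlinarith [(Nat.cast_nonneg (max a c) : (0 : ℝ) ≤ _)]

/-- A triangle has one genuine range and a square two, while a `Box` has three. The idle ranges are
kept equal to range `0`, so that they do not delay the base case; the pieces inherit this invariant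
along with the decreasing measure. -/
theorem divideParen_sub {ρ : ℝ} (hρ : 1 ≤ ρ) {t : Fin 3} {X : Box} (hb : ¬ ∀ d, X.len d ≤ 1)
    (h1 : t = 1 → X.len 1 = X.len 0) (h0 : t = 0 → X.len 1 = X.len 0 ∧ X.len 2 = X.len 0)
    {q : Piece 3} (hq : q ∈ (divideParen ρ t X.len).ops) :
    (q.box X).len 0 + (q.box X).len 1 + (q.box X).len 2 < X.len 0 + X.len 1 + X.len 2 ∧
    (q.kind = 1 → (q.box X).len 1 = (q.box X).len 0) ∧
    (q.kind = 0 → (q.box X).len 1 = (q.box X).len 0 ∧ (q.box X).len 2 = (q.box X).len 0) := by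
  have hb' : ¬ (X.len 0 ≤ 1 ∧ X.len 1 ≤ 1 ∧ X.len 2 ≤ 1) := fun h => hb fun d => by
    fin_cases d
    exacts [h.1, h.2.1, h.2.2]
  revert hq
  simp only [divideParen, hb, if_false]
  split_ifs with ht ht hz hz hk
  · obtain ⟨e1, e2⟩ := h0 ht
    simp only [SP.ops, List.cons_append, List.nil_append, List.mem_cons, List.not_mem_nil,
      or_false]
    rintro (rfl | rfl | rfl) <;> refine ⟨?_, ?_, ?_⟩ <;> simp [part_box] <;>
      (try simp [part]) <;> omega
  · simp [SP.ops]
  · have e1 := h1 ht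
    simp only [SP.ops, List.cons_append, List.nil_append, List.mem_cons, List.not_mem_nil,
      or_false]
    rintro (rfl | rfl | rfl | rfl | rfl | rfl | rfl | rfl) <;> refine ⟨?_, ?_, ?_⟩ <;>
      simp [part_box] <;> (try simp [part]) <;> omega
  · simp [SP.ops]
  · have hk1 : 1 < X.len 0 ∨ 1 < X.len 2 := lt_max_iff.1 hk.1
    simp only [SP.ops, List.cons_append, List.nil_append, List.mem_cons, List.not_mem_nil,
      or_false]
    rintro (rfl | rfl | rfl | rfl) <;> refine ⟨?_, ?_, ?_⟩ <;> simp [part_box] <;>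
      (try simp [part]) <;> omega
  · have hK : 1 < X.len 1 := one_lt_middle hρ hz hb' hk
    simp only [SP.ops, List.cons_append, List.nil_append, List.mem_cons, List.not_mem_nil,
      or_false]
    rintro (rfl | rfl) <;> refine ⟨?_, ?_, ?_⟩ <;> simp [part_box] <;>
      (try simp [part]) <;> omega

theorem unfolds_task (n : ℕ) {ρ : ℝ} (hρ : 1 ≤ ρ) (N : ℕ) : ∀ (t : Fin 3) (X : Box),
    X.len 0 + X.len 1 + X.len 2 < N → (t = 1 → X.len 1 = X.len 0) →
    (t = 0 → X.len 1 = X.len 0 ∧ X.len 2 = X.len 0) →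
    (algorithm ρ).Unfolds n t X (taskProg n ρ t X) := by
  induction N with
  | zero => intro t X h; omega
  | succ N ih =>
    intro t X hN h1 h0
    by_cases hb : ∀ d, X.len d ≤ 1
    · have h := DivideConquer.Unfolds.base (A := algorithm ρ) (n := n) t X hb
      have e : taskProg n ρ t X = baseParen n t X := by
        have b0 := hb 0
        have b1 := hb 1
        have b2 := hb 2
        unfold taskProg baseParen
        split_ifs with ht ht
        · rw [triProg, if_pos b0]
        · next h => rw [sqProg, if_pos h]
        · next h => rw [sqProg, if_neg h, if_pos ⟨b0, b2⟩]
        · next h => rw [mulProg, if_pos h]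
        · next h => rw [mulProg, if_neg h, dif_pos ⟨b0, b1, b2⟩]
      rw [e]
      exact h
    · have h := DivideConquer.Unfolds.step (A := algorithm ρ) (n := n) t X
        (fun q => taskProg n ρ q.kind (q.box X)) hb
      have e : taskProg n ρ t X =
          (divideParen ρ t X.len).bind fun q => taskProg n ρ q.kind (q.box X) := by
        have hb' : ¬ (X.len 0 ≤ 1 ∧ X.len 1 ≤ 1 ∧ X.len 2 ≤ 1) := fun h => hb fun d => by
          fin_cases d
          exacts [h.1, h.2.1, h.2.2]
        unfold divideParen
        rw [if_neg hb]
        split_ifs with ht ht hz hz hk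
        · subst ht
          obtain ⟨e1, e2⟩ := h0 rfl
          have hL : ¬ X.len 0 ≤ 1 := by omega
          rw [taskProg, if_pos rfl, triProg, if_neg hL]
          simp [SP.bind, taskProg, part_box]
          simp [part]
        · subst ht
          rw [taskProg, if_neg (by decide : ¬ (1 : Fin 3) = 0), if_pos rfl, sqProg, if_pos hz, SP.bind]
        · subst ht
          have e1 := h1 rfl
          have hL : ¬ (X.len 0 ≤ 1 ∧ X.len 2 ≤ 1) := by omega
          rw [taskProg, if_neg (by decide : ¬ (1 : Fin 3) = 0), if_pos rfl, sqProg, if_neg hz, if_neg hL]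
          simp [SP.bind, taskProg, part_box]
          simp [part]
        · rw [taskProg, if_neg, if_neg, mulProg, if_pos hz, SP.bind] <;> assumption
        · rw [taskProg, if_neg, if_neg, mulProg, if_neg hz, dif_neg hb', dif_pos hk]
          · simp [SP.bind, taskProg, part_box]
            simp [part]
          all_goals assumption
        · have hK : 1 < X.len 1 := one_lt_middle hρ hz hb' hk
          rw [taskProg, if_neg, if_neg, mulProg, if_neg hz, dif_neg hb', dif_neg hk, dif_pos hK]
          · simp [SP.bind, taskProg, part_box]
            simp [part]
          all_goals assumption
      rw [e]
      apply h
      intro q hq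
      obtain ⟨g, g1, g0⟩ := divideParen_sub hρ hb h1 h0 hq
      exact ih _ _ (g.trans_le (Nat.lt_succ_iff.1 hN)) g1 g0

theorem algorithm_runs {ρ : ℝ} (hρ : 1 ≤ ρ) (n : ℕ) : (algorithm ρ).Runs n (triProg n ρ 0 (n + 1)) :=
  unfolds_task n hρ _ 0 ⟨fun _ => 0, fun _ => n + 1⟩ (Nat.lt_succ_self _) (by simp) (by simp)

/-! ### Induction principles -/

theorem exists_halves (a : ℕ) : ∃ x y, a = x + y ∧ a / 2 = x ∧ x ≤ y ∧ y ≤ x + 1 :=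
  ⟨a / 2, a - a / 2, by omega, rfl, by omega, by omega⟩

/-- Halves appear as summands `a ≤ b ≤ a + 1`, which removes division from all later inductions.
Only the larger halves are known to be nonempty, since an outer range of length one splits as `0 +
1`. The split conditions are passed on because they control the aspect ratio. The variant
`mulProg_rec` serves for facts about the program itself. -/
theorem mulProg_induction {n : ℕ} {ρ : ℝ} (hρ : 1 ≤ ρ) {motive : ℕ → ℕ → ℕ → ℕ → ℕ → ℕ → Prop}
    (empty : ∀ i a k K j c, a = 0 ∨ K = 0 ∨ c = 0 → mulProg n ρ i a k K j c = .done →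
      motive i a k K j c)
    (single : ∀ i k j, mulProg n ρ i 1 k 1 j 1 = .op (cellI n i k j) → motive i 1 k 1 j 1)
    (outer : ∀ i a b k K j c d : ℕ, a ≤ b → b ≤ a + 1 → c ≤ d → d ≤ c + 1 → 0 < b → 0 < K →
      0 < d → 1 < max (a + b) (c + d) → (K : ℝ) ≤ ρ * (max (a + b) (c + d) : ℕ) →
      mulProg n ρ i (a + b) k K j (c + d) =
        .par (.par (mulProg n ρ i a k K j c) (mulProg n ρ i a k K (j + c) d))
          (.par (mulProg n ρ (i + a) b k K j c) (mulProg n ρ (i + a) b k K (j + c) d)) →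
      motive i a k K j c → motive i a k K (j + c) d → motive (i + a) b k K j c →
      motive (i + a) b k K (j + c) d → motive i (a + b) k K j (c + d))
    (middle : ∀ i a k K L j c : ℕ, K ≤ L → L ≤ K + 1 → 0 < K → 0 < a → 0 < c →
      max a c ≤ 1 ∨ ρ * (max a c : ℕ) < (K + L : ℕ) →
      mulProg n ρ i a k (K + L) j c =
        .seq (mulProg n ρ i a k K j c) (mulProg n ρ i a (k + K) L j c) →
      motive i a k K j c → motive i a (k + K) L j c → motive i a k (K + L) j c)
    (i a k K j c : ℕ) : motive i a k K j c := by
  induction h : a + K + c using Nat.strong_induction_on generalizing i a k K j c with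
  | _ N ih =>
    subst h
    have e := mulProg.eq_def n ρ i a k K j c
    split_ifs at e with h0 h1 h2 h3
    · exact empty _ _ _ _ _ _ h0 e
    · obtain ⟨rfl, rfl, rfl⟩ : a = 1 ∧ K = 1 ∧ c = 1 := by omega
      exact single _ _ _ e
    · have h2' := lt_max_iff.1 h2.1
      obtain ⟨x, y, rfl, hx, hxy, hyx⟩ := exists_halves a
      obtain ⟨z, w, rfl, hz, hzw, hwz⟩ := exists_halves c
      rw [hx, hz, Nat.add_sub_cancel_left, Nat.add_sub_cancel_left] at e
      refine outer _ _ _ _ _ _ _ _ hxy hyx hzw hwz (by omega) (by omega) (by omega) h2.1 h2.2 e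
        ?_ ?_ ?_ ?_ <;> exact ih _ (by omega) _ _ _ _ _ _ rfl
    · obtain ⟨x, y, rfl, hx, hxy, hyx⟩ := exists_halves K
      rw [hx, Nat.add_sub_cancel_left] at e
      refine middle _ _ _ _ _ _ _ hxy hyx (by omega) (by omega) (by omega) ?_ e ?_ ?_
      · by_cases hm : 1 < max a c
        · exact Or.inr (not_le.1 fun h => h2 ⟨hm, h⟩)
        · exact Or.inl (not_lt.1 hm)
      all_goals exact ih _ (by omega) _ _ _ _ _ _ rfl
    · exact absurd (one_lt_middle hρ h0 h1 h2) h3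

theorem mulProg_rec {n : ℕ} {ρ : ℝ} (hρ : 1 ≤ ρ) {motive : ℕ → ℕ → ℕ → ℕ → ℕ → ℕ → SP Instr → Prop}
    (empty : ∀ i a k K j c, a = 0 ∨ K = 0 ∨ c = 0 → motive i a k K j c .done)
    (single : ∀ i k j, motive i 1 k 1 j 1 (.op (cellI n i k j)))
    (outer : ∀ (i a b k K j c d : ℕ) P Q R S, a ≤ b → b ≤ a + 1 → c ≤ d → d ≤ c + 1 → 0 < b →
      0 < K → 0 < d → 1 < max (a + b) (c + d) → (K : ℝ) ≤ ρ * (max (a + b) (c + d) : ℕ) →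
      motive i a k K j c P → motive i a k K (j + c) d Q → motive (i + a) b k K j c R →
      motive (i + a) b k K (j + c) d S →
      motive i (a + b) k K j (c + d) (.par (.par P Q) (.par R S)))
    (middle : ∀ (i a k K L j c : ℕ) P Q, K ≤ L → L ≤ K + 1 → 0 < K → 0 < a → 0 < c →
      max a c ≤ 1 ∨ ρ * (max a c : ℕ) < (K + L : ℕ) →
      motive i a k K j c P → motive i a (k + K) L j c Q →
      motive i a k (K + L) j c (.seq P Q))
    (i a k K j c : ℕ) : motive i a k K j c (mulProg n ρ i a k K j c) := by
  induction i, a, k, K, j, c using mulProg_induction (n := n) hρ with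
  | empty i a k K j c h e => exact e ▸ empty _ _ _ _ _ _ h
  | single i k j e => exact e ▸ single _ _ _
  | outer i a b k K j c d h1 h2 h3 h4 h5 h6 h7 h8 h9 e hP hQ hR hS =>
    exact e ▸ outer _ _ _ _ _ _ _ _ _ _ _ _ h1 h2 h3 h4 h5 h6 h7 h8 h9 hP hQ hR hS
  | middle i a k K L j c h1 h2 h3 h4 h5 h6 e hP hQ =>
    exact e ▸ middle _ _ _ _ _ _ _ _ _ h1 h2 h3 h4 h5 h6 hP hQ

theorem sqProg_induction {n : ℕ} {ρ : ℝ} {motive : ℕ → ℕ → ℕ → ℕ → Prop}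
    (empty : ∀ i p j q, p = 0 ∨ q = 0 → sqProg n ρ i p j q = .done → motive i p j q)
    (single : ∀ i j, sqProg n ρ i 1 j 1 = .op (copyI n i j) → motive i 1 j 1)
    (split : ∀ i a b j c d : ℕ, a ≤ b → b ≤ a + 1 → c ≤ d → d ≤ c + 1 → 0 < b → 0 < d →
      1 < max (a + b) (c + d) →
      sqProg n ρ i (a + b) j (c + d) =
        .seq (sqProg n ρ (i + a) b j c)
          (.seq (.par (.seq (mulProg n ρ i a (i + a) b j c) (sqProg n ρ i a j c))
            (.seq (mulProg n ρ (i + a) b j c (j + c) d) (sqProg n ρ (i + a) b (j + c) d)))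
          (.seq (mulProg n ρ i a (i + a) b (j + c) d)
            (.seq (mulProg n ρ i a j c (j + c) d) (sqProg n ρ i a (j + c) d)))) →
      motive i a j c → motive i a (j + c) d → motive (i + a) b j c →
      motive (i + a) b (j + c) d → motive i (a + b) j (c + d))
    (i p j q : ℕ) : motive i p j q := by
  induction h : p + q using Nat.strong_induction_on generalizing i p j q with
  | _ N ih =>
    subst h
    have e := sqProg.eq_def n ρ i p j q
    split_ifs at e with h0 h1
    · exact empty _ _ _ _ h0 e
    · obtain ⟨rfl, rfl⟩ : p = 1 ∧ q = 1 := by omega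
      exact single _ _ e
    · obtain ⟨x, y, rfl, hx, hxy, hyx⟩ := exists_halves p
      obtain ⟨z, w, rfl, hz, hzw, hwz⟩ := exists_halves q
      rw [hx, hz, Nat.add_sub_cancel_left, Nat.add_sub_cancel_left] at e
      refine split _ _ _ _ _ _ hxy hyx hzw hwz (by omega) (by omega)
        (lt_max_iff.2 (by omega)) e ?_ ?_ ?_ ?_ <;> exact ih _ (by omega) _ _ _ _ rfl

theorem sqProg_rec {n : ℕ} {ρ : ℝ} {motive : ℕ → ℕ → ℕ → ℕ → SP Instr → Prop}
    (empty : ∀ i p j q, p = 0 ∨ q = 0 → motive i p j q .done)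
    (single : ∀ i j, motive i 1 j 1 (.op (copyI n i j)))
    (split : ∀ i a b j c d P Q R S, a ≤ b → b ≤ a + 1 → c ≤ d → d ≤ c + 1 → 0 < b → 0 < d →
      1 < max (a + b) (c + d) →
      P = sqProg n ρ i a j c → Q = sqProg n ρ i a (j + c) d → R = sqProg n ρ (i + a) b j c →
      S = sqProg n ρ (i + a) b (j + c) d →
      motive i a j c P → motive i a (j + c) d Q → motive (i + a) b j c R →
      motive (i + a) b (j + c) d S →
      motive i (a + b) j (c + d)
        (.seq R (.seq (.par (.seq (mulProg n ρ i a (i + a) b j c) P)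
          (.seq (mulProg n ρ (i + a) b j c (j + c) d) S))
          (.seq (mulProg n ρ i a (i + a) b (j + c) d) (.seq (mulProg n ρ i a j c (j + c) d) Q)))))
    (i p j q : ℕ) : motive i p j q (sqProg n ρ i p j q) := by
  induction i, p, j, q using sqProg_induction (n := n) (ρ := ρ) with
  | empty i p j q h e => exact e ▸ empty _ _ _ _ h
  | single i j e => exact e ▸ single _ _
  | split i a b j c d h1 h2 h3 h4 h5 h6 h7 e hP hQ hR hS =>
    exact e ▸ split _ _ _ _ _ _ _ _ _ _ h1 h2 h3 h4 h5 h6 h7 rfl rfl rfl rfl hP hQ hR hS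

theorem triProg_induction {n : ℕ} {ρ : ℝ} {motive : ℕ → ℕ → Prop}
    (small : ∀ i L, L ≤ 1 → triProg n ρ i L = .done → motive i L)
    (split : ∀ i a b, a ≤ b → b ≤ a + 1 → 0 < a →
      triProg n ρ i (a + b) =
        .seq (.par (triProg n ρ i a) (triProg n ρ (i + a) b)) (sqProg n ρ i a (i + a) b) →
      motive i a → motive (i + a) b → motive i (a + b))
    (i L : ℕ) : motive i L := by
  induction h : L using Nat.strong_induction_on generalizing i L with
  | _ N ih =>
    subst h
    have e := triProg.eq_def n ρ i L
    split_ifs at e with h0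
    · exact small _ _ h0 e
    · obtain ⟨x, y, rfl, hx, hxy, hyx⟩ := exists_halves L
      rw [hx, Nat.add_sub_cancel_left] at e
      refine split _ _ _ hxy hyx (by omega) e ?_ ?_ <;> exact ih _ (by omega) _ _ rfl

theorem triProg_rec {n : ℕ} {ρ : ℝ} {motive : ℕ → ℕ → SP Instr → Prop}
    (small : ∀ i L, L ≤ 1 → motive i L .done)
    (split : ∀ i a b P Q, a ≤ b → b ≤ a + 1 → 0 < a → P = triProg n ρ i a →
      Q = triProg n ρ (i + a) b → motive i a P → motive (i + a) b Q →
      motive i (a + b) (.seq (.par P Q) (sqProg n ρ i a (i + a) b)))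
    (i L : ℕ) : motive i L (triProg n ρ i L) := by
  induction i, L using triProg_induction (n := n) (ρ := ρ) with
  | small i L h e => exact e ▸ small _ _ h
  | split i a b h1 h2 h3 e hP hQ => exact e ▸ split _ _ _ _ _ h1 h2 h3 rfl rfl hP hQ

/-! ### The instructions of the tasks -/

theorem cellI_inj {n i k j i' k' j' : ℕ} :
    cellI n i k j = cellI n i' k' j' ↔ i = i' ∧ k = k' ∧ j = j' := by
  constructor
  · intro h
    simp only [cellI, Instr.cell.injEq] at h
    exact ⟨h.1, h.2.1, h.2.2.1⟩
  · rintro ⟨rfl, rfl, rfl⟩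
    rfl

theorem mulProg_ops {n : ℕ} {ρ : ℝ} (hρ : 1 ≤ ρ) (i a k K j c : ℕ) :
    (∀ x ∈ (mulProg n ρ i a k K j c).ops, ∃ i' k' j', x = cellI n i' k' j') ∧
    ∀ i' k' j', cellI n i' k' j' ∈ (mulProg n ρ i a k K j c).ops ↔
      (i ≤ i' ∧ i' < i + a) ∧ (k ≤ k' ∧ k' < k + K) ∧ (j ≤ j' ∧ j' < j + c) := by
  induction i, a, k, K, j, c using mulProg_rec (n := n) hρ with
  | empty i a k K j c h => 
    refine ⟨by simp [SP.ops], fun i' k' j' => ?_⟩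
    simp only [SP.ops, List.not_mem_nil, false_iff]
    omega
  | single i k j =>
    refine ⟨by simp only [SP.ops, List.mem_singleton]; exact fun x hx => ⟨_, _, _, hx⟩, ?_⟩
    intro i' k' j'
    simp only [SP.ops, List.mem_singleton, cellI_inj]
    omega
  | outer i a b k K j c d P Q R S _ _ _ _ _ _ _ _ _ hP hQ hR hS =>
    refine ⟨?_, fun i' k' j' => ?_⟩
    · simp only [SP.ops, List.mem_append]
      rintro x ((h | h) | h | h)
      exacts [hP.1 x h, hQ.1 x h, hR.1 x h, hS.1 x h]
    · simp only [SP.ops, List.mem_append, hP.2, hQ.2, hR.2, hS.2]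
      omega
  | middle i a k K L j c P Q _ _ _ _ _ _ hP hQ =>
    refine ⟨?_, fun i' k' j' => ?_⟩
    · simp only [SP.ops, List.mem_append]
      rintro x (h | h)
      exacts [hP.1 x h, hQ.1 x h]
    · simp only [SP.ops, List.mem_append, hP.2, hQ.2]
      omega

theorem mem_mulProg {n : ℕ} {ρ : ℝ} (hρ : 1 ≤ ρ) {i a k K j c : ℕ} {x : Instr} :
    x ∈ (mulProg n ρ i a k K j c).ops ↔ ∃ i' k' j', ((i ≤ i' ∧ i' < i + a) ∧
      (k ≤ k' ∧ k' < k + K) ∧ (j ≤ j' ∧ j' < j + c)) ∧ x = cellI n i' k' j' := by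
  constructor
  · intro h
    obtain ⟨i', k', j', rfl⟩ := (mulProg_ops hρ i a k K j c).1 x h
    exact ⟨i', k', j', ((mulProg_ops hρ i a k K j c).2 _ _ _).1 h, rfl⟩
  · rintro ⟨i', k', j', h, rfl⟩
    exact ((mulProg_ops hρ i a k K j c).2 _ _ _).2 h

/-- The cells evaluated by the square task on `[i, i+p) × [j, j+q)`. -/
def SqCell (i p j q i' k' j' : ℕ) : Prop :=
  (i ≤ i' ∧ i' < i + p) ∧ (j ≤ j' ∧ j' < j + q) ∧ ((i' < k' ∧ k' < i + p) ∨ (j ≤ k' ∧ k' < j'))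

theorem sqProg_ops {n : ℕ} {ρ : ℝ} (hρ : 1 ≤ ρ) (i p j q : ℕ) (hij : i + p ≤ j) :
    (∀ x ∈ (sqProg n ρ i p j q).ops, (∃ i' k' j', SqCell i p j q i' k' j' ∧ x = cellI n i' k' j') ∨
      ∃ i' j', ((i ≤ i' ∧ i' < i + p) ∧ j ≤ j' ∧ j' < j + q) ∧ x = copyI n i' j') ∧
    (∀ i' k' j', SqCell i p j q i' k' j' → cellI n i' k' j' ∈ (sqProg n ρ i p j q).ops) ∧
    (∀ i' j', ((i ≤ i' ∧ i' < i + p) ∧ j ≤ j' ∧ j' < j + q) →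
      copyI n i' j' ∈ (sqProg n ρ i p j q).ops) := by
  revert hij
  induction i, p, j, q using sqProg_rec (n := n) (ρ := ρ) with
  | empty i p j q h =>
    intro hij
    refine ⟨by simp [SP.ops], fun i' k' j' h' => ?_, fun i' j' h' => ?_⟩
    · unfold SqCell at h'; omega
    · omega
  | single i j =>
    intro hij
    refine ⟨fun x hx => Or.inr ⟨i, j, by omega, List.mem_singleton.1 hx⟩, fun i' k' j' h' => ?_,
      fun i' j' h' => ?_⟩
    · unfold SqCell at h'; omega
    · obtain ⟨rfl, rfl⟩ : i' = i ∧ j' = j := by omega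
      simp [SP.ops]
  | split i a b j c d P Q R S _ _ _ _ _ _ _ _ _ _ _ hP hQ hR hS =>
    intro hij
    obtain ⟨P1, P2, P3⟩ := hP (by omega)
    obtain ⟨Q1, Q2, Q3⟩ := hQ (by omega)
    obtain ⟨R1, R2, R3⟩ := hR (by omega)
    obtain ⟨S1, S2, S3⟩ := hS (by omega)
    simp only [SP.ops, List.mem_append]
    refine ⟨fun x hx => ?_, fun i' k' j' h' => ?_, fun i' j' h' => ?_⟩
    · have cells : ∀ {i' k' j'}, SqCell i (a + b) j (c + d) i' k' j' → x = cellI n i' k' j' →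
          (∃ i' k' j', SqCell i (a + b) j (c + d) i' k' j' ∧ x = cellI n i' k' j') ∨
          ∃ i' j', ((i ≤ i' ∧ i' < i + (a + b)) ∧ j ≤ j' ∧ j' < j + (c + d)) ∧ x = copyI n i' j' :=
        fun h e => Or.inl ⟨_, _, _, h, e⟩
      have muls : ∀ {i1 a1 k1 K1 j1 c1}, x ∈ (mulProg n ρ i1 a1 k1 K1 j1 c1).ops →
          (∀ i' k' j', ((i1 ≤ i' ∧ i' < i1 + a1) ∧ (k1 ≤ k' ∧ k' < k1 + K1) ∧
            (j1 ≤ j' ∧ j' < j1 + c1)) → SqCell i (a + b) j (c + d) i' k' j') →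
          (∃ i' k' j', SqCell i (a + b) j (c + d) i' k' j' ∧ x = cellI n i' k' j') ∨
          ∃ i' j', ((i ≤ i' ∧ i' < i + (a + b)) ∧ j ≤ j' ∧ j' < j + (c + d)) ∧ x = copyI n i' j' := by
        intro i1 a1 k1 K1 j1 c1 h hsub
        obtain ⟨i', k', j', h, e⟩ := (mem_mulProg hρ).1 h
        exact cells (hsub _ _ _ h) e
      rcases hx with hx | ((hx | hx) | hx | hx) | hx | hx | hx
      · rcases R1 x hx with ⟨i', k', j', h, e⟩ | ⟨i', j', h, e⟩
        · exact cells (by unfold SqCell at *; omega) e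
        · exact Or.inr ⟨i', j', by omega, e⟩
      · exact muls hx (by unfold SqCell; omega)
      · rcases P1 x hx with ⟨i', k', j', h, e⟩ | ⟨i', j', h, e⟩
        · exact cells (by unfold SqCell at *; omega) e
        · exact Or.inr ⟨i', j', by omega, e⟩
      · exact muls hx (by unfold SqCell; omega)
      · rcases S1 x hx with ⟨i', k', j', h, e⟩ | ⟨i', j', h, e⟩
        · exact cells (by unfold SqCell at *; omega) e
        · exact Or.inr ⟨i', j', by omega, e⟩
      · exact muls hx (by unfold SqCell; omega)
      · exact muls hx (by unfold SqCell; omega)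
      · rcases Q1 x hx with ⟨i', k', j', h, e⟩ | ⟨i', j', h, e⟩
        · exact cells (by unfold SqCell at *; omega) e
        · exact Or.inr ⟨i', j', by omega, e⟩
    · have p2 := P2 i' k' j'
      have q2 := Q2 i' k' j'
      have r2 := R2 i' k' j'
      have s2 := S2 i' k' j'
      simp only [(mulProg_ops hρ _ _ _ _ _ _).2]
      unfold SqCell at *
      -- The quadrant of the entry decides who evaluates the cell: middle indices within the
      -- quadrant's own ranges belong to its square task, the others to the products run before it
      -- (none for the near quadrant, two for the far one).
      rcases lt_or_ge i' (i + a) with hi | hi <;> rcases lt_or_ge j' (j + c) with hj | hj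
      · by_cases hk : i + a ≤ k' ∧ k' < j
        · right; left; left; left; omega
        · right; left; left; right; exact p2 (by omega)
      · by_cases hk : i + a ≤ k' ∧ k' < j
        · right; right; left; omega
        · by_cases hk : j ≤ k' ∧ k' < j + c
          · right; right; right; left; omega
          · right; right; right; right; exact q2 (by omega)
      · left; exact r2 (by omega)
      · by_cases hk : j ≤ k' ∧ k' < j + c
        · right; left; right; left; omega
        · right; left; right; right; exact s2 (by omega)
    · rcases lt_or_ge i' (i + a) with hi | hi <;> rcases lt_or_ge j' (j + c) with hj | hj
      · exact Or.inr (Or.inl (Or.inl (Or.inr (P3 i' j' (by omega)))))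
      · exact Or.inr (Or.inr (Or.inr (Or.inr (Q3 i' j' (by omega)))))
      · exact Or.inl (R3 i' j' (by omega))
      · exact Or.inr (Or.inl (Or.inr (Or.inr (S3 i' j' (by omega)))))

theorem triProg_ops {n : ℕ} {ρ : ℝ} (hρ : 1 ≤ ρ) (i L : ℕ) :
    (∀ x ∈ (triProg n ρ i L).ops,
      (∃ i' k' j', (i ≤ i' ∧ i' < k' ∧ k' < j' ∧ j' < i + L) ∧ x = cellI n i' k' j') ∨
      ∃ i' j', (i ≤ i' ∧ i' < j' ∧ j' < i + L) ∧ x = copyI n i' j') ∧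
    (∀ i' k' j', (i ≤ i' ∧ i' < k' ∧ k' < j' ∧ j' < i + L) →
      cellI n i' k' j' ∈ (triProg n ρ i L).ops) ∧
    (∀ i' j', (i ≤ i' ∧ i' < j' ∧ j' < i + L) → copyI n i' j' ∈ (triProg n ρ i L).ops) := by
  induction i, L using triProg_rec (n := n) (ρ := ρ) with
  | small i L h => 
    refine ⟨by simp [SP.ops], ?_, ?_⟩ <;> intros <;> omega
  | split i a b P Q _ _ _ _ _ hP hQ =>
    obtain ⟨P1, P2, P3⟩ := hP
    obtain ⟨Q1, Q2, Q3⟩ := hQ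
    obtain ⟨S1, S2, S3⟩ := sqProg_ops (n := n) hρ i a (i + a) b le_rfl
    simp only [SP.ops, List.mem_append]
    refine ⟨fun x hx => ?_, fun i' k' j' h' => ?_, fun i' j' h' => ?_⟩
    · rcases hx with (hx | hx) | hx
      · rcases P1 x hx with ⟨i', k', j', h, e⟩ | ⟨i', j', h, e⟩
        · exact Or.inl ⟨i', k', j', by omega, e⟩
        · exact Or.inr ⟨i', j', by omega, e⟩
      · rcases Q1 x hx with ⟨i', k', j', h, e⟩ | ⟨i', j', h, e⟩
        · exact Or.inl ⟨i', k', j', by omega, e⟩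
        · exact Or.inr ⟨i', j', by omega, e⟩
      · rcases S1 x hx with ⟨i', k', j', h, e⟩ | ⟨i', j', h, e⟩
        · exact Or.inl ⟨i', k', j', by unfold SqCell at h; omega, e⟩
        · exact Or.inr ⟨i', j', by omega, e⟩
    · by_cases h1 : j' < i + a
      · exact Or.inl (Or.inl (P2 _ _ _ (by omega)))
      · by_cases h2 : i + a ≤ i'
        · exact Or.inl (Or.inr (Q2 _ _ _ (by omega)))
        · exact Or.inr (S2 _ _ _ (by unfold SqCell; omega))
    · by_cases h1 : j' < i + a
      · exact Or.inl (Or.inl (P3 _ _ (by omega)))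
      · by_cases h2 : i + a ≤ i'
        · exact Or.inl (Or.inr (Q3 _ _ (by omega)))
        · exact Or.inr (S3 _ _ (by omega))

/-! ### Each cell is evaluated once -/

theorem ite_range_add (lo a b x : ℕ) : (if lo ≤ x ∧ x < lo + (a + b) then 1 else 0 : ℕ) =
    (if lo ≤ x ∧ x < lo + a then 1 else 0) + if lo + a ≤ x ∧ x < lo + a + b then 1 else 0 := by
  split_ifs <;> omega

/-- The indicator of a box is a product of three interval indicators. A split adds the indicators of
adjacent intervals, so the induction is the distributive law. -/
theorem mulProg_count {n : ℕ} {ρ : ℝ} (hρ : 1 ≤ ρ) (i a k K j c i' k' j' : ℕ) :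
    ((mulProg n ρ i a k K j c).ops.filterMap Instr.label).count (i', k', j') =
      if (i ≤ i' ∧ i' < i + a) ∧ (k ≤ k' ∧ k' < k + K) ∧ (j ≤ j' ∧ j' < j + c) then 1 else 0 := by
  have e : ∀ (p q r : Prop) [Decidable p] [Decidable q] [Decidable r], (if p ∧ q ∧ r then 1 else 0 : ℕ) =
      (if p then 1 else 0) * ((if q then 1 else 0) * if r then 1 else 0) := by
    intro p q r _ _ _
    by_cases p <;> by_cases q <;> by_cases r <;> simp [*]
  rw [e]
  induction i, a, k, K, j, c using mulProg_rec (n := n) hρ with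
  | empty i a k K j c h =>
    rw [← e, if_neg (by omega)]
    simp [SP.ops]
  | single i k j =>
    simp only [SP.ops, cellI, Instr.label, List.filterMap_cons, List.filterMap_nil,
      List.count_singleton, beq_iff_eq, Prod.mk.injEq]
    rw [← e]
    congr 1
    rw [eq_iff_iff]
    omega
  | outer i a b k K j c d P Q R S _ _ _ _ _ _ _ _ _ hP hQ hR hS =>
    simp only [SP.ops, List.filterMap_append, List.count_append, hP, hQ, hR, hS, ite_range_add]
    ring
  | middle i a k K L j c P Q _ _ _ _ _ _ hP hQ =>
    simp only [SP.ops, List.filterMap_append, List.count_append, hP, hQ, ite_range_add]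
    ring

open Classical in
theorem sqProg_count {n : ℕ} {ρ : ℝ} (hρ : 1 ≤ ρ) (i p j q i' k' j' : ℕ) (hij : i + p ≤ j) :
    ((sqProg n ρ i p j q).ops.filterMap Instr.label).count (i', k', j') =
      if SqCell i p j q i' k' j' then 1 else 0 := by
  revert hij
  induction i, p, j, q using sqProg_rec (n := n) (ρ := ρ) with
  | empty i p j q h =>
    intro hij
    rw [if_neg (by unfold SqCell; omega)]
    simp [SP.ops]
  | single i j =>
    intro hij
    rw [if_neg (by unfold SqCell; omega)]
    rw [copyI, SP.ops, List.filterMap_cons_none rfl]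
    simp
  | split i a b j c d P Q R S _ _ _ _ _ _ _ _ _ _ _ hP hQ hR hS =>
    intro hij
    simp only [SP.ops, List.filterMap_append, List.count_append, hP (by omega), hQ (by omega),
      hR (by omega), hS (by omega), mulProg_count hρ]
    unfold SqCell
    rcases lt_or_ge i' (i + a) with hi | hi <;> rcases lt_or_ge j' (j + c) with hj | hj
    -- In each quadrant most indicators vanish identically; discarding them first leaves few cases.
    · rw [if_neg (c := (i + a ≤ _ ∧ _) ∧ (j ≤ j' ∧ _) ∧ _) (by omega),
        if_neg (c := (i + a ≤ _ ∧ _) ∧ (j ≤ k' ∧ _) ∧ _) (by omega),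
        if_neg (c := (i + a ≤ _ ∧ _) ∧ (j + c ≤ j' ∧ _) ∧ _) (by omega),
        if_neg (c := _ ∧ (i + a ≤ k' ∧ _) ∧ j + c ≤ j' ∧ _) (by omega),
        if_neg (c := _ ∧ (j ≤ k' ∧ _) ∧ j + c ≤ j' ∧ _) (by omega),
        if_neg (c := _ ∧ (j + c ≤ j' ∧ _) ∧ _) (by omega)]
      split_ifs <;> omega
    · rw [if_neg (c := (i + a ≤ _ ∧ _) ∧ (j ≤ j' ∧ _) ∧ _) (by omega),
        if_neg (c := _ ∧ (i + a ≤ k' ∧ _) ∧ j ≤ j' ∧ _) (by omega),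
        if_neg (c := _ ∧ (j ≤ j' ∧ _) ∧ _) (by omega),
        if_neg (c := (i + a ≤ _ ∧ _) ∧ (j ≤ k' ∧ _) ∧ _) (by omega),
        if_neg (c := (i + a ≤ _ ∧ _) ∧ (j + c ≤ j' ∧ _) ∧ _) (by omega)]
      split_ifs <;> omega
    · rw [if_neg (c := _ ∧ (i + a ≤ k' ∧ _) ∧ j ≤ j' ∧ _) (by omega),
        if_neg (c := (i ≤ _ ∧ _) ∧ (j ≤ j' ∧ _) ∧ _) (by omega),
        if_neg (c := (i + a ≤ _ ∧ _) ∧ (j ≤ k' ∧ _) ∧ _) (by omega),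
        if_neg (c := (i + a ≤ _ ∧ _) ∧ (j + c ≤ j' ∧ _) ∧ _) (by omega),
        if_neg (c := _ ∧ (i + a ≤ k' ∧ _) ∧ j + c ≤ j' ∧ _) (by omega),
        if_neg (c := (i ≤ _ ∧ _) ∧ (j ≤ k' ∧ _) ∧ j + c ≤ j' ∧ _) (by omega),
        if_neg (c := (i ≤ _ ∧ _) ∧ (j + c ≤ j' ∧ _) ∧ _) (by omega)]
      split_ifs <;> omega
    · rw [if_neg (c := (i + a ≤ _ ∧ _) ∧ (j ≤ j' ∧ _) ∧ _) (by omega),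
        if_neg (c := _ ∧ (i + a ≤ k' ∧ _) ∧ j ≤ j' ∧ _) (by omega),
        if_neg (c := (i ≤ _ ∧ _) ∧ (j ≤ j' ∧ j' < j + c) ∧ _) (by omega),
        if_neg (c := _ ∧ (i + a ≤ k' ∧ _) ∧ j + c ≤ j' ∧ _) (by omega),
        if_neg (c := (i ≤ _ ∧ i' < i + a) ∧ (j ≤ k' ∧ _) ∧ j + c ≤ j' ∧ _) (by omega),
        if_neg (c := (i ≤ _ ∧ i' < i + a) ∧ (j + c ≤ j' ∧ _) ∧ _) (by omega)]
      split_ifs <;> omega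

theorem triProg_count {n : ℕ} {ρ : ℝ} (hρ : 1 ≤ ρ) (i L i' k' j' : ℕ) :
    ((triProg n ρ i L).ops.filterMap Instr.label).count (i', k', j') =
      if i ≤ i' ∧ i' < k' ∧ k' < j' ∧ j' < i + L then 1 else 0 := by
  induction i, L using triProg_rec (n := n) (ρ := ρ) with
  | small i L h =>
    rw [if_neg (by omega)]
    simp [SP.ops]
  | split i a b P Q _ _ _ _ _ hP hQ =>
    simp only [SP.ops, List.filterMap_append, List.count_append, hP, hQ,
      sqProg_count hρ _ _ _ _ _ _ _ le_rfl]
    unfold SqCell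
    split_ifs <;> omega

/-! ### Work and span -/

/-- The `+ 3` pays for the forks: four subtasks save `12` and the three forks of a quartering cost
`3`. If one outer range has an empty half, two subtasks remain, and `6 - 3` is still enough. -/
theorem mulProg_work {n : ℕ} {ρ : ℝ} (hρ : 1 ≤ ρ) (i a k K j c : ℕ) :
    (a = 0 ∨ K = 0 ∨ c = 0 → (mulProg n ρ i a k K j c).work = 0) ∧
    (0 < a → 0 < K → 0 < c → (mulProg n ρ i a k K j c).work + 3 ≤ 4 * (a * K * c)) := by
  induction i, a, k, K, j, c using mulProg_rec (n := n) hρ with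
  | empty i a k K j c h => exact ⟨fun _ => rfl, fun _ _ _ => by omega⟩
  | single i k j => exact ⟨fun h => by omega, fun _ _ _ => by simp [SP.work]⟩
  | outer i a b k K j c d P Q R S _ _ _ _ hb hK hd hm _ hP hQ hR hS =>
    refine ⟨fun h => by omega, fun _ _ _ => ?_⟩
    rw [lt_max_iff] at hm
    have s4 := hS.2 hb hK hd
    simp only [SP.work]
    rcases Nat.eq_zero_or_pos a with rfl | ha
    · rw [hP.1 (by omega), hQ.1 (by omega)]
      have := hR.2 hb hK (by omega)
      linarith
    · rcases Nat.eq_zero_or_pos c with rfl | hc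
      · rw [hP.1 (by omega), hR.1 (by omega)]
        have := hQ.2 ha hK hd
        linarith
      · have p4 := hP.2 ha hK hc
        have q4 := hQ.2 ha hK hd
        have r4 := hR.2 hb hK hc
        linarith
  | middle i a k K L j c P Q _ _ hK ha hc _ hP hQ =>
    refine ⟨fun h => by omega, fun _ _ _ => ?_⟩
    have p4 := hP.2 ha hK hc
    have q4 := hQ.2 ha (by omega) hc
    simp only [SP.work]
    linarith

theorem mulProg_work_le {n : ℕ} {ρ : ℝ} (hρ : 1 ≤ ρ) (i a k K j c : ℕ) :
    (mulProg n ρ i a k K j c).work ≤ 4 * (a * K * c) := by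
  obtain ⟨h0, h1⟩ := mulProg_work (n := n) hρ i a k K j c
  by_cases h : a = 0 ∨ K = 0 ∨ c = 0
  · rw [h0 h]; exact Nat.zero_le _
  · have := h1 (by omega) (by omega) (by omega)
    omega

/-- The cubic terms of the quadrants and the products add up exactly to that of the square; the fork
is paid for by the slack. -/
theorem sqProg_work {n : ℕ} {ρ : ℝ} (hρ : 1 ≤ ρ) (i p j q : ℕ) :
    (p = 0 ∨ q = 0 → (sqProg n ρ i p j q).work = 0) ∧
    (0 < p → 0 < q → (sqProg n ρ i p j q).work + 2 + p * q ≤ 2 * (p * q * (p + q))) := by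
  induction i, p, j, q using sqProg_rec (n := n) (ρ := ρ) with
  | empty i p j q h => exact ⟨fun _ => rfl, fun _ _ => by omega⟩
  | single i j => exact ⟨fun h => by omega, fun _ _ => by simp [SP.work]⟩
  | split i a b j c d P Q R S _ _ _ _ hb hd hm _ _ _ _ hP hQ hR hS =>
    refine ⟨fun h => by omega, fun _ _ => ?_⟩
    rw [lt_max_iff] at hm
    have s4 := hS.2 hb hd
    have m1 := mulProg_work_le (n := n) hρ i a (i + a) b j c
    have m2 := mulProg_work_le (n := n) hρ (i + a) b j c (j + c) d
    have m3 := mulProg_work_le (n := n) hρ i a (i + a) b (j + c) d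
    have m4 := mulProg_work_le (n := n) hρ i a j c (j + c) d
    simp only [SP.work]
    rcases Nat.eq_zero_or_pos a with rfl | ha
    · rw [hP.1 (by omega), hQ.1 (by omega)]
      have := hR.2 hb (by omega)
      linarith
    · rcases Nat.eq_zero_or_pos c with rfl | hc
      · rw [hP.1 (by omega), hR.1 (by omega)]
        have := hQ.2 ha hd
        linarith
      · have p4 := hP.2 ha hc
        have q4 := hQ.2 ha hd
        have r4 := hR.2 hb hc
        linarith

theorem triProg_work {n : ℕ} {ρ : ℝ} (hρ : 1 ≤ ρ) (i L : ℕ) :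
    (triProg n ρ i L).work ≤ 2 * L ^ 3 := by
  induction i, L using triProg_rec (n := n) (ρ := ρ) with
  | small i L h => exact Nat.zero_le _
  | split i a b P Q _ _ ha _ _ hP hQ =>
    have := (sqProg_work (n := n) hρ i a (i + a) b).2 ha (by omega)
    simp only [SP.work]
    nlinarith [Nat.zero_le (a * b * (a + b)), Nat.zero_le (a * b)]

/-- Halving the middle range adds spans, so the bound is linear in `K`; a quartering adds two forks
to the path, at most `2 * K`. -/
theorem mulProg_span {n : ℕ} {ρ : ℝ} (hρ : 1 ≤ ρ) (i a k K j c : ℕ) : ∀ l : ℕ,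
    a ≤ 2 ^ l → c ≤ 2 ^ l → (mulProg n ρ i a k K j c).span ≤ K * (1 + 2 * l) := by
  induction i, a, k, K, j, c using mulProg_rec (n := n) hρ with
  | empty i a k K j c h => exact fun _ _ _ => Nat.zero_le _
  | single i k j => exact fun l _ _ => by simp [SP.span]
  | outer i a b k K j c d P Q R S _ _ _ _ hb hK hd hm _ hP hQ hR hS =>
    intro l ha hc
    rw [lt_max_iff] at hm
    rcases l with _ | l
    · simp at ha hc; omega
    rw [pow_succ] at ha hc
    have p := hP l (by omega) (by omega)
    have q := hQ l (by omega) (by omega)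
    have r := hR l (by omega) (by omega)
    have s := hS l (by omega) (by omega)
    have e : K * (1 + 2 * (l + 1)) = K * (1 + 2 * l) + 2 * K := by ring
    simp only [SP.span]
    omega
  | middle i a k K L j c P Q _ _ hK ha hc _ hP hQ =>
    intro l h1 h2
    have p := hP l h1 h2
    have q := hQ l h1 h2
    simp only [SP.span]
    linarith

theorem two_pow_le_three_pow (l : ℕ) : (6 * l + 16) * 2 ^ l + 1 ≤ 17 * 3 ^ l := by
  induction l with
  | zero => simp
  | succ l ih => rw [pow_succ, pow_succ]; nlinarith [Nat.zero_le (l * 2 ^ l), Nat.zero_le (2 ^ l)]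

/-- The longest path runs through three quadrants, three products and one fork, so that `S (l + 1) ≤
3 * S l + 3 * 2 ^ l * (1 + 2 * l) + 1`. The correction solves this recurrence: `3 * (6 * l + 16) - 3
* (1 + 2 * l) - 1 = 2 * (6 * (l + 1) + 16)`. -/
theorem sqProg_span {n : ℕ} {ρ : ℝ} (hρ : 1 ≤ ρ) (i p j q : ℕ) : ∀ l : ℕ,
    p ≤ 2 ^ l → q ≤ 2 ^ l → (sqProg n ρ i p j q).span + (6 * l + 16) * 2 ^ l ≤ 17 * 3 ^ l := by
  induction i, p, j, q using sqProg_rec (n := n) (ρ := ρ) with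
  | empty i p j q h => 
    intro l _ _
    have := two_pow_le_three_pow l
    simp only [SP.span]
    omega
  | single i j =>
    intro l _ _
    have := two_pow_le_three_pow l
    simp only [SP.span]
    omega
  | split i a b j c d P Q R S _ _ _ _ hb hd hm _ _ _ _ hP hQ hR hS =>
    intro l h1 h2
    rw [lt_max_iff] at hm
    rcases l with _ | l
    · simp at h1 h2; omega
    rw [pow_succ] at h1 h2
    have p := hP l (by omega) (by omega)
    have q := hQ l (by omega) (by omega)
    have r := hR l (by omega) (by omega)
    have s := hS l (by omega) (by omega)
    have m : ∀ i1 a1 k1 K1 j1 c1, a1 ≤ 2 ^ l → K1 ≤ 2 ^ l → c1 ≤ 2 ^ l →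
        (mulProg n ρ i1 a1 k1 K1 j1 c1).span ≤ 2 ^ l * (1 + 2 * l) :=
      fun _ _ _ _ _ _ e1 e2 e3 => (mulProg_span hρ _ _ _ _ _ _ l e1 e3).trans
        (Nat.mul_le_mul_right _ e2)
    have m1 := m i a (i + a) b j c (by omega) (by omega) (by omega)
    have m2 := m (i + a) b j c (j + c) d (by omega) (by omega) (by omega)
    have m3 := m i a (i + a) b (j + c) d (by omega) (by omega) (by omega)
    have m4 := m i a j c (j + c) d (by omega) (by omega) (by omega)
    have e1 : (6 * (l + 1) + 16) * 2 ^ (l + 1) = 12 * (l * 2 ^ l) + 44 * 2 ^ l := by ring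
    have e2 : 2 ^ l * (1 + 2 * l) = 2 ^ l + 2 * (l * 2 ^ l) := by ring
    have e3 : (6 * l + 16) * 2 ^ l = 6 * (l * 2 ^ l) + 16 * 2 ^ l := by ring
    have e4 : 17 * 3 ^ (l + 1) = 3 * (17 * 3 ^ l) := by ring
    have e5 : 1 ≤ 2 ^ l := Nat.one_le_two_pow
    simp only [SP.span]
    omega

theorem triProg_span {n : ℕ} {ρ : ℝ} (hρ : 1 ≤ ρ) (i L : ℕ) : ∀ l : ℕ,
    L ≤ 2 ^ l → (triProg n ρ i L).span ≤ 17 * 3 ^ l := by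
  induction i, L using triProg_rec (n := n) (ρ := ρ) with
  | small i L h => exact fun _ _ => Nat.zero_le _
  | split i a b P Q _ _ ha _ _ hP hQ =>
    intro l h
    rcases l with _ | l
    · simp at h; omega
    rw [pow_succ] at h
    have p := hP l (by omega)
    have q := hQ l (by omega)
    have r := sqProg_span (n := n) hρ i a (i + a) b l (by omega) (by omega)
    have e : 1 ≤ (6 * l + 16) * 2 ^ l := Nat.succ_le_of_lt (by positivity)
    have e4 : 17 * 3 ^ (l + 1) = 3 * (17 * 3 ^ l) := by ring
    simp only [SP.span]
    omega

/-! ### Accessed addresses and races -/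

theorem addr_inj {n i j i' j' : ℕ} (hj : j ≤ n) (hj' : j' ≤ n)
    (h : addr n i j = addr n i' j') : i = i' ∧ j = j' := by
  unfold addr at h
  have e : ∀ i j, j ≤ n → (i * (n + 1) + j) / (n + 1) = i := fun i j hj => by
    rw [mul_comm, Nat.mul_add_div (Nat.succ_pos n), Nat.div_eq_of_lt (by omega), add_zero]
  have h1 := e i j hj
  rw [h, e i' j' hj'] at h1
  subst h1
  exact ⟨rfl, by omega⟩

/-- All targets of `t` are in the region `T`, and all sources in the region `S`, of the table. -/
def Acc (n : ℕ) (t : List Instr) (T S : ℕ → ℕ → Prop) : Prop :=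
  ∀ x ∈ t, (∃ u v, u ≤ n ∧ v ≤ n ∧ T u v ∧ x.target = addr n u v) ∧
    ∀ s ∈ x.sources, ∃ u v, u ≤ n ∧ v ≤ n ∧ S u v ∧ s = addr n u v

theorem Acc.mono {n : ℕ} {t : List Instr} {T S T' S' : ℕ → ℕ → Prop} (h : Acc n t T S)
    (hT : ∀ u v, T u v → T' u v) (hS : ∀ u v, S u v → S' u v) : Acc n t T' S' := by
  intro x hx
  obtain ⟨⟨u, v, hu, hv, huv, e⟩, h2⟩ := h x hx
  refine ⟨⟨u, v, hu, hv, hT _ _ huv, e⟩, fun s hs => ?_⟩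
  obtain ⟨u, v, hu, hv, huv, e⟩ := h2 s hs
  exact ⟨u, v, hu, hv, hS _ _ huv, e⟩

theorem Acc.append {n : ℕ} {t t' : List Instr} {T S : ℕ → ℕ → Prop} (h : Acc n t T S)
    (h' : Acc n t' T S) : Acc n (t ++ t') T S := fun x hx =>
  (List.mem_append.1 hx).elim (h x) (h' x)

theorem Acc.raceFree_par {n : ℕ} {p q : SP Instr} {T S T' S' : ℕ → ℕ → Prop}
    (hp : RaceFree p) (hq : RaceFree q) (h : Acc n p.ops T S) (h' : Acc n q.ops T' S')
    (h1 : ∀ u v, T u v → ¬ T' u v) (h2 : ∀ u v, T u v → ¬ S' u v) (h3 : ∀ u v, T' u v → ¬ S u v) :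
    RaceFree (.par p q) := by
  refine ⟨hp, hq, fun a ha b hb => ?_⟩
  obtain ⟨⟨u, v, hu, hv, huv, e⟩, sa⟩ := h a ha
  obtain ⟨⟨u', v', hu', hv', huv', e'⟩, sb⟩ := h' b hb
  refine ⟨fun hh => ?_, fun hh => ?_, fun hh => ?_⟩
  · rw [e, e'] at hh
    obtain ⟨rfl, rfl⟩ := addr_inj hv hv' hh
    exact h1 _ _ huv huv'
  · obtain ⟨x, y, hx, hy, hxy, e2⟩ := sb _ hh
    rw [e] at e2
    obtain ⟨rfl, rfl⟩ := addr_inj hv hy e2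
    exact h2 _ _ huv hxy
  · obtain ⟨x, y, hx, hy, hxy, e2⟩ := sa _ hh
    rw [e'] at e2
    obtain ⟨rfl, rfl⟩ := addr_inj hv' hy e2
    exact h3 _ _ huv' hxy

/-- The block `[r, r+p) × [c, c+q)` of the table. -/
def Blk (r p c q u v : ℕ) : Prop := (r ≤ u ∧ u < r + p) ∧ c ≤ v ∧ v < c + q

theorem mulProg_acc {n : ℕ} {ρ : ℝ} (hρ : 1 ≤ ρ) (i a k K j c : ℕ) (hi : i + a ≤ n + 1)
    (hk : k + K ≤ n + 1) (hj : j + c ≤ n + 1) :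
    Acc n (mulProg n ρ i a k K j c).ops (Blk i a j c)
      (fun u v => Blk i a j c u v ∨ Blk i a k K u v ∨ Blk j c k K u v) := by
  intro x hx
  obtain ⟨i', k', j', h, rfl⟩ := (mem_mulProg hρ).1 hx
  refine ⟨⟨i', j', by omega, by omega, ⟨h.1, h.2.2⟩, rfl⟩, fun s hs => ?_⟩
  simp only [cellI, Instr.sources, Finset.mem_insert, Finset.mem_singleton] at hs
  rcases hs with rfl | rfl | rfl
  · exact ⟨i', k', by omega, by omega, Or.inr (Or.inl ⟨h.1, h.2.1⟩), rfl⟩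
  · exact ⟨j', k', by omega, by omega, Or.inr (Or.inr ⟨h.2.2, h.2.1⟩), rfl⟩
  · exact ⟨i', j', by omega, by omega, Or.inl ⟨h.1, h.2.2⟩, rfl⟩

theorem sqProg_acc {n : ℕ} {ρ : ℝ} (hρ : 1 ≤ ρ) (i p j q : ℕ) (hij : i + p ≤ j)
    (hj : j + q ≤ n + 1) :
    Acc n (sqProg n ρ i p j q).ops (fun u v => Blk i p j q u v ∨ Blk j q i p u v)
      (fun u v => Blk i p i p u v ∨ Blk i p j q u v ∨ Blk j q i p u v ∨ Blk j q j q u v) := by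
  intro x hx
  rcases (sqProg_ops hρ i p j q hij).1 x hx with ⟨i', k', j', h, rfl⟩ | ⟨i', j', h, rfl⟩
  · unfold SqCell at h
    refine ⟨⟨i', j', by omega, by omega, Or.inl ⟨h.1, h.2.1⟩, rfl⟩, fun s hs => ?_⟩
    simp only [cellI, Instr.sources, Finset.mem_insert, Finset.mem_singleton] at hs
    unfold Blk
    rcases hs with rfl | rfl | rfl
    · exact ⟨i', k', by omega, by omega, by omega, rfl⟩
    · exact ⟨j', k', by omega, by omega, by omega, rfl⟩
    · exact ⟨i', j', by omega, by omega, by omega, rfl⟩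
  · refine ⟨⟨j', i', by omega, by omega, Or.inr ⟨h.2, h.1⟩, rfl⟩, fun s hs => ?_⟩
    simp only [copyI, Instr.sources, Finset.mem_singleton] at hs
    exact ⟨i', j', by omega, by omega, Or.inr (Or.inl ⟨h.1, h.2⟩), hs⟩

theorem triProg_acc {n : ℕ} {ρ : ℝ} (hρ : 1 ≤ ρ) (i L : ℕ) (hi : i + L ≤ n + 1) :
    Acc n (triProg n ρ i L).ops (Blk i L i L) (Blk i L i L) := by
  intro x hx
  rcases (triProg_ops hρ i L).1 x hx with ⟨i', k', j', h, rfl⟩ | ⟨i', j', h, rfl⟩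
  · refine ⟨⟨i', j', by omega, by omega, by unfold Blk; omega, rfl⟩, fun s hs => ?_⟩
    simp only [cellI, Instr.sources, Finset.mem_insert, Finset.mem_singleton] at hs
    unfold Blk
    rcases hs with rfl | rfl | rfl
    · exact ⟨i', k', by omega, by omega, by omega, rfl⟩
    · exact ⟨j', k', by omega, by omega, by omega, rfl⟩
    · exact ⟨i', j', by omega, by omega, by omega, rfl⟩
  · refine ⟨⟨j', i', by omega, by omega, by unfold Blk; omega, rfl⟩, fun s hs => ?_⟩
    simp only [copyI, Instr.sources, Finset.mem_singleton] at hs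
    exact ⟨i', j', by omega, by omega, by unfold Blk; omega, hs⟩

theorem mulProg_raceFree {n : ℕ} {ρ : ℝ} (hρ : 1 ≤ ρ) (i a k K j c : ℕ) (hik : i + a ≤ k)
    (hkj : k + K ≤ j) (hj : j + c ≤ n + 1) : RaceFree (mulProg n ρ i a k K j c) := by
  revert hik hkj hj
  -- The accessed regions are carried through the same induction, since the principle forgets which
  -- programs the subtasks are.
  refine And.left (b := i + a ≤ k → k + K ≤ j → j + c ≤ n + 1 → Acc n (mulProg n ρ i a k K j c).ops
    (Blk i a j c) (fun u v => Blk i a j c u v ∨ Blk i a k K u v ∨ Blk j c k K u v)) ?_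
  induction i, a, k, K, j, c using mulProg_rec (n := n) hρ with
  | empty i a k K j c h => exact ⟨fun _ _ _ => trivial, fun _ _ _ => by simp [SP.ops, Acc]⟩
  | single i k j =>
    refine ⟨fun _ _ _ => trivial, fun _ _ _ => ?_⟩
    have := mulProg_acc (n := n) hρ i 1 k 1 j 1 (by omega) (by omega) (by omega)
    rwa [mulProg, if_neg (by omega), dif_pos (by omega)] at this
  | outer i a b k K j c d P Q R S _ _ _ _ _ _ _ _ _ hP hQ hR hS =>
    constructor
    · intro h1 h2 h3
      refine Acc.raceFree_par (n := n) (T := Blk i a j (c + d)) (T' := Blk (i + a) b j (c + d))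
        (S := fun u v => Blk i a j (c + d) u v ∨ Blk i a k K u v ∨ Blk j (c + d) k K u v)
        (S' := fun u v => Blk (i + a) b j (c + d) u v ∨ Blk (i + a) b k K u v ∨
          Blk j (c + d) k K u v) ?_ ?_ ?_ ?_ ?_ ?_ ?_
      · refine Acc.raceFree_par (hP.1 (by omega) (by omega) (by omega))
          (hQ.1 (by omega) (by omega) (by omega)) (hP.2 (by omega) (by omega) (by omega))
          (hQ.2 (by omega) (by omega) (by omega)) ?_ ?_ ?_ <;> unfold Blk <;> intros <;> omega
      · refine Acc.raceFree_par (hR.1 (by omega) (by omega) (by omega))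
          (hS.1 (by omega) (by omega) (by omega)) (hR.2 (by omega) (by omega) (by omega))
          (hS.2 (by omega) (by omega) (by omega)) ?_ ?_ ?_ <;> unfold Blk <;> intros <;> omega
      · refine Acc.append ((hP.2 (by omega) (by omega) (by omega)).mono ?_ ?_)
          ((hQ.2 (by omega) (by omega) (by omega)).mono ?_ ?_) <;> unfold Blk <;> intros <;> omega
      · refine Acc.append ((hR.2 (by omega) (by omega) (by omega)).mono ?_ ?_)
          ((hS.2 (by omega) (by omega) (by omega)).mono ?_ ?_) <;> unfold Blk <;> intros <;> omega
      all_goals unfold Blk; intros; omega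
    · intro h1 h2 h3
      refine Acc.append (Acc.append ((hP.2 (by omega) (by omega) (by omega)).mono ?_ ?_)
        ((hQ.2 (by omega) (by omega) (by omega)).mono ?_ ?_))
        (Acc.append ((hR.2 (by omega) (by omega) (by omega)).mono ?_ ?_)
        ((hS.2 (by omega) (by omega) (by omega)).mono ?_ ?_)) <;> unfold Blk <;> intros <;> omega
  | middle i a k K L j c P Q _ _ _ _ _ _ hP hQ =>
    refine ⟨fun h1 h2 h3 => ⟨hP.1 (by omega) (by omega) (by omega),
      hQ.1 (by omega) (by omega) (by omega)⟩, fun h1 h2 h3 => ?_⟩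
    refine Acc.append ((hP.2 (by omega) (by omega) (by omega)).mono ?_ ?_)
        ((hQ.2 (by omega) (by omega) (by omega)).mono ?_ ?_) <;> unfold Blk <;> intros <;> omega

/-- The two parallel quadrants have disjoint rows and disjoint columns. Whatever else their branches
read, in the near quadrant, its transposed copy and the diagonal blocks, is written by neither. -/
theorem sqProg_raceFree {n : ℕ} {ρ : ℝ} (hρ : 1 ≤ ρ) (i p j q : ℕ) (hij : i + p ≤ j)
    (hj : j + q ≤ n + 1) : RaceFree (sqProg n ρ i p j q) := by
  revert hij hj
  induction i, p, j, q using sqProg_rec (n := n) (ρ := ρ) with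
  | empty i p j q h => exact fun _ _ => trivial
  | single i j => exact fun _ _ => trivial
  | split i a b j c d P Q R S _ _ _ _ _ _ _ eP eQ eR eS hP hQ hR hS =>
    intro h1 h2
    refine ⟨hR (by omega) (by omega), ?_, mulProg_raceFree hρ _ _ _ _ _ _ (by omega) (by omega)
      (by omega), mulProg_raceFree hρ _ _ _ _ _ _ (by omega) (by omega) (by omega),
      hQ (by omega) (by omega)⟩
    have aP := sqProg_acc (n := n) hρ i a j c (by omega) (by omega)
    have aS := sqProg_acc (n := n) hρ (i + a) b (j + c) d (by omega) (by omega)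
    have a1 := mulProg_acc (n := n) hρ i a (i + a) b j c (by omega) (by omega) (by omega)
    have a2 := mulProg_acc (n := n) hρ (i + a) b j c (j + c) d (by omega) (by omega) (by omega)
    rw [← eP] at aP
    rw [← eS] at aS
    refine Acc.raceFree_par (n := n)
      (T := fun u v => Blk i a j c u v ∨ Blk j c i a u v)
      (S := fun u v => Blk i a i a u v ∨ Blk i a j c u v ∨ Blk j c i a u v ∨ Blk j c j c u v ∨
        Blk i a (i + a) b u v ∨ Blk j c (i + a) b u v)
      (T' := fun u v => Blk (i + a) b (j + c) d u v ∨ Blk (j + c) d (i + a) b u v)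
      (S' := fun u v => Blk (i + a) b (i + a) b u v ∨ Blk (i + a) b (j + c) d u v ∨
        Blk (j + c) d (i + a) b u v ∨ Blk (j + c) d (j + c) d u v ∨
        Blk (i + a) b j c u v ∨ Blk (j + c) d j c u v)
      ⟨mulProg_raceFree hρ _ _ _ _ _ _ (by omega) (by omega) (by omega), hP (by omega) (by omega)⟩
      ⟨mulProg_raceFree hρ _ _ _ _ _ _ (by omega) (by omega) (by omega), hS (by omega) (by omega)⟩
      ((a1.mono ?_ ?_).append (aP.mono ?_ ?_)) ((a2.mono ?_ ?_).append (aS.mono ?_ ?_)) ?_ ?_ ?_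
    all_goals intro u v; unfold Blk; omega

theorem triProg_raceFree {n : ℕ} {ρ : ℝ} (hρ : 1 ≤ ρ) (i L : ℕ) (hi : i + L ≤ n + 1) :
    RaceFree (triProg n ρ i L) := by
  revert hi
  induction i, L using triProg_rec (n := n) (ρ := ρ) with
  | small i L h => exact fun _ => trivial
  | split i a b P Q _ _ _ eP eQ hP hQ =>
    intro hi
    refine ⟨?_, sqProg_raceFree hρ _ _ _ _ le_rfl (by omega)⟩
    refine Acc.raceFree_par (hP (by omega)) (hQ (by omega))
      (eP ▸ triProg_acc (n := n) hρ i a (by omega))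
      (eQ ▸ triProg_acc (n := n) hρ (i + a) b (by omega)) ?_ ?_ ?_
    all_goals unfold Blk; intros; omega

/-! ### Correctness -/

/-- The instruction may be executed once those of `S` have been executed. -/
inductive Ready (n : ℕ) (S : Set Instr) : Instr → Prop
  | cell (i k j : ℕ) : i < k → k < j → j ≤ n → (∀ l, i < l → l < k → cellI n i l k ∈ S) →
      (∀ l, k < l → l < j → cellI n k l j ∈ S) → copyI n k j ∈ S → Ready n S (cellI n i k j)
  | copy (i j : ℕ) : i < j → j ≤ n → (∀ l, i < l → l < j → cellI n i l j ∈ S) →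
      Ready n S (copyI n i j)

/-- The instructions of the list can be executed in this order, after those of `S`. -/
def Valid (n : ℕ) (S : Set Instr) : List Instr → Prop
  | [] => True
  | a :: t => Ready n S a ∧ Valid n (insert a S) t

theorem Ready.mono {n : ℕ} {S S' : Set Instr} {a : Instr} (h : Ready n S a) (hS : S ⊆ S') :
    Ready n S' a := by
  cases h with
  | cell i k j h1 h2 h3 h4 h5 h6 =>
    exact .cell i k j h1 h2 h3 (fun l a b => hS (h4 l a b)) (fun l a b => hS (h5 l a b)) (hS h6)
  | copy i j h1 h2 h3 => exact .copy i j h1 h2 fun l a b => hS (h3 l a b)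

theorem valid_of_ready {n : ℕ} {t : List Instr} {S : Set Instr} (h : ∀ a ∈ t, Ready n S a) :
    Valid n S t := by
  induction t generalizing S with
  | nil => trivial
  | cons a t ih =>
    refine ⟨h a (by simp), ih fun b hb => (h b (by simp [hb])).mono (Set.subset_insert _ _)⟩

theorem Valid.append {n : ℕ} {t t' : List Instr} {S : Set Instr} (h : Valid n S t)
    (h' : Valid n (S ∪ {a | a ∈ t}) t') : Valid n S (t ++ t') := by
  induction t generalizing S with
  | nil => simpa using h'
  | cons a t ih =>
    refine ⟨h.1, ih h.2 ?_⟩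
    convert h' using 1
    ext b
    simp only [Set.mem_union, Set.mem_insert_iff, Set.mem_ofPred_eq, List.mem_cons]
    tauto

theorem Valid.append_of_forall {n : ℕ} {t t' : List Instr} {S : Set Instr} (h : Valid n S t)
    (h' : ∀ S', S ⊆ S' → (∀ a ∈ t, a ∈ S') → Valid n S' t') : Valid n S (t ++ t') :=
  h.append (h' _ Set.subset_union_left fun _ ha => Or.inr ha)

/-- The entry `(i, j)` is complete, and so is its transposed copy. -/
def Ended (n : ℕ) (S : Set Instr) (i j : ℕ) : Prop :=
  (∀ l, i < l → l < j → cellI n i l j ∈ S) ∧ copyI n i j ∈ S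

theorem Ended.mono {n : ℕ} {S S' : Set Instr} {i j : ℕ} (h : Ended n S i j) (hS : S ⊆ S') :
    Ended n S' i j := ⟨fun l a b => hS (h.1 l a b), hS h.2⟩

theorem mulProg_valid {n : ℕ} {ρ : ℝ} (hρ : 1 ≤ ρ) {i a k K j c : ℕ} {S : Set Instr}
    (hik : i + a ≤ k) (hkj : k + K ≤ j) (hj : j + c ≤ n + 1)
    (h1 : ∀ u v, Blk i a k K u v → Ended n S u v) (h2 : ∀ u v, Blk k K j c u v → Ended n S u v) :
    Valid n S (mulProg n ρ i a k K j c).ops := by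
  refine valid_of_ready fun x hx => ?_
  obtain ⟨i', k', j', h, rfl⟩ := (mem_mulProg hρ).1 hx
  have e2 := h2 k' j' h.2
  exact .cell _ _ _ (by omega) (by omega) (by omega) (h1 i' k' ⟨h.1, h.2.1⟩).1 e2.1 e2.2

theorem sqProg_ended {n : ℕ} {ρ : ℝ} (hρ : 1 ≤ ρ) {i p j q : ℕ} (hij : i + p ≤ j) {S : Set Instr}
    (h : ∀ x ∈ (sqProg n ρ i p j q).ops, x ∈ S)
    (h' : ∀ u l v, Blk i p j q u v → i + p ≤ l → l < j → cellI n u l v ∈ S) (u v : ℕ)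
    (huv : Blk i p j q u v) : Ended n S u v := by
  have o := (sqProg_ops (n := n) hρ i p j q hij).2
  refine ⟨fun l x y => ?_, h _ (o.2 _ _ huv)⟩
  by_cases hl : i + p ≤ l ∧ l < j
  · exact h' u l v huv hl.1 hl.2
  · exact h _ (o.1 _ _ _ (by unfold SqCell; unfold Blk at huv; omega))

/-- The hypotheses say that both triangles are complete and that middle indices between the two
ranges are done. For a quadrant, the gap between its ranges is larger by a half-range on one or both
sides; the products executed just before supply exactly these middle indices. -/
theorem sqProg_valid {n : ℕ} {ρ : ℝ} (hρ : 1 ≤ ρ) (i p j q : ℕ) : ∀ S : Set Instr,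
    i + p ≤ j → j + q ≤ n + 1 →
    (∀ u v, Blk i p i p u v → u < v → Ended n S u v) →
    (∀ u v, Blk j q j q u v → u < v → Ended n S u v) →
    (∀ u l v, Blk i p j q u v → i + p ≤ l → l < j → cellI n u l v ∈ S) →
    Valid n S (sqProg n ρ i p j q).ops := by
  induction i, p, j, q using sqProg_rec (n := n) (ρ := ρ) with
  | empty i p j q h => exact fun _ _ _ _ _ _ => trivial
  | single i j =>
    intro S h1 h2 h3 h4 h5
    refine valid_of_ready fun x hx => ?_
    rw [SP.ops, List.mem_singleton] at hx
    subst hx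
    exact .copy _ _ (by omega) (by omega) fun l a b => h5 i l j (by unfold Blk; omega) (by omega) b
  | split i a b j c d P Q R S _ _ _ _ _ _ _ eP eQ eR eS hP hQ hR hS =>
    intro S₀ h1 h2 h3 h4 h5
    have m1 := (mulProg_ops (n := n) hρ i a (i + a) b j c).2
    have m2 := (mulProg_ops (n := n) hρ (i + a) b j c (j + c) d).2
    have m3 := (mulProg_ops (n := n) hρ i a (i + a) b (j + c) d).2
    have m4 := (mulProg_ops (n := n) hρ i a j c (j + c) d).2
    have blk : ∀ {r p s q r' p' s' q' u v}, Blk r p s q u v → r' ≤ r → r + p ≤ r' + p' → s' ≤ s →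
        s + q ≤ s' + q' → Blk r' p' s' q' u v := by
      unfold Blk; intros; omega
    refine Valid.append_of_forall (hR S₀ (by omega) (by omega)
      (fun u v h => h3 u v (blk h (by omega) (by omega) (by omega) (by omega)))
      (fun u v h => h4 u v (blk h (by omega) (by omega) (by omega) (by omega)))
      (fun u l v h x y => h5 u l v (blk h (by omega) (by omega) (by omega) (by omega)) (by omega) y))
      fun S1 s1 r1 => ?_
    -- The near quadrant is now complete. It is the right operand of the first product and the left
    -- operand of the second.
    have endR := sqProg_ended hρ (by omega) (S := S1) (eR ▸ r1) fun u l v h x y =>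
      s1 (h5 u l v (blk h (by omega) (by omega) (by omega) (by omega)) (by omega) y)
    refine Valid.append_of_forall (Valid.append_of_forall (Valid.append_of_forall
      (mulProg_valid hρ (by omega) (by omega) (by omega)
        (fun u v h => (h3 u v (blk h (by omega) (by omega) (by omega) (by omega))
          (by unfold Blk at h; omega)).mono s1) endR) fun S2 s2 t2 => ?_)
      fun S3 s3 _ => Valid.append_of_forall
        (mulProg_valid hρ (by omega) (by omega) (by omega) (fun u v h => (endR u v h).mono s3)
          (fun u v h => (h4 u v (blk h (by omega) (by omega) (by omega) (by omega))
            (by unfold Blk at h; omega)).mono (s1.trans s3))) fun S4 s4 t4 => ?_)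
      fun S5 s5 t5 => ?_
    · refine hP S2 (by omega) (by omega)
        (fun u v h x => (h3 u v (blk h (by omega) (by omega) (by omega) (by omega)) x).mono
          (s1.trans s2))
        (fun u v h x => (h4 u v (blk h (by omega) (by omega) (by omega) (by omega)) x).mono
          (s1.trans s2)) fun u l v h x y => ?_
      by_cases hl : l < i + a + b
      · exact t2 _ ((m1 u l v).2 (by unfold Blk at h; omega))
      · exact s2 (s1 (h5 u l v (blk h (by omega) (by omega) (by omega) (by omega)) (by omega) y))
    · refine hS S4 (by omega) (by omega)
        (fun u v h x => (h3 u v (blk h (by omega) (by omega) (by omega) (by omega)) x).mono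
          (s1.trans (s3.trans s4)))
        (fun u v h x => (h4 u v (blk h (by omega) (by omega) (by omega) (by omega)) x).mono
          (s1.trans (s3.trans s4))) fun u l v h x y => ?_
      by_cases hl : j ≤ l
      · exact t4 _ ((m2 u l v).2 (by unfold Blk at h; omega))
      · exact s4 (s3 (s1 (h5 u l v (blk h (by omega) (by omega) (by omega) (by omega)) (by omega)
          (by omega))))
    simp only [SP.ops, List.mem_append] at t5
    have endP := sqProg_ended hρ (by omega) (S := S5)
      (eP ▸ fun x hx => t5 x (Or.inl (Or.inr hx))) fun u l v h x y => by
        by_cases hl : l < i + a + b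
        · exact t5 _ (Or.inl (Or.inl ((m1 u l v).2 (by unfold Blk at h; omega))))
        · exact s5 (s1 (h5 u l v (blk h (by omega) (by omega) (by omega) (by omega)) (by omega) y))
    have endS := sqProg_ended hρ (by omega) (S := S5)
      (eS ▸ fun x hx => t5 x (Or.inr (Or.inr hx))) fun u l v h x y => by
        by_cases hl : j ≤ l
        · exact t5 _ (Or.inr (Or.inl ((m2 u l v).2 (by unfold Blk at h; omega))))
        · exact s5 (s1 (h5 u l v (blk h (by omega) (by omega) (by omega) (by omega)) (by omega)
            (by omega)))
    refine Valid.append_of_forall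
      (mulProg_valid hρ (by omega) (by omega) (by omega)
        (fun u v h => (h3 u v (blk h (by omega) (by omega) (by omega) (by omega))
          (by unfold Blk at h; omega)).mono (s1.trans s5)) endS) fun S6 s6 t6 => ?_
    refine Valid.append_of_forall
      (mulProg_valid hρ (by omega) (by omega) (by omega) (fun u v h => (endP u v h).mono s6)
        (fun u v h => (h4 u v (blk h (by omega) (by omega) (by omega) (by omega))
          (by unfold Blk at h; omega)).mono (s1.trans (s5.trans s6)))) fun S7 s7 t7 => ?_
    have s07 := s1.trans (s5.trans (s6.trans s7))
    refine hQ S7 (by omega) (by omega)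
        (fun u v h x => (h3 u v (blk h (by omega) (by omega) (by omega) (by omega)) x).mono s07)
        (fun u v h x => (h4 u v (blk h (by omega) (by omega) (by omega) (by omega)) x).mono s07)
        fun u l v h x y => ?_
    by_cases hl : l < i + a + b
    · exact s7 (t6 _ ((m3 u l v).2 (by unfold Blk at h; omega)))
    by_cases hl : j ≤ l
    · exact t7 _ ((m4 u l v).2 (by unfold Blk at h; omega))
    · exact s07 (h5 u l v (blk h (by omega) (by omega) (by omega) (by omega)) (by omega) (by omega))

theorem triProg_ended {n : ℕ} {ρ : ℝ} (hρ : 1 ≤ ρ) {i L : ℕ} {S : Set Instr}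
    (h : ∀ x ∈ (triProg n ρ i L).ops, x ∈ S) (u v : ℕ) (huv : Blk i L i L u v) (hlt : u < v) :
    Ended n S u v := by
  have o := (triProg_ops (n := n) hρ i L).2
  unfold Blk at huv
  exact ⟨fun l x y => h _ (o.1 _ _ _ (by omega)), h _ (o.2 _ _ (by omega))⟩

theorem triProg_valid {n : ℕ} {ρ : ℝ} (hρ : 1 ≤ ρ) (i L : ℕ) : ∀ S : Set Instr, i + L ≤ n + 1 →
    Valid n S (triProg n ρ i L).ops := by
  induction i, L using triProg_rec (n := n) (ρ := ρ) with
  | small i L h => exact fun _ _ => trivial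
  | split i a b P Q _ _ _ eP eQ hP hQ =>
    intro S h
    refine Valid.append_of_forall (Valid.append_of_forall (hP _ (by omega))
      fun S1 _ _ => hQ S1 (by omega)) fun S2 s2 t2 => ?_
    simp only [SP.ops, List.mem_append] at t2
    refine sqProg_valid hρ _ _ _ _ _ le_rfl (by omega)
      (triProg_ended hρ (eP ▸ fun x hx => t2 x (Or.inl hx)))
      (triProg_ended hρ (eQ ▸ fun x hx => t2 x (Or.inr hx))) fun u l v _ x y => by omega

/-! ### The memory along a valid list -/

section Memory

variable {V : Type} [SemilatticeInf V]

open Classical in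
/-- The value of the entry `(i, j)` once the cells of `S` have been evaluated. -/
noncomputable def partialVal (n : ℕ) (g : ℕ → ℕ → ℕ → V → V → V) (d : ℕ → V) (D : ℕ → ℕ → V)
    (S : Set Instr) (i j : ℕ) : WithTop V :=
  (if j = i + 1 then (d i : WithTop V) else ⊤) ⊓
    ((Finset.Ioo i j).filter fun k => cellI n i k j ∈ S).inf
      fun k => (g i k j (D i k) (D k j) : WithTop V)

theorem partialVal_eq {n : ℕ} {g : ℕ → ℕ → ℕ → V → V → V} {d : ℕ → V} {D : ℕ → ℕ → V}
    (hD : IsParenSolution n g d D) {S : Set Instr} {i j : ℕ} (hij : i < j) (hj : j ≤ n)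
    (hS : ∀ l, i < l → l < j → cellI n i l j ∈ S) :
    partialVal n g d D S i j = (D i j : WithTop V) := by
  classical
  unfold partialVal
  rw [Finset.filter_true_of_mem fun k hk => hS k (Finset.mem_Ioo.1 hk).1 (Finset.mem_Ioo.1 hk).2]
  by_cases h : j = i + 1
  · subst h
    rw [if_pos rfl, hD.1 i (by omega)]
    have : Finset.Ioo i (i + 1) = ∅ := by ext; simp
    simp [this]
  · rw [if_neg h, hD.2 i j (by omega) hj, top_inf_eq]
    exact (Finset.coe_inf' _ _).symm

theorem partialVal_congr {n : ℕ} {g : ℕ → ℕ → ℕ → V → V → V} {d : ℕ → V} {D : ℕ → ℕ → V}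
    {S S' : Set Instr} {i j : ℕ} (h : ∀ l, cellI n i l j ∈ S' ↔ cellI n i l j ∈ S) :
    partialVal n g d D S' i j = partialVal n g d D S i j := by
  classical
  unfold partialVal
  congr 2
  exact Finset.filter_congr fun l _ => h l

theorem partialVal_insert {n : ℕ} {g : ℕ → ℕ → ℕ → V → V → V} {d : ℕ → V} {D : ℕ → ℕ → V}
    {S S' : Set Instr} {i j k : ℕ} (hik : i < k) (hkj : k < j)
    (h : ∀ l, cellI n i l j ∈ S' ↔ l = k ∨ cellI n i l j ∈ S) :
    partialVal n g d D S' i j =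
      partialVal n g d D S i j ⊓ (g i k j (D i k) (D k j) : WithTop V) := by
  classical
  unfold partialVal
  have hf : (Finset.Ioo i j).filter (fun l => cellI n i l j ∈ S') =
      insert k ((Finset.Ioo i j).filter fun l => cellI n i l j ∈ S) := by
    ext l
    simp only [Finset.mem_filter, Finset.mem_Ioo, Finset.mem_insert, h]
    constructor
    · rintro ⟨hl, e | e⟩
      exacts [Or.inl e, Or.inr ⟨hl, e⟩]
    · rintro (rfl | ⟨hl, e⟩)
      exacts [⟨⟨hik, hkj⟩, Or.inl rfl⟩, ⟨hl, Or.inr e⟩]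
  rw [hf, Finset.inf_insert, inf_assoc, inf_comm (Finset.inf _ _)]

/-- The memory when the instructions of `S` have been executed. -/
def MemInv (n : ℕ) (g : ℕ → ℕ → ℕ → V → V → V) (d : ℕ → V) (D : ℕ → ℕ → V) (S : Set Instr)
    (m : ℕ → WithTop V) : Prop :=
  ∀ i j, i < j → j ≤ n → m (addr n i j) = partialVal n g d D S i j ∧
    (copyI n i j ∈ S → m (addr n j i) = (D i j : WithTop V))

theorem copyI_ne_cellI {n i j i' k' j' : ℕ} : copyI n i j ≠ cellI n i' k' j' := by
  simp [copyI, cellI]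

/-- Entries lie strictly above the diagonal and copies strictly below, so an instruction changes
exactly one word of the invariant, and by `Ready` its operands are already final. -/
theorem MemInv.step {n : ℕ} {g : ℕ → ℕ → ℕ → V → V → V} {d : ℕ → V} {D : ℕ → ℕ → V}
    (hD : IsParenSolution n g d D) {S : Set Instr} {m : ℕ → WithTop V}
    (h : MemInv n g d D S m) {a : Instr} (ha : Ready n S a) :
    MemInv n g d D (insert a S) (a.exec g m) := by
  classical
  cases ha with
  | cell i k j hik hkj hj h1 h2 h3 =>
    have ex := (h i k hik (by omega)).1
    rw [partialVal_eq hD hik (by omega) h1] at ex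
    have ey := (h k j hkj hj).2 h3
    intro i' j' hij' hj'
    have tr : (cellI n i k j).exec g m (addr n j' i') = m (addr n j' i') := by
      refine Function.update_of_ne (fun e => ?_) _ _
      have := addr_inj (by omega) hj e
      omega
    refine ⟨?_, fun hc => tr.trans ((h i' j' hij' hj').2 ?_)⟩
    · by_cases he : i' = i ∧ j' = j
      · obtain ⟨rfl, rfl⟩ := he
        have : (cellI n i' k j').exec g m (addr n i' j') =
            m (addr n i' j') ⊓ (g i' k j' (D i' k) (D k j') : WithTop V) := by
          simp only [cellI, Instr.exec, Function.update_self, ex, ey, WithTop.map₂_coe_coe]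
        rw [this, (h i' j' hij' hj').1]
        refine (partialVal_insert hik hkj fun l => ?_).symm
        simp only [Set.mem_insert_iff, cellI_inj, true_and, and_true]
      · have : (cellI n i k j).exec g m (addr n i' j') = m (addr n i' j') := by
          refine Function.update_of_ne (fun e => he ?_) _ _
          exact addr_inj hj' hj e
        rw [this, (h i' j' hij' hj').1]
        refine (partialVal_congr fun l => ?_).symm
        simp only [Set.mem_insert_iff, cellI_inj]
        tauto
    · exact (Set.mem_insert_iff.1 hc).resolve_left copyI_ne_cellI
  | copy i j hij hj h1 =>
    have ex := (h i j hij hj).1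
    rw [partialVal_eq hD hij hj h1] at ex
    intro i' j' hij' hj'
    have up : (copyI n i j).exec g m (addr n i' j') = m (addr n i' j') := by
      refine Function.update_of_ne (fun e => ?_) _ _
      have := addr_inj hj' (by omega) e
      omega
    refine ⟨?_, fun hc => ?_⟩
    · rw [up, (h i' j' hij' hj').1]
      refine (partialVal_congr fun l => ?_).symm
      simp only [Set.mem_insert_iff, copyI_ne_cellI.symm, false_or]
    · by_cases he : i' = i ∧ j' = j
      · obtain ⟨rfl, rfl⟩ := he
        simp only [copyI, Instr.exec, Function.update_self, ex]
      · have : (copyI n i j).exec g m (addr n j' i') = m (addr n j' i') := by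
          refine Function.update_of_ne (fun e => he ?_) _ _
          have := addr_inj (by omega) (by omega) e
          omega
        rw [this]
        refine (h i' j' hij' hj').2 ((Set.mem_insert_iff.1 hc).resolve_left fun e => he ?_)
        simp only [copyI, Instr.copy.injEq] at e
        exact addr_inj hj' hj e.1

theorem MemInv.foldl {n : ℕ} {g : ℕ → ℕ → ℕ → V → V → V} {d : ℕ → V} {D : ℕ → ℕ → V}
    (hD : IsParenSolution n g d D) {t : List Instr} {S : Set Instr} {m : ℕ → WithTop V}
    (h : MemInv n g d D S m) (ht : Valid n S t) :
    MemInv n g d D (S ∪ {a | a ∈ t}) (t.foldl (Instr.exec g) m) := by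
  induction t generalizing S m with
  | nil => simpa using h
  | cons a t ih =>
    rw [List.foldl_cons]
    convert ih (h.step hD ht.1) ht.2 using 1
    ext b
    simp only [Set.mem_union, Set.mem_insert_iff, Set.mem_ofPred_eq, List.mem_cons]
    tauto

theorem memInv_init {n : ℕ} (g : ℕ → ℕ → ℕ → V → V → V) (d : ℕ → V) (D : ℕ → ℕ → V) :
    MemInv n g d D ∅ (initMem n d) := by
  intro i j hij hj
  refine ⟨?_, fun h => absurd h (Set.notMem_empty _)⟩
  have e1 : addr n i j / (n + 1) = i := by
    rw [addr, mul_comm, Nat.mul_add_div (Nat.succ_pos n), Nat.div_eq_of_lt (by omega), add_zero]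
  have e2 : addr n i j % (n + 1) = j := by
    rw [addr, mul_comm, Nat.mul_add_mod, Nat.mod_eq_of_lt (by omega)]
  simp only [initMem, e1, e2, partialVal, Set.mem_empty_iff_false, Finset.filter_false,
    Finset.inf_empty, inf_top_eq]
  by_cases h : j = i + 1
  · rw [if_pos ⟨by omega, h⟩, if_pos h]
  · rw [if_neg (fun h' => h h'.2), if_neg h]

end Memory

theorem triProg_computes {n : ℕ} {ρ : ℝ} (hρ : 1 ≤ ρ) : Computes n (triProg n ρ 0 (n + 1)) := by
  refine ⟨fun i k j h1 h2 h3 => ?_, fun V _ g d D hD i j hij hj => ?_⟩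
  · rw [triProg_count hρ, if_pos (by omega)]
  · have h := (memInv_init g d D).foldl hD (triProg_valid hρ 0 (n + 1) ∅ (by omega))
    rw [(h i j hij hj).1]
    exact partialVal_eq hD hij hj fun l x y =>
      Or.inr ((triProg_ops hρ 0 (n + 1)).2.1 _ _ _ (by omega))

/-! ## Upper bounds for the cache complexity -/

/-! ### Composing cache runs -/

theorem cacheRun_append {M B : ℕ} {res dirty : Finset ℕ} {t t' : List Instr} {R W R' W' : ℕ}
    (h : CacheRun M B res dirty t R W) (h' : CacheRun M B ∅ ∅ t' R' W') :
    CacheRun M B res dirty (t ++ t') (R + R') (W + W') := by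
  induction h with
  | finish => simpa using h'
  | load l h1 h2 _ ih => rw [Nat.add_right_comm]; exact .load l h1 h2 ih
  | drop l h1 h2 _ ih => exact .drop l h1 h2 ih
  | writeBack l h1 h2 _ ih => rw [Nat.add_right_comm]; exact .writeBack l h1 h2 ih
  | exec a h1 h2 _ ih => exact .exec a h1 h2 ih

theorem cacheRun_load {M B : ℕ} {res dirty : Finset ℕ} {t : List Instr} {R W : ℕ} (E : Finset ℕ)
    (hE : Disjoint res E) (hM : (res ∪ E).card * B ≤ M)
    (h : CacheRun M B (res ∪ E) dirty t R W) : CacheRun M B res dirty t (R + E.card) W := by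
  induction E using Finset.induction_on generalizing R with
  | empty => simpa using h
  | insert l E hl ih =>
    rw [Finset.disjoint_insert_right] at hE
    rw [Finset.union_insert] at h hM
    have hl' : l ∉ res ∪ E := by simp [hl, hE.1]
    rw [Finset.card_insert_of_notMem hl'] at hM
    rw [Finset.card_insert_of_notMem hl, ← add_assoc, add_right_comm]
    exact ih hE.2 ((Nat.mul_le_mul_right _ (Nat.le_succ _)).trans hM) (.load l hl' hM h)

theorem cacheRun_drop {M B : ℕ} {res dirty : Finset ℕ} {t : List Instr} {R W : ℕ} (E : Finset ℕ)
    (hE : Disjoint res E) (hd : dirty ⊆ res)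
    (h : CacheRun M B res dirty t R W) : CacheRun M B (res ∪ E) dirty t R W := by
  induction E using Finset.induction_on with
  | empty => simpa using h
  | insert l E hl ih =>
    rw [Finset.disjoint_insert_right] at hE
    have hl' : l ∉ res ∪ E := by simp [hl, hE.1]
    rw [Finset.union_insert]
    refine .drop l (Finset.mem_insert_self _ _) (fun h => hE.1 (hd h)) ?_
    rw [Finset.erase_insert hl']
    exact ih hE.2

theorem cacheRun_flush {M B : ℕ} (Z D : Finset ℕ) (hD : D ⊆ Z) :
    ∃ W ≤ Z.card, CacheRun M B Z D [] 0 W := by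
  induction Z using Finset.induction_on generalizing D with
  | empty => 
    rw [Finset.subset_empty.1 hD]
    exact ⟨0, le_rfl, .finish⟩
  | insert l Z hl ih =>
    rw [Finset.card_insert_of_notMem hl]
    by_cases h : l ∈ D
    · obtain ⟨W, hW, hr⟩ := ih (D.erase l) (by
        rw [← Finset.erase_insert hl]; exact Finset.erase_subset_erase _ hD)
      refine ⟨W + 1, by omega, .writeBack l (Finset.mem_insert_self _ _) h ?_⟩
      rwa [Finset.erase_insert hl]
    · obtain ⟨W, hW, hr⟩ := ih D ((Finset.subset_insert_iff_of_notMem h).1 hD)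
      refine ⟨W, by omega, .drop l (Finset.mem_insert_self _ _) h ?_⟩
      rwa [Finset.erase_insert hl]

/-- `CacheRun` always describes a run up to its end. A partial run is therefore stated as what may
be put in front of an arbitrary continuation `t'`; `Held` has the same form. -/
theorem cacheRun_exec {M B : ℕ} {res Z : Finset ℕ} (hZ : Z ⊆ res) (t : List Instr)
    (hs : ∀ x ∈ t, ∀ y ∈ x.sources, y / B ∈ res) (ht : ∀ x ∈ t, x.target / B ∈ Z) :
    ∀ D ⊆ Z, ∃ D' ⊆ Z, ∀ t' R W, CacheRun M B res D' t' R W →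
      CacheRun M B res D (t ++ t') R W := by
  induction t with
  | nil => exact fun D hD => ⟨D, hD, fun _ _ _ h => h⟩
  | cons a t ih =>
    intro D hD
    have ha := ht a (by simp)
    obtain ⟨D', hD', h⟩ := ih (fun x hx => hs x (by simp [hx])) (fun x hx => ht x (by simp [hx]))
      (insert (a.target / B) D) (Finset.insert_subset ha hD)
    exact ⟨D', hD', fun t' R W hr => .exec a (hs a (by simp)) (hZ ha) (h t' R W hr)⟩

/-- With the lines `Z` in the cache throughout, and all others not needed before and after, `t` can
be executed with line reads of at most `r` words in total, and no line writes. -/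
def Held (M B : ℕ) (Z : Finset ℕ) (t : List Instr) (r : ℝ) : Prop :=
  ∀ D ⊆ Z, ∃ D' ⊆ Z, ∃ R₀ : ℕ, (R₀ * B : ℝ) ≤ r ∧ ∀ t' R W, CacheRun M B Z D' t' R W →
    CacheRun M B Z D (t ++ t') (R₀ + R) W

theorem Held.mono {M B : ℕ} {Z : Finset ℕ} {t : List Instr} {r r' : ℝ} (h : Held M B Z t r)
    (hr : r ≤ r') : Held M B Z t r' := fun D hD => by
  obtain ⟨D', hD', R₀, h1, h2⟩ := h D hD
  exact ⟨D', hD', R₀, h1.trans hr, h2⟩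

theorem held_nil {M B : ℕ} {Z : Finset ℕ} : Held M B Z [] 0 := fun D hD =>
  ⟨D, hD, 0, by simp, fun t' R W h => by simpa using h⟩

theorem Held.append {M B : ℕ} {Z : Finset ℕ} {t t' : List Instr} {r r' : ℝ} (h : Held M B Z t r)
    (h' : Held M B Z t' r') : Held M B Z (t ++ t') (r + r') := fun D hD => by
  obtain ⟨D1, hD1, R1, h1, h2⟩ := h D hD
  obtain ⟨D2, hD2, R2, h3, h4⟩ := h' D1 hD1
  refine ⟨D2, hD2, R1 + R2, by push_cast; linarith, fun u R W hu => ?_⟩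
  rw [List.append_assoc, add_assoc]
  exact h2 _ _ _ (h4 _ _ _ hu)

/-- The lines of `E` outside `Z` are only read. They stay clean and are dropped for free, so only
loading them is paid for. -/
theorem held_of_fit {M B : ℕ} {Z E : Finset ℕ} {t : List Instr} (hM : (Z ∪ E).card * B ≤ M)
    (hs : ∀ x ∈ t, ∀ y ∈ x.sources, y / B ∈ Z ∪ E) (ht : ∀ x ∈ t, x.target / B ∈ Z) :
    Held M B Z t (E.card * B) := by
  intro D hD
  obtain ⟨D', hD', h⟩ := cacheRun_exec Finset.subset_union_left t hs ht D hD
  refine ⟨D', hD', (E \ Z).card, ?_, fun t' R W hr => ?_⟩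
  · have : (E \ Z).card ≤ E.card := Finset.card_le_card Finset.sdiff_subset
    gcongr
  · rw [add_comm]
    refine cacheRun_load (E \ Z) Finset.disjoint_sdiff (by rwa [Finset.union_sdiff_self_eq_union]) ?_
    rw [Finset.union_sdiff_self_eq_union]
    refine h _ _ _ ?_
    rw [← Finset.union_sdiff_self_eq_union]
    exact cacheRun_drop _ Finset.disjoint_sdiff hD' hr

/-- `t` can be executed, from an empty cache to an empty cache, with line reads of at most `r` words
and line writes of at most `w` words in total. -/
def RunsIn (M B : ℕ) (t : List Instr) (r w : ℝ) : Prop :=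
  ∃ R W : ℕ, CacheRun M B ∅ ∅ t R W ∧ (R * B : ℝ) ≤ r ∧ (W * B : ℝ) ≤ w

theorem RunsIn.mono {M B : ℕ} {t : List Instr} {r w r' w' : ℝ} (h : RunsIn M B t r w)
    (hr : r ≤ r') (hw : w ≤ w') : RunsIn M B t r' w' := by
  obtain ⟨R, W, h1, h2, h3⟩ := h
  exact ⟨R, W, h1, h2.trans hr, h3.trans hw⟩

theorem runsIn_nil {M B : ℕ} : RunsIn M B [] 0 0 := ⟨0, 0, .finish, by simp, by simp⟩

theorem RunsIn.append {M B : ℕ} {t t' : List Instr} {r w r' w' : ℝ} (h : RunsIn M B t r w)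
    (h' : RunsIn M B t' r' w') : RunsIn M B (t ++ t') (r + r') (w + w') := by
  obtain ⟨R, W, h1, h2, h3⟩ := h
  obtain ⟨R', W', h1', h2', h3'⟩ := h'
  exact ⟨_, _, cacheRun_append h1 h1', by push_cast; linarith, by push_cast; linarith⟩

theorem Held.runsIn {M B : ℕ} {Z : Finset ℕ} {t : List Instr} {r : ℝ} (h : Held M B Z t r)
    (hM : Z.card * B ≤ M) : RunsIn M B t (Z.card * B + r) (Z.card * B) := by
  obtain ⟨D, hD, R₀, h1, h2⟩ := h ∅ (Finset.empty_subset _)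
  obtain ⟨W, hW, hf⟩ := cacheRun_flush (M := M) (B := B) Z D hD
  have h3 := h2 _ _ _ hf
  rw [List.append_nil] at h3
  have h4 := cacheRun_load (res := ∅) Z (Finset.disjoint_empty_left _) (by simpa using hM)
    (by simpa using h3)
  refine ⟨_, _, h4, by push_cast; linarith, ?_⟩
  gcongr

theorem runsIn_of_fit {M B : ℕ} {Z : Finset ℕ} {t : List Instr} (hM : Z.card * B ≤ M)
    (hs : ∀ x ∈ t, ∀ y ∈ x.sources, y / B ∈ Z) (ht : ∀ x ∈ t, x.target / B ∈ Z) :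
    RunsIn M B t (Z.card * B) (Z.card * B) := by
  have h := (held_of_fit (E := ∅) (by simpa using hM) (by simpa using hs) ht).runsIn hM
  simpa using h

/-! ### Lines of a block -/

/-- The lines of the block `[r, r+p) × [c, c+q)` of the table. -/
def blkLines (n B r p c q : ℕ) : Finset ℕ :=
  (Finset.Ico r (r + p)).biUnion fun u => (Finset.Ico c (c + q)).image fun v => addr n u v / B

theorem mem_blkLines {n B r p c q u v : ℕ} (h : Blk r p c q u v) :
    addr n u v / B ∈ blkLines n B r p c q :=
  Finset.mem_biUnion.2 ⟨u, Finset.mem_Ico.2 h.1, Finset.mem_image.2 ⟨v, Finset.mem_Ico.2 h.2, rfl⟩⟩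

theorem card_blkLines_le_mul (n B r p c q : ℕ) : (blkLines n B r p c q).card ≤ p * q := by
  have := Finset.card_biUnion_le_card_mul (Finset.Ico r (r + p))
    (fun u => (Finset.Ico c (c + q)).image fun v => addr n u v / B) q
    (fun u _ => Finset.card_image_le.trans (by simp))
  simpa [blkLines] using this

/-- A row of a block is contiguous and meets at most `q / B + 2` lines. This is why right operands
are read from the transposed copy. -/
theorem card_blkLines {B : ℕ} (hB : 0 < B) (n r p c q : ℕ) :
    (blkLines n B r p c q).card * B ≤ p * (q + 2 * B) := by
  have := Finset.card_biUnion_le_card_mul (Finset.Ico r (r + p))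
    (fun u => (Finset.Ico c (c + q)).image fun v => addr n u v / B) ((q + 2 * B) / B) ?_
  · rw [Nat.card_Ico, Nat.add_sub_cancel_left] at this
    calc (blkLines n B r p c q).card * B ≤ p * ((q + 2 * B) / B) * B := Nat.mul_le_mul_right _ this
      _ = p * ((q + 2 * B) / B * B) := by ring
      _ ≤ _ := Nat.mul_le_mul_left _ (Nat.div_mul_le_self _ _)
  · intro u _
    have sub : (Finset.Ico c (c + q)).image (fun v => addr n u v / B) ⊆
        Finset.Ico (addr n u c / B) (addr n u c / B + (q + 2 * B) / B) := by
      intro l hl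
      obtain ⟨v, hv, rfl⟩ := Finset.mem_image.1 hl
      rw [Finset.mem_Ico] at hv ⊢
      have e : (q + 2 * B) / B = q / B + 2 := by
        rw [mul_comm, Nat.add_mul_div_left _ _ hB]
      have e1 : addr n u v / B ≤ (addr n u c + q) / B :=
        Nat.div_le_div_right (by unfold addr; omega)
      have e2 : (addr n u c + q) / B ≤ addr n u c / B + q / B + 1 := by
        rw [Nat.add_div hB]; split_ifs <;> omega
      exact ⟨Nat.div_le_div_right (by unfold addr; omega), by omega⟩
    exact (Finset.card_le_card sub).trans (by simp)

/-! ### The scale of the cache -/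

/-- `s` is the side of the blocks that fit into the cache, up to a constant. -/
structure CacheScale (M B s : ℕ) : Prop where
  pos : 1 ≤ s
  B_pos : 0 < B
  three : 3 * B ≤ M
  tall : B ^ 2 ≤ M
  fits : s = 1 ∨ 400 * s ^ 2 ≤ M
  le : M ≤ (40 * s) ^ 2

/-- The side is about `√M / 20`, but at least one; when it is one by force, the guarantee of three
lines replaces `400 * s ^ 2 ≤ M`. -/
theorem exists_cacheScale {M B : ℕ} (hB : 0 < B) (h3 : 3 * B ≤ M) (ht : B ^ 2 ≤ M) :
    ∃ s, CacheScale M B s := by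
  refine ⟨max 1 (Nat.sqrt M / 20), le_max_left _ _, hB, h3, ht, ?_, ?_⟩
  · rcases le_total (Nat.sqrt M / 20) 1 with h | h
    · exact Or.inl (max_eq_left h)
    · right
      rw [max_eq_right h]
      have h1 : 20 * (Nat.sqrt M / 20) ≤ Nat.sqrt M := Nat.mul_div_le _ _
      have h2 := Nat.sqrt_le' M
      nlinarith
  · have h1 : Nat.sqrt M + 1 ≤ 40 * max 1 (Nat.sqrt M / 20) := by
      rcases le_total (Nat.sqrt M / 20) 1 with h | h
      · rw [max_eq_left h]; omega
      · rw [max_eq_right h]; omega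
    exact (Nat.lt_succ_sqrt' M).le.trans (Nat.pow_le_pow_left h1 2)

theorem CacheScale.B_le {M B s : ℕ} (h : CacheScale M B s) : B ≤ 40 * s :=
  (Nat.pow_le_pow_iff_left two_ne_zero).1 (h.tall.trans h.le)

/-- The tall cache makes partly used lines harmless: `m * a` and `B` are both at most `√M`. -/
theorem CacheScale.mul_B_le {M B s : ℕ} (h : CacheScale M B s) {a m : ℕ}
    (ha : m ^ 2 * a ^ 2 ≤ M) : m * (a * B) ≤ M := by
  refine (Nat.pow_le_pow_iff_left two_ne_zero).1 ?_
  calc (m * (a * B)) ^ 2 = m ^ 2 * a ^ 2 * B ^ 2 := by ring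
    _ ≤ M * M := Nat.mul_le_mul ha h.tall
    _ = M ^ 2 := by ring

/-- The possible shapes of product tasks that are not much smaller than the cache. -/
structure Good (s : ℕ) (σ : ℝ) (a K c : ℕ) : Prop where
  near : a ≤ c + 1 ∧ c ≤ a + 1
  wide : max a c ≤ 2 * K
  narrow : (K : ℝ) ≤ 3 * σ ^ 2 * (max a c : ℕ)
  large : s ^ 2 ≤ 18 * (max a c * K)

theorem Good.of_near {s : ℕ} {σ : ℝ} (hσ : 1 ≤ σ) {a K c : ℕ} (ha : 0 < a) (hK : 0 < K)
    (h1 : a ≤ c + 1 ∧ c ≤ a + 1) (h2 : a ≤ K + 1 ∧ K ≤ a + 1) (h3 : c ≤ K + 1)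
    (sa : s ≤ 3 * a) (sK : s ≤ 3 * K) : Good s σ a K c := by
  refine ⟨h1, max_le (by omega) (by omega), ?_, ?_⟩
  · have e : K ≤ 3 * max a c := by have := le_max_left a c; omega
    have e' : (K : ℝ) ≤ 3 * (max a c : ℕ) := by exact_mod_cast e
    have : (1 : ℝ) ≤ σ ^ 2 := one_le_pow₀ hσ
    nlinarith [(Nat.cast_nonneg (max a c) : (0 : ℝ) ≤ _)]
  · have := le_max_left a c
    nlinarith [Nat.mul_le_mul sa sK]

/-- Halving divides a nonempty side by at most `3` (the worst case is `3 = 1 + 2`). Thus the test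
passed before the split gives `narrow` with its factor `3`, and `6` becomes `18` in `large`. -/
theorem Good.outer {s : ℕ} {σ : ℝ} {a a' K c c' : ℕ} (h : Good s σ a K c)
    (hr : (K : ℝ) ≤ σ ^ 2 * (max a c : ℕ)) (hs : s ^ 2 ≤ 6 * (max a c * K))
    (ha : a' ≤ a) (hc : c' ≤ c) (h1 : a' ≤ c' + 1 ∧ c' ≤ a' + 1)
    (ha3 : a ≤ 3 * a') (hc3 : c ≤ 3 * c') : Good s σ a' K c' := by
  have hm : max a c ≤ 3 * max a' c' := by
    have := le_max_left a' c'
    have := le_max_right a' c'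
    exact max_le (by omega) (by omega)
  refine ⟨h1, (max_le_max ha hc).trans h.wide, hr.trans ?_, ?_⟩
  · have : ((max a c : ℕ) : ℝ) ≤ 3 * (max a' c' : ℕ) := by exact_mod_cast hm
    nlinarith [sq_nonneg σ]
  · nlinarith

/-- The middle range is halved only if it exceeds both outer ones or these have length one, so its
halves remain `wide`. -/
theorem Good.middle {s : ℕ} {σ : ℝ} (hσ : 1 ≤ σ) {a K K' c : ℕ} (h : Good s σ a K c)
    (hr : max a c ≤ 1 ∨ σ ^ 2 * (max a c : ℕ) < K) (hs : s ^ 2 ≤ 6 * (max a c * K))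
    (hK : K' ≤ K) (hK' : 0 < K') (h2 : K ≤ 2 * K' + 1) : Good s σ a K' c := by
  refine ⟨h.near, ?_, le_trans (by exact_mod_cast hK) h.narrow, ?_⟩
  · rcases hr with hr | hr
    · omega
    · have : ((max a c : ℕ) : ℝ) < K := by
        have : (1 : ℝ) ≤ σ ^ 2 := one_le_pow₀ hσ
        nlinarith [(Nat.cast_nonneg (max a c) : (0 : ℝ) ≤ _)]
      have : max a c < K := by exact_mod_cast this
      omega
  · have : K ≤ 3 * K' := by omega
    nlinarith

theorem Good.mul_max_le {s : ℕ} {σ : ℝ} {a K c : ℕ} (h : Good s σ a K c) (ha : 0 < a)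
    (hc : 0 < c) : max a c * max a c ≤ 2 * (a * c) := by
  obtain ⟨h1, h2⟩ := h.near
  rcases le_total a c with h | h
  · rw [max_eq_right h]; nlinarith
  · rw [max_eq_left h]; nlinarith

theorem mulProg_of_empty (n : ℕ) (ρ : ℝ) (i : ℕ) {a : ℕ} (k : ℕ) {K : ℕ} (j : ℕ) {c : ℕ}
    (h : a = 0 ∨ K = 0 ∨ c = 0) : mulProg n ρ i a k K j c = .done := by
  rw [mulProg, if_pos h]

theorem sqProg_of_empty (n : ℕ) (ρ : ℝ) (i : ℕ) {p : ℕ} (j : ℕ) {q : ℕ}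
    (h : p = 0 ∨ q = 0) : sqProg n ρ i p j q = .done := by
  rw [sqProg, if_pos h]

/-! ### Product tasks -/

/-- The lines `Z` leave enough room in the cache. -/
def Roomy (M B s : ℕ) (Z : Finset ℕ) : Prop :=
  (s = 1 ∧ Z.card ≤ 1) ∨ (400 * s ^ 2 ≤ M ∧ 4 * (Z.card * B) ≤ M)

/-- With `m = max a c`, the operands occupy about `m * K` words and serve about `m ^ 2 * K` cells.
From `large` and `narrow` follows `s ≤ 8 * σ * m`, which turns the former into `σ / s` words per
cell. From `large` and `wide` follows `s ≤ 6 * K`, so the partial lines, with `B ≤ 40 * s`, do not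
dominate. -/
theorem mulProg_held_of_fit {M B s n : ℕ} {σ : ℝ} (hs : CacheScale M B s) (hσ : 1 ≤ σ)
    {i a k K j c : ℕ} (hi : i + a ≤ n + 1) (hk : k + K ≤ n + 1) (hj : j + c ≤ n + 1)
    (ha : 0 < a) (hK : 0 < K) (hc : 0 < c) (hg : Good s σ a K c) (hfit : max a c * K ≤ s ^ 2)
    {Z : Finset ℕ} (hZ : blkLines n B i a j c ⊆ Z) (hroom : Roomy M B s Z) :
    Held M B Z (mulProg n (σ ^ 2) i a k K j c).ops (16000 * (a * K * c) * σ / s) := by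
  have acc := mulProg_acc (n := n) (ρ := σ ^ 2) (one_le_pow₀ hσ) i a k K j c hi hk hj
  set X := blkLines n B i a k K
  set Y := blkLines n B j c k K
  have cX : X.card * B ≤ a * (K + 2 * B) := card_blkLines hs.B_pos _ _ _ _ _
  have cY : Y.card * B ≤ c * (K + 2 * B) := card_blkLines hs.B_pos _ _ _ _ _
  have ma := le_max_left a c
  have mc := le_max_right a c
  have hwide := hg.wide
  have room : (Z ∪ (X ∪ Y)).card * B ≤ M := by
    have u : (Z ∪ (X ∪ Y)).card ≤ Z.card + (X.card + Y.card) :=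
      (Finset.card_union_le _ _).trans (Nat.add_le_add_left (Finset.card_union_le _ _) _)
    rcases hroom with ⟨rfl, hZ1⟩ | ⟨h400, hZ4⟩
    -- In a tiny cache, `Z` and the two operand blocks have at most one line each, and three lines
    -- fit.
    · have m1 : max a c * K ≤ 1 := by simpa using hfit
      have mp : 0 < max a c := lt_max_of_lt_left ha
      have : max a c = 1 := by nlinarith
      have : K = 1 := by nlinarith
      have hX : X.card ≤ a * K := card_blkLines_le_mul _ _ _ _ _ _
      have hY : Y.card ≤ c * K := card_blkLines_le_mul _ _ _ _ _ _
      have : X.card ≤ 1 := hX.trans (by nlinarith)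
      have : Y.card ≤ 1 := hY.trans (by nlinarith)
      calc (Z ∪ (X ∪ Y)).card * B ≤ 3 * B := Nat.mul_le_mul_right _ (by omega)
        _ ≤ M := hs.three
    · have m2 : max a c ^ 2 ≤ 2 * s ^ 2 := by nlinarith
      have mB : 14 * (max a c * B) ≤ M := hs.mul_B_le (by omega)
      have aB : a * B ≤ max a c * B := Nat.mul_le_mul_right _ ma
      have cB : c * B ≤ max a c * B := Nat.mul_le_mul_right _ mc
      have aK : a * K ≤ max a c * K := Nat.mul_le_mul_right _ ma
      have cK : c * K ≤ max a c * K := Nat.mul_le_mul_right _ mc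
      have e1 : a * (K + 2 * B) = a * K + 2 * (a * B) := by ring
      have e2 : c * (K + 2 * B) = c * K + 2 * (c * B) := by ring
      have e3 : (Z.card + (X.card + Y.card)) * B = Z.card * B + (X.card * B + Y.card * B) := by ring
      have := Nat.mul_le_mul_right B u
      omega
  have hfull := held_of_fit (t := (mulProg n (σ ^ 2) i a k K j c).ops) room ?_ ?_
  · refine hfull.mono ?_
    have s0 : (0 : ℝ) < s := by exact_mod_cast hs.pos
    have B0 : (B : ℝ) ≤ 40 * s := by exact_mod_cast hs.B_le
    obtain ⟨m, hm⟩ : ∃ m : ℝ, m = ((max a c : ℕ) : ℝ) := ⟨_, rfl⟩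
    have ham : (a : ℝ) ≤ m := by rw [hm]; exact_mod_cast ma
    have hcm : (c : ℝ) ≤ m := by rw [hm]; exact_mod_cast mc
    have hmac : m * m ≤ 2 * (a * c) := by rw [hm]; exact_mod_cast hg.mul_max_le ha hc
    have hmK : m ≤ 2 * K := by rw [hm]; exact_mod_cast hg.wide
    have hl : (s : ℝ) ^ 2 ≤ 18 * (m * K) := by rw [hm]; exact_mod_cast hg.large
    have hn : (K : ℝ) ≤ 3 * σ ^ 2 * m := by rw [hm]; exact hg.narrow
    have hK0 : (0 : ℝ) < K := by exact_mod_cast hK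
    have m0 : 0 < m := lt_of_lt_of_le (by exact_mod_cast ha) ham
    have h1 : (s : ℝ) ≤ 6 * K := by
      refine le_of_sq_le_sq ?_ (by positivity)
      nlinarith
    have h2 : (s : ℝ) ≤ 8 * σ * m := by
      refine le_of_sq_le_sq ?_ (by positivity)
      nlinarith [mul_nonneg (sq_nonneg σ) (sq_nonneg m)]
    have h3 : ((X ∪ Y).card * B : ℝ) ≤ 2 * m * (K + 80 * s) := by
      have e1 : ((X ∪ Y).card * B : ℝ) ≤ X.card * B + Y.card * B := by
        rw [← add_mul]
        gcongr
        exact_mod_cast Finset.card_union_le _ _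
      have e2 : (X.card * B : ℝ) ≤ a * (K + 2 * B) := by exact_mod_cast cX
      have e3 : (Y.card * B : ℝ) ≤ c * (K + 2 * B) := by exact_mod_cast cY
      have e4 : (a : ℝ) * (K + 2 * B) ≤ m * (K + 80 * s) :=
        mul_le_mul ham (by linarith) (by positivity) m0.le
      have e5 : (c : ℝ) * (K + 2 * B) ≤ m * (K + 80 * s) :=
        mul_le_mul hcm (by linarith) (by positivity) m0.le
      linarith
    refine h3.trans ?_
    rw [le_div_iff₀ s0]
    calc 2 * m * (K + 80 * s) * s ≤ 2 * m * (K + 80 * (6 * K)) * (8 * σ * m) := by gcongr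
      _ = 7696 * (m * m) * K * σ := by ring
      _ ≤ 7696 * (2 * (a * c)) * K * σ := by gcongr
      _ ≤ 16000 * (a * K * c) * σ := by
        have : (0 : ℝ) ≤ a * K * c * σ := by positivity
        nlinarith
  · intro x hx y hy
    obtain ⟨u, v, -, -, h, rfl⟩ := (acc x hx).2 y hy
    rcases h with h | h | h
    · exact Finset.mem_union_left _ (hZ (mem_blkLines h))
    · exact Finset.mem_union_right _ (Finset.mem_union_left _ (mem_blkLines h))
    · exact Finset.mem_union_right _ (Finset.mem_union_right _ (mem_blkLines h))
  · intro x hx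
    obtain ⟨u, v, -, -, h, e⟩ := (acc x hx).1
    rw [e]
    exact hZ (mem_blkLines h)

theorem blkLines_subset {n B r p c q r' p' c' q' : ℕ} (h1 : r' ≤ r) (h2 : r + p ≤ r' + p')
    (h3 : c' ≤ c) (h4 : c + q ≤ c' + q') : blkLines n B r p c q ⊆ blkLines n B r' p' c' q' := by
  intro l hl
  obtain ⟨u, hu, hl⟩ := Finset.mem_biUnion.1 hl
  obtain ⟨v, hv, rfl⟩ := Finset.mem_image.1 hl
  rw [Finset.mem_Ico] at hu hv
  exact mem_blkLines ⟨by omega, by omega⟩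

/-- While the operands are too large, that is `s ^ 2 < max a c * K`, both kinds of split preserve
`Good`. The bound is proportional to the number of cells, hence additive over the subtasks. -/
theorem mulProg_held {M B s n : ℕ} {σ : ℝ} (hs : CacheScale M B s) (hσ : 1 ≤ σ)
    (i a k K j c : ℕ) : ∀ Z : Finset ℕ, i + a ≤ n + 1 → k + K ≤ n + 1 → j + c ≤ n + 1 →
    (0 < a → 0 < K → 0 < c → Good s σ a K c) → blkLines n B i a j c ⊆ Z → Roomy M B s Z →
    Held M B Z (mulProg n (σ ^ 2) i a k K j c).ops (16000 * (a * K * c) * σ / s) := by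
  have fit : ∀ (i a k K j c : ℕ) (Z : Finset ℕ), i + a ≤ n + 1 → k + K ≤ n + 1 → j + c ≤ n + 1 →
      (0 < a → 0 < K → 0 < c → Good s σ a K c) → blkLines n B i a j c ⊆ Z → Roomy M B s Z →
      max a c * K ≤ s ^ 2 →
      Held M B Z (mulProg n (σ ^ 2) i a k K j c).ops (16000 * (a * K * c) * σ / s) := by
    intro i a k K j c Z hi hk hj hg hZ hroom hfit
    by_cases h0 : a = 0 ∨ K = 0 ∨ c = 0
    · rw [mulProg_of_empty _ _ _ _ _ h0]
      exact held_nil.mono (by positivity)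
    · exact mulProg_held_of_fit hs hσ hi hk hj (by omega) (by omega) (by omega)
        (hg (by omega) (by omega) (by omega)) hfit hZ hroom
  induction i, a, k, K, j, c using mulProg_induction (n := n) (one_le_pow₀ hσ : 1 ≤ σ ^ 2) with
  | empty i a k K j c h e =>
    intro Z _ _ _ _ _ _
    rw [e]
    exact held_nil.mono (by positivity)
  | single i k j e =>
    intro Z hi hk hj hg hZ hroom
    exact fit i 1 k 1 j 1 Z hi hk hj hg hZ hroom (by simpa using Nat.one_le_pow 2 s hs.pos)
  | outer i a b k K j c d h1 h2 h3 h4 h5 h6 h7 h8 h9 e hP hQ hR hS =>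
    intro Z hi hk hj hg hZ hroom
    by_cases hfit : max (a + b) (c + d) * K ≤ s ^ 2
    · exact fit _ _ _ _ _ _ Z hi hk hj hg hZ hroom hfit
    have g := hg (by omega) h6 (by omega)
    have hnear := g.near
    have good : ∀ x y, (x = a ∨ x = b) → (y = c ∨ y = d) → 0 < x → 0 < K → 0 < y →
        Good s σ x K y := fun x y hx hy hx0 _ hy0 =>
      g.outer h9 (by omega) (by omega) (by omega) (by omega) (by omega) (by omega)
    rw [e]
    refine (((hP Z (by omega) hk (by omega) (good _ _ (by simp) (by simp))
      ((blkLines_subset (by omega) (by omega) (by omega) (by omega)).trans hZ) hroom).append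
      (hQ Z (by omega) hk (by omega) (good _ _ (by simp) (by simp))
      ((blkLines_subset (by omega) (by omega) (by omega) (by omega)).trans hZ) hroom)).append
      ((hR Z (by omega) hk (by omega) (good _ _ (by simp) (by simp))
      ((blkLines_subset (by omega) (by omega) (by omega) (by omega)).trans hZ) hroom).append
      (hS Z (by omega) hk (by omega) (good _ _ (by simp) (by simp))
      ((blkLines_subset (by omega) (by omega) (by omega) (by omega)).trans hZ) hroom))).mono
      (le_of_eq ?_)
    push_cast
    ring
  | middle i a k K L j c h1 h2 h3 h4 h5 h6 e hP hQ =>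
    intro Z hi hk hj hg hZ hroom
    by_cases hfit : max a c * (K + L) ≤ s ^ 2
    · exact fit _ _ _ _ _ _ Z hi hk hj hg hZ hroom hfit
    have g := hg h4 (by omega) h5
    rw [e]
    refine ((hP Z hi (by omega) hj (fun _ _ _ => g.middle hσ h6 (by omega) (by omega) h3 (by omega))
      hZ hroom).append (hQ Z hi (by omega) hj
      (fun _ _ _ => g.middle hσ h6 (by omega) (by omega) (by omega) (by omega)) hZ hroom)).mono
      (le_of_eq ?_)
    push_cast
    ring

/-- The output block is loaded once, held during the whole task and written at most once. The factor
`700` absorbs partial lines, as `B ≤ 40 * s ≤ 120 * max a c`. -/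
theorem mulProg_runsIn_of_fit {M B s n : ℕ} {σ : ℝ} (hs : CacheScale M B s) (hσ : 1 ≤ σ)
    {i a k K j c : ℕ} (hi : i + a ≤ n + 1) (hk : k + K ≤ n + 1) (hj : j + c ≤ n + 1)
    (hg : 0 < a → 0 < K → 0 < c → Good s σ a K c ∧ s ≤ 3 * max a c) (hfit : max a c ≤ s) :
    RunsIn M B (mulProg n (σ ^ 2) i a k K j c).ops
      (16000 * (a * K * c) * σ / s + 700 * (a * c * max 1 (3 * K / (σ ^ 2 * s))))
      (700 * (a * c * max 1 (3 * K / (σ ^ 2 * s)))) := by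
  by_cases h0 : a = 0 ∨ K = 0 ∨ c = 0
  · rw [mulProg_of_empty _ _ _ _ _ h0]
    exact runsIn_nil.mono (by positivity) (by positivity)
  obtain ⟨g, hsm⟩ := hg (by omega) (by omega) (by omega)
  have ma := le_max_left a c
  have mc := le_max_right a c
  have hnear := g.near
  have cZ := card_blkLines (B := B) hs.B_pos n i a j c
  have e : a * (c + 2 * B) ≤ s * (s + 2 * B) := Nat.mul_le_mul (by omega) (by omega)
  have room : Roomy M B s (blkLines n B i a j c) ∧ (blkLines n B i a j c).card * B ≤ M := by
    rcases hs.fits with h1 | h400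
    · have : (blkLines n B i a j c).card ≤ 1 := (card_blkLines_le_mul _ _ _ _ _ _).trans
        (by nlinarith)
      refine ⟨Or.inl ⟨h1, this⟩, ?_⟩
      have := hs.three
      nlinarith
    · have := hs.mul_B_le (a := s) (m := 20) (by omega)
      have e2 : s * (s + 2 * B) = s ^ 2 + 2 * (s * B) := by ring
      exact ⟨Or.inr ⟨h400, by omega⟩, by omega⟩
  have hw : ((blkLines n B i a j c).card * B : ℝ) ≤
      700 * (a * c * max 1 (3 * K / (σ ^ 2 * s))) := by
    have h1 : a * (c + 2 * B) ≤ 700 * (a * c) := by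
      have := hs.B_le
      calc a * (c + 2 * B) ≤ a * (700 * c) := Nat.mul_le_mul_left _ (by omega)
        _ = _ := by ring
    have h2 : ((blkLines n B i a j c).card * B : ℝ) ≤ 700 * (a * c * 1) := by
      rw [mul_one]; exact_mod_cast cZ.trans h1
    refine h2.trans ?_
    gcongr
    exact le_max_left _ _
  refine ((mulProg_held hs hσ i a k K j c _ hi hk hj (fun _ _ _ => g) subset_rfl room.1).runsIn
    room.2).mono ?_ hw
  linarith

/-- Splitting continues until the output block has side at most `s`; then each pass over a block
costs its size. The factor `max 1 (3 * K / (σ ^ 2 * s))` bounds the number of passes in a form that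
is additive under every split occurring above that scale. -/
theorem mulProg_runsIn {M B s n : ℕ} {σ : ℝ} (hs : CacheScale M B s) (hσ : 1 ≤ σ)
    (i a k K j c : ℕ) : i + a ≤ n + 1 → k + K ≤ n + 1 → j + c ≤ n + 1 →
    (0 < a → 0 < K → 0 < c → Good s σ a K c ∧ s ≤ 3 * max a c) →
    RunsIn M B (mulProg n (σ ^ 2) i a k K j c).ops
      (16000 * (a * K * c) * σ / s + 700 * (a * c * max 1 (3 * K / (σ ^ 2 * s))))
      (700 * (a * c * max 1 (3 * K / (σ ^ 2 * s)))) := by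
  induction i, a, k, K, j, c using mulProg_induction (n := n) (one_le_pow₀ hσ : 1 ≤ σ ^ 2) with
  | empty i a k K j c h e =>
    intro _ _ _ _
    rw [e]
    exact runsIn_nil.mono (by positivity) (by positivity)
  | single i k j e =>
    intro hi hk hj hg
    exact mulProg_runsIn_of_fit hs hσ hi hk hj hg (by simpa using hs.pos)
  | outer i a b k K j c d h1 h2 h3 h4 h5 h6 h7 h8 h9 e hP hQ hR hS =>
    intro hi hk hj hg
    by_cases hfit : max (a + b) (c + d) ≤ s
    · exact mulProg_runsIn_of_fit hs hσ hi hk hj hg hfit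
    obtain ⟨g, -⟩ := hg (by omega) h6 (by omega)
    have hnear := g.near
    have hw := g.wide
    have hl : s ^ 2 ≤ 6 * (max (a + b) (c + d) * K) := by nlinarith
    have good : ∀ x y, (x = a ∨ x = b) → (y = c ∨ y = d) → 0 < x → 0 < K → 0 < y →
        Good s σ x K y ∧ s ≤ 3 * max x y := fun x y hx hy hx0 _ hy0 =>
      ⟨g.outer h9 hl (by omega) (by omega) (by omega) (by omega) (by omega), by omega⟩
    rw [e]
    refine (((hP (by omega) hk (by omega) (good _ _ (by simp) (by simp))).append
      (hQ (by omega) hk (by omega) (good _ _ (by simp) (by simp)))).append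
      ((hR (by omega) hk (by omega) (good _ _ (by simp) (by simp))).append
      (hS (by omega) hk (by omega) (good _ _ (by simp) (by simp))))).mono
      (le_of_eq ?_) (le_of_eq ?_)
    all_goals push_cast; ring
  | middle i a k K L j c h1 h2 h3 h4 h5 h6 e hP hQ =>
    intro hi hk hj hg
    by_cases hfit : max a c ≤ s
    · exact mulProg_runsIn_of_fit hs hσ hi hk hj hg hfit
    obtain ⟨g, hsm⟩ := hg h4 (by omega) h5
    have hw := g.wide
    have hl : s ^ 2 ≤ 6 * (max a c * (K + L)) := by nlinarith
    have s0 : (0 : ℝ) < s := by exact_mod_cast hs.pos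
    -- A middle split of a block of side above `s` means that the middle range exceeds `σ ^ 2 * s`.
    -- Its halves exceed a third of this, so for the task and both halves the maximum is its second
    -- argument, which is linear in the middle length.
    have big : σ ^ 2 * s < (K + L : ℕ) := by
      rcases h6 with h6 | h6
      · have := hs.pos; omega
      · refine lt_of_le_of_lt ?_ h6
        gcongr
        omega
    have term : ∀ x : ℕ, K + L ≤ 3 * x → max 1 (3 * (x : ℝ) / (σ ^ 2 * s)) = 3 * x / (σ ^ 2 * s) := by
      intro x hx
      refine max_eq_right ?_
      rw [one_le_div (by positivity)]
      exact big.le.trans (by exact_mod_cast hx)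
    have hP' := hP hi (by omega) hj (fun _ _ _ =>
      ⟨g.middle hσ h6 (by omega) (by omega) h3 (by omega), hsm⟩)
    have hQ' := hQ hi (by omega) hj (fun _ _ _ =>
      ⟨g.middle hσ h6 (by omega) (by omega) (by omega) (by omega), hsm⟩)
    rw [term K (by omega)] at hP'
    rw [term L (by omega)] at hQ'
    rw [e, term (K + L) (by omega)]
    refine (hP'.append hQ').mono (le_of_eq ?_) (le_of_eq ?_)
    all_goals push_cast; ring

/-! ### Square and triangle tasks -/

/-- Replacing the maximum by a sum separates a term proportional to the number of cells from one
pass over the output. -/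
theorem mulProg_runsIn' {M B s n : ℕ} {σ : ℝ} (hs : CacheScale M B s) (hσ : 1 ≤ σ)
    (i a k K j c : ℕ) (hi : i + a ≤ n + 1) (hk : k + K ≤ n + 1) (hj : j + c ≤ n + 1)
    (h1 : a ≤ c + 1 ∧ c ≤ a + 1) (h2 : a ≤ K + 1 ∧ K ≤ a + 1) (h3 : c ≤ K + 1 ∧ K ≤ c + 1)
    (hlarge : 0 < a → 0 < K → 0 < c → s ≤ 3 * a ∧ s ≤ 3 * K) :
    RunsIn M B (mulProg n (σ ^ 2) i a k K j c).ops
      (16000 * σ / s * (a * K * c) + (2100 / (σ ^ 2 * s) * (a * K * c) + 700 * (a * c)))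
      (2100 / (σ ^ 2 * s) * (a * K * c) + 700 * (a * c)) := by
  have hm : (700 * (a * c * max 1 (3 * K / (σ ^ 2 * s))) : ℝ) ≤
      2100 / (σ ^ 2 * s) * (a * K * c) + 700 * (a * c) := by
    have : max 1 (3 * (K : ℝ) / (σ ^ 2 * s)) ≤ 1 + 3 * K / (σ ^ 2 * s) :=
      max_le (le_add_of_nonneg_right (by positivity)) (le_add_of_nonneg_left zero_le_one)
    calc (700 * (a * c * max 1 (3 * K / (σ ^ 2 * s))) : ℝ)
        ≤ 700 * (a * c * (1 + 3 * K / (σ ^ 2 * s))) := by gcongr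
      _ = _ := by ring
  refine (mulProg_runsIn hs hσ i a k K j c hi hk hj fun ha hK hc => ?_).mono ?_ hm
  · obtain ⟨sa, sK⟩ := hlarge ha hK hc
    have := le_max_left a c
    exact ⟨Good.of_near hσ ha hK h1 h2 h3.1 sa sK, by omega⟩
  · refine add_le_add (le_of_eq ?_) hm
    ring

/-- The number of cells of a square task. -/
noncomputable def sqCells (p q : ℝ) : ℝ := p * q * (p + q - 2) / 2

theorem sqCells_nonneg (p q : ℕ) : 0 ≤ sqCells p q := by
  unfold sqCells
  rcases Nat.eq_zero_or_pos p with rfl | hp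
  · simp
  rcases Nat.eq_zero_or_pos q with rfl | hq
  · simp
  have h1 : (1 : ℝ) ≤ p := by exact_mod_cast hp
  have h2 : (1 : ℝ) ≤ q := by exact_mod_cast hq
  have h3 : (0 : ℝ) ≤ p + q - 2 := by linarith
  positivity

/-- The four blocks touched by a square at cache scale fit together; for `s = 1` the square is one
copy, which needs two lines. -/
theorem runsIn_sq_of_fit {M B s n : ℕ} {σ : ℝ} (hs : CacheScale M B s) (hσ : 1 ≤ σ)
    {i p j q : ℕ} (hij : i + p ≤ j) (hj : j + q ≤ n + 1) (hpq : p ≤ q + 1 ∧ q ≤ p + 1)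
    (hlarge : 0 < p → 0 < q → s ≤ 3 * max p q) (hfit : max p q ≤ s) :
    RunsIn M B (sqProg n (σ ^ 2) i p j q).ops (2800 * (p * q)) (2800 * (p * q)) := by
  by_cases h0 : p = 0 ∨ q = 0
  · rw [sqProg_of_empty _ _ _ _ h0]
    exact runsIn_nil.mono (by positivity) (by positivity)
  have hl := hlarge (by omega) (by omega)
  have hBs := hs.B_le
  have acc := sqProg_acc (n := n) (ρ := σ ^ 2) (one_le_pow₀ hσ) i p j q hij hj
  rcases hs.fits with h1 | h400
  · obtain ⟨rfl, rfl⟩ : p = 1 ∧ q = 1 := by omega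
    have e : sqProg n (σ ^ 2) i 1 j 1 = .op (copyI n i j) := by
      rw [sqProg, if_neg (by omega), if_pos (by omega)]
    rw [e]
    have hc : ({addr n i j / B, addr n j i / B} : Finset ℕ).card * B ≤ 2 * B :=
      Nat.mul_le_mul_right _ (Finset.card_le_two)
    have h3 := hs.three
    have hw : ((({addr n i j / B, addr n j i / B} : Finset ℕ).card * B : ℕ) : ℝ) ≤
        2800 * ((1 : ℕ) * (1 : ℕ)) := by
      norm_num
      exact_mod_cast (show _ ≤ 2800 by omega)
    push_cast at hw
    refine (runsIn_of_fit (Z := {addr n i j / B, addr n j i / B}) (by omega) ?_ ?_).mono ?_ ?_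
    · simp [SP.ops, copyI, Instr.sources]
    · simp [SP.ops, copyI, Instr.target]
    · simpa using hw
    · simpa using hw
  · set Z := (blkLines n B i p i p ∪ blkLines n B i p j q) ∪
      (blkLines n B j q i p ∪ blkLines n B j q j q) with hZ
    have hc : Z.card * B ≤ (p + q) * (p + q + 4 * B) := by
      have h1 := card_blkLines hs.B_pos n i p i p
      have h2 := card_blkLines hs.B_pos n i p j q
      have h3 := card_blkLines hs.B_pos n j q i p
      have h4 := card_blkLines hs.B_pos n j q j q
      have h5 : Z.card ≤ ((blkLines n B i p i p).card + (blkLines n B i p j q).card) +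
          ((blkLines n B j q i p).card + (blkLines n B j q j q).card) :=
        (Finset.card_union_le _ _).trans (Nat.add_le_add (Finset.card_union_le _ _)
          (Finset.card_union_le _ _))
      have h6 := Nat.mul_le_mul_right B h5
      nlinarith
    have pm := le_max_left p q
    have qm := le_max_right p q
    have hM : Z.card * B ≤ M := by
      have h20 := hs.mul_B_le (a := s) (m := 20) (by omega)
      have : (p + q) * (p + q + 4 * B) ≤ (2 * s) * (2 * s + 4 * B) :=
        Nat.mul_le_mul (by omega) (by omega)
      have e : (2 * s) * (2 * s + 4 * B) = 4 * s ^ 2 + 8 * (s * B) := by ring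
      omega
    have hw' : Z.card * B ≤ 2800 * (p * q) := by
      refine hc.trans ?_
      have h1 : p + q + 4 * B ≤ 481 * (p + q) := by omega
      have h2 : (p + q) * (p + q) ≤ 5 * (p * q) := by
        have hp : 1 ≤ p := by omega
        have hq : 1 ≤ q := by omega
        rcases (by omega : p = q ∨ p = q + 1 ∨ q = p + 1) with h | h | h <;> subst h <;> nlinarith
      calc (p + q) * (p + q + 4 * B) ≤ (p + q) * (481 * (p + q)) := Nat.mul_le_mul_left _ h1
        _ = 481 * ((p + q) * (p + q)) := by ring
        _ ≤ _ := by omega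
    have hw : ((Z.card * B : ℕ) : ℝ) ≤ 2800 * (p * q) := by exact_mod_cast hw'
    push_cast at hw
    refine (runsIn_of_fit hM (fun x hx y hy => ?_) fun x hx => ?_).mono hw hw
    · obtain ⟨u, v, -, -, h, rfl⟩ := (acc x hx).2 y hy
      simp only [hZ, Finset.mem_union]
      rcases h with h | h | h | h
      exacts [Or.inl (Or.inl (mem_blkLines h)), Or.inl (Or.inr (mem_blkLines h)),
        Or.inr (Or.inl (mem_blkLines h)), Or.inr (Or.inr (mem_blkLines h))]
    · obtain ⟨u, v, -, -, h, e⟩ := (acc x hx).1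
      rw [e]
      simp only [hZ, Finset.mem_union]
      rcases h with h | h
      exacts [Or.inl (Or.inr (mem_blkLines h)), Or.inr (Or.inl (mem_blkLines h))]

/-- The number of cells is exactly additive over the quadrants and products. Each of the `l` levels
above the cache scale adds a bounded number of passes over the outputs, which gives the factor `l +
1`. -/
theorem sqProg_runsIn {M B s n : ℕ} {σ : ℝ} (hs : CacheScale M B s) (hσ : 1 ≤ σ)
    (i p j q : ℕ) : ∀ l : ℕ, p ≤ 2 ^ l * s → q ≤ 2 ^ l * s → i + p ≤ j → j + q ≤ n + 1 →
    (p ≤ q + 1 ∧ q ≤ p + 1) → (0 < p → 0 < q → s ≤ 3 * max p q) →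
    RunsIn M B (sqProg n (σ ^ 2) i p j q).ops
      (16000 * σ / s * sqCells p q +
        (2100 / (σ ^ 2 * s) * sqCells p q + 2800 * (p * q) * (l + 1)))
      (2100 / (σ ^ 2 * s) * sqCells p q + 2800 * (p * q) * (l + 1)) := by
  have fit : ∀ (i p j q l : ℕ), i + p ≤ j → j + q ≤ n + 1 →
      (p ≤ q + 1 ∧ q ≤ p + 1) → (0 < p → 0 < q → s ≤ 3 * max p q) → max p q ≤ s →
      RunsIn M B (sqProg n (σ ^ 2) i p j q).ops
        (16000 * σ / s * sqCells p q +
          (2100 / (σ ^ 2 * s) * sqCells p q + 2800 * (p * q) * (l + 1)))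
        (2100 / (σ ^ 2 * s) * sqCells p q + 2800 * (p * q) * (l + 1)) := by
    intro i p j q l hij hj hpq hl hfit
    have h0 := sqCells_nonneg p q
    have h1 : 0 ≤ 2100 / (σ ^ 2 * s) * sqCells p q := by positivity
    have h2 : 0 ≤ 16000 * σ / s * sqCells p q := by positivity
    have h3 : (0 : ℝ) ≤ 2800 * (p * q) * l := by positivity
    exact (runsIn_sq_of_fit hs hσ hij hj hpq hl hfit).mono (by linarith) (by linarith)
  induction i, p, j, q using sqProg_induction (n := n) (ρ := σ ^ 2) with
  | empty i p j q h e =>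
    intro l _ _ hij hj hpq hl
    exact fit i p j q l hij hj hpq hl (by have := hs.pos; omega)
  | single i j e =>
    intro l _ _ hij hj hpq hl
    exact fit i 1 j 1 l hij hj hpq hl (by simpa using hs.pos)
  | split i a b j c d h1 h2 h3 h4 h5 h6 h7 e hP hQ hR hS =>
    intro l hlp hlq hij hj hpq hlarge
    by_cases hfit : max (a + b) (c + d) ≤ s
    · exact fit i (a + b) j (c + d) l hij hj hpq hlarge hfit
    rcases l with _ | l
    · rw [pow_zero, one_mul] at hlp hlq; omega
    rw [pow_succ, mul_right_comm] at hlp hlq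
    have m1 := mulProg_runsIn' (n := n) hs hσ i a (i + a) b j c (by omega) (by omega) (by omega)
      (by omega) (by omega) (by omega) (by omega)
    have m2 := mulProg_runsIn' (n := n) hs hσ (i + a) b j c (j + c) d (by omega) (by omega)
      (by omega) (by omega) (by omega) (by omega) (by omega)
    have m3 := mulProg_runsIn' (n := n) hs hσ i a (i + a) b (j + c) d (by omega) (by omega)
      (by omega) (by omega) (by omega) (by omega) (by omega)
    have m4 := mulProg_runsIn' (n := n) hs hσ i a j c (j + c) d (by omega) (by omega)
      (by omega) (by omega) (by omega) (by omega) (by omega)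
    have P := hP l (by omega) (by omega) (by omega) (by omega) (by omega) (by omega)
    have Q := hQ l (by omega) (by omega) (by omega) (by omega) (by omega) (by omega)
    have R := hR l (by omega) (by omega) (by omega) (by omega) (by omega) (by omega)
    have S := hS l (by omega) (by omega) (by omega) (by omega) (by omega) (by omega)
    rw [e]
    refine (R.append (((m1.append P).append (m2.append S)).append
      (m3.append (m4.append Q)))).mono ?_ ?_
    all_goals
      rw [← sub_nonneg]
      -- The cell counts cancel. The additional level allows `2800 * (a + b) * (c + d)`, of which
      -- the four products use `700 * (a * c + b * d + 2 * a * d)`; this is the remainder.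
      refine le_of_le_of_eq (b := 700 * (3 * ((a : ℝ) * c) + 3 * (b * d) + 2 * (a * d) +
        4 * (b * c))) (by positivity) ?_
      unfold sqCells
      push_cast
      ring

/-- The number of cells of a triangle task. -/
noncomputable def triCells (L : ℝ) : ℝ := L * (L - 1) * (L - 2) / 6

theorem triCells_nonneg (L : ℕ) : 0 ≤ triCells L := by
  unfold triCells
  rcases (by omega : L = 0 ∨ L = 1 ∨ 2 ≤ L) with rfl | rfl | h
  · simp
  · simp
  · have h2 : (2 : ℝ) ≤ L := by exact_mod_cast h
    have h3 : (0 : ℝ) ≤ L - 1 := by linarith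
    have h4 : (0 : ℝ) ≤ L - 2 := by linarith
    positivity

theorem triProg_runsIn_of_fit {M B s n : ℕ} {σ : ℝ} (hs : CacheScale M B s) (hσ : 1 ≤ σ)
    {i L : ℕ} (hi : i + L ≤ n + 1) (hl : s ≤ 3 * L) (hfit : L ≤ s) :
    RunsIn M B (triProg n (σ ^ 2) i L).ops (2800 * L ^ 2) (2800 * L ^ 2) := by
  rcases hs.fits with h1 | h400
  · rw [triProg, if_pos (by omega)]
    exact runsIn_nil.mono (by positivity) (by positivity)
  have hc := card_blkLines hs.B_pos n i L i L
  have hB := hs.B_le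
  have acc := triProg_acc (n := n) (ρ := σ ^ 2) (one_le_pow₀ hσ) i L hi
  have hM : (blkLines n B i L i L).card * B ≤ M := by
    have h20 := hs.mul_B_le (a := s) (m := 20) (by omega)
    have : L * (L + 2 * B) ≤ s * (s + 2 * B) := Nat.mul_le_mul (by omega) (by omega)
    have e : s * (s + 2 * B) = s ^ 2 + 2 * (s * B) := by ring
    omega
  have hw' : (blkLines n B i L i L).card * B ≤ 2800 * L ^ 2 :=
    calc (blkLines n B i L i L).card * B ≤ L * (L + 2 * B) := hc
      _ ≤ L * (2800 * L) := Nat.mul_le_mul_left _ (by omega)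
      _ = _ := by ring
  have hw : (((blkLines n B i L i L).card * B : ℕ) : ℝ) ≤ 2800 * L ^ 2 := by exact_mod_cast hw'
  push_cast at hw
  refine (runsIn_of_fit hM (fun x hx y hy => ?_) fun x hx => ?_).mono hw hw
  · obtain ⟨u, v, -, -, h, rfl⟩ := (acc x hx).2 y hy
    exact mem_blkLines h
  · obtain ⟨u, v, -, -, h, e⟩ := (acc x hx).1
    rw [e]
    exact mem_blkLines h

theorem triProg_runsIn {M B s n : ℕ} {σ : ℝ} (hs : CacheScale M B s) (hσ : 1 ≤ σ)
    (i L : ℕ) : ∀ l : ℕ, L ≤ 2 ^ l * s → i + L ≤ n + 1 → s ≤ 3 * L →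
    RunsIn M B (triProg n (σ ^ 2) i L).ops
      (16000 * σ / s * triCells L + (2100 / (σ ^ 2 * s) * triCells L + 2800 * L ^ 2 * (l + 1)))
      (2100 / (σ ^ 2 * s) * triCells L + 2800 * L ^ 2 * (l + 1)) := by
  have fit : ∀ i L l : ℕ, i + L ≤ n + 1 → s ≤ 3 * L → L ≤ s →
      RunsIn M B (triProg n (σ ^ 2) i L).ops
      (16000 * σ / s * triCells L + (2100 / (σ ^ 2 * s) * triCells L + 2800 * L ^ 2 * (l + 1)))
      (2100 / (σ ^ 2 * s) * triCells L + 2800 * L ^ 2 * (l + 1)) := by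
    intro i L l hi hl hfit
    have h0 := triCells_nonneg L
    have h1 : 0 ≤ 2100 / (σ ^ 2 * s) * triCells L := by positivity
    have h2 : 0 ≤ 16000 * σ / s * triCells L := by positivity
    have h3 : (0 : ℝ) ≤ 2800 * L ^ 2 * l := by positivity
    exact (triProg_runsIn_of_fit hs hσ hi hl hfit).mono (by linarith) (by linarith)
  induction i, L using triProg_induction (n := n) (ρ := σ ^ 2) with
  | small i L h e =>
    intro l _ hi hl
    exact fit i L l hi hl (h.trans hs.pos)
  | split i a b h1 h2 h3 e hP hQ =>
    intro l hL hi hl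
    by_cases hfit : a + b ≤ s
    · exact fit i (a + b) l hi hl hfit
    rcases l with _ | l
    · rw [pow_zero, one_mul] at hL; omega
    rw [pow_succ, mul_right_comm] at hL
    have P := hP l (by omega) (by omega) (by omega)
    have Q := hQ l (by omega) (by omega) (by omega)
    have S := sqProg_runsIn (n := n) hs hσ i a (i + a) b l (by omega) (by omega) (by omega)
      (by omega) (by omega) (by omega)
    rw [e]
    refine ((P.append Q).append S).mono ?_ ?_
    all_goals
      rw [← sub_nonneg]
      refine le_of_le_of_eq (b := 2800 * (((a : ℝ) + b) ^ 2 + a * b * (l + 1)))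
        (by positivity) ?_
      unfold sqCells triCells
      push_cast
      ring

/-! ### Total reads and writes of the algorithm. -/

theorem exists_log_le {x : ℝ} (hx : 1 ≤ x) :
    ∃ l : ℕ, x ≤ 2 ^ l ∧ (l + 1 : ℝ) ^ 3 ≤ 100 * x := by
  -- A cubic bound is what the absorption of the logarithm needs: `σ ^ 2 * (l + 1)` will be compared
  -- with `n / √M ≥ σ ^ 3` after cubing.
  have key : ∀ l : ℕ, (l + 1 + 1) ^ 3 ≤ 100 * 2 ^ l := by
    intro l
    induction l using Nat.strong_induction_on with
    | _ l ih =>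
      rcases (by omega : l = 0 ∨ l = 1 ∨ l = 2 ∨ 3 ≤ l) with rfl | rfl | rfl | h
      · norm_num
      · norm_num
      · norm_num
      · obtain ⟨m, rfl⟩ : ∃ m, l = m + 1 := ⟨l - 1, by omega⟩
        have h1 := ih m (by omega)
        rw [pow_succ 2 m]
        nlinarith [Nat.mul_le_mul h h, Nat.zero_le (m ^ 2 * (m - 2)), sq_nonneg m]
  have hex : ∃ l : ℕ, x ≤ 2 ^ l := pow_unbounded_of_one_lt x one_lt_two |>.imp fun _ h => h.le
  classical
  refine ⟨Nat.find hex, Nat.find_spec hex, ?_⟩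
  rcases h : Nat.find hex with _ | l
  · norm_num
    linarith
  · have h1 : ¬ x ≤ 2 ^ l := Nat.find_min hex (by omega)
    have h2 : ((l : ℝ) + 1 + 1) ^ 3 ≤ 100 * 2 ^ l := by exact_mod_cast key l
    push_cast
    linarith

/-- Upper bounds for the reads and writes of the algorithm, up to constants. -/
theorem exists_cacheRun {n M B : ℕ} {σ : ℝ} (hσ : 1 ≤ σ) (hn : 2 ≤ n) (hB : 0 < B)
    (h3 : 3 * B ≤ M) (ht : B ^ 2 ≤ M) (hMn : √(M : ℝ) ≤ n) :
    ∃ (R W l : ℕ), CacheRun M B ∅ ∅ (triProg n (σ ^ 2) 0 (n + 1)).ops R W ∧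
      (l + 1 : ℝ) ^ 3 ≤ 8000 * (n / √(M : ℝ)) ∧
      (R : ℝ) ≤ 1000000 * (σ * (n ^ 3 / (B * √(M : ℝ))) + n ^ 2 * (l + 1) / B) ∧
      (W : ℝ) ≤ 1000000 * (1 / σ ^ 2 * (n ^ 3 / (B * √(M : ℝ))) + n ^ 2 * (l + 1) / B) := by
  obtain ⟨s, hs⟩ := exists_cacheScale hB h3 ht
  have s0 : (0 : ℝ) < s := by exact_mod_cast hs.pos
  have B0 : (0 : ℝ) < B := by exact_mod_cast hB
  have M0 : (0 : ℝ) < M := by exact_mod_cast (by omega : 0 < M)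
  have n0 : (2 : ℝ) ≤ n := by exact_mod_cast hn
  set m := √(M : ℝ) with hm
  have m0 : 0 < m := Real.sqrt_pos.2 M0
  have hms : m ≤ 40 * s := by
    rw [hm, Real.sqrt_le_left (by positivity)]
    exact_mod_cast hs.le
  have hsM : (s : ℝ) ≤ m := by
    rw [hm]
    apply Real.le_sqrt_of_sq_le
    rcases hs.fits with h | h
    · subst h; norm_num; exact_mod_cast (by omega : 1 ≤ M)
    · exact_mod_cast (by omega : s ^ 2 ≤ M)
  have hsn : s ≤ n := by exact_mod_cast hsM.trans hMn
  have hx : 1 ≤ ((n : ℝ) + 1) / s := by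
    rw [one_le_div s0]
    have : (s : ℝ) ≤ n := by exact_mod_cast hsn
    linarith
  obtain ⟨l, hl1, hl2⟩ := exists_log_le hx
  rw [div_le_iff₀ s0] at hl1
  obtain ⟨R, W, hrun, hR, hW⟩ := triProg_runsIn (n := n) hs hσ 0 (n + 1) l
    (by exact_mod_cast hl1) (by omega) (by omega)
  have hinv : 1 / (s : ℝ) ≤ 40 / m := by
    rw [div_le_div_iff₀ s0 m0]
    linarith
  have tri : triCells ((n + 1 : ℕ) : ℝ) ≤ (n : ℝ) ^ 3 := by
    unfold triCells
    push_cast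
    nlinarith [sq_nonneg (n : ℝ)]
  have tri0 := triCells_nonneg (n + 1)
  have c1 : triCells ((n + 1 : ℕ) : ℝ) / s ≤ 40 * (n ^ 3 / m) := by
    calc triCells ((n + 1 : ℕ) : ℝ) / s = triCells ((n + 1 : ℕ) : ℝ) * (1 / s) := by ring
      _ ≤ (n : ℝ) ^ 3 * (40 / m) := by gcongr
      _ = _ := by ring
  have c2 : (((n + 1 : ℕ) : ℝ)) ^ 2 * (l + 1) ≤ 3 * n ^ 2 * (l + 1) := by
    have : (((n + 1 : ℕ) : ℝ)) ^ 2 ≤ 3 * n ^ 2 := by push_cast; nlinarith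
    gcongr
  -- The reads include loading the output blocks, at the rate `1 / σ ^ 2` of the writes; the operand
  -- reads dominate this.
  have σ1 : 1 / σ ^ 2 ≤ σ := by
    rw [div_le_iff₀ (by positivity)]
    have := one_le_pow₀ (n := 3) hσ
    nlinarith
  set T := triCells ((n + 1 : ℕ) : ℝ) with hT
  have e2 : 2100 / (σ ^ 2 * s) * T = 2100 * (1 / σ ^ 2 * (T / s)) := by field_simp
  have b2 : 1 / σ ^ 2 * (T / s) ≤ 1 / σ ^ 2 * (40 * (n ^ 3 / m)) := by gcongr
  refine ⟨R, W, l, hrun, ?_, ?_, ?_⟩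
  · refine hl2.trans ?_
    have : ((n : ℝ) + 1) / s ≤ 80 * (n / m) := by
      calc ((n : ℝ) + 1) / s = (n + 1) * (1 / s) := by ring
        _ ≤ (2 * n) * (40 / m) := by gcongr; linarith
        _ = _ := by ring
    linarith
  · have e1 : 16000 * σ / s * T = 16000 * (σ * (T / s)) := by ring
    have b1 : σ * (T / s) ≤ σ * (40 * (n ^ 3 / m)) := by gcongr
    have b3 : 1 / σ ^ 2 * (40 * (n ^ 3 / m)) ≤ σ * (40 * (n ^ 3 / m)) := by gcongr
    have p1 : 0 ≤ σ * (n ^ 3 / m) := by positivity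
    have p2 : 0 ≤ (n : ℝ) ^ 2 * (l + 1) := by positivity
    have : (R : ℝ) * B ≤ 1000000 * (σ * (n ^ 3 / m) + n ^ 2 * (l + 1)) := by linarith
    calc (R : ℝ) = R * B / B := by field_simp
      _ ≤ 1000000 * (σ * (n ^ 3 / m) + n ^ 2 * (l + 1)) / B := by gcongr
      _ = _ := by field_simp
  · have p1 : 0 ≤ 1 / σ ^ 2 * (n ^ 3 / m) := by positivity
    have p2 : 0 ≤ (n : ℝ) ^ 2 * (l + 1) := by positivity
    have : (W : ℝ) * B ≤ 1000000 * (1 / σ ^ 2 * (n ^ 3 / m) + n ^ 2 * (l + 1)) := by linarith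
    calc (W : ℝ) = W * B / B := by field_simp
      _ ≤ 1000000 * (1 / σ ^ 2 * (n ^ 3 / m) + n ^ 2 * (l + 1)) / B := by gcongr
      _ = _ := by field_simp

/-! ## Lower bounds for the cache complexity -/

/-! ### Splitting a cache run -/

/-- A line modified during `t₁` is either written back during `t₁` or still dirty at the cut, which
bounds `F`. A line used during `t₁` was either resident at the start or loaded, which bounds `G`.
The inclusions of `dirty` and `res` carry the induction. -/
theorem cacheRun_split {M B : ℕ} {res dirty : Finset ℕ} {t : List Instr} {R W : ℕ}
    (h : CacheRun M B res dirty t R W) : ∀ t₁ t₂, t = t₁ ++ t₂ → dirty ⊆ res → res.card * B ≤ M →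
    ∃ (res' dirty' : Finset ℕ) (R₁ W₁ R₂ W₂ : ℕ) (F G : Finset ℕ),
      (dirty' ⊆ res' ∧ res'.card * B ≤ M) ∧ CacheRun M B res' dirty' t₂ R₂ W₂ ∧
      R₁ + R₂ = R ∧ W₁ + W₂ = W ∧
      (F.card ≤ dirty'.card + W₁ ∧ dirty ⊆ F ∧ ∀ x ∈ t₁, x.target / B ∈ F) ∧
      G.card ≤ res.card + R₁ ∧ res ⊆ G ∧ ∀ x ∈ t₁, ∀ y ∈ x.sources, y / B ∈ G := by
  induction h with
  | finish =>
    intro t₁ t₂ ht hd hM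
    obtain ⟨rfl, rfl⟩ := List.append_eq_nil_iff.1 ht.symm
    exact ⟨∅, ∅, 0, 0, 0, 0, ∅, ∅, ⟨hd, hM⟩, .finish, rfl, rfl, by simp, by simp⟩
  | @load res dirty t R W l hl hc h ih =>
    intro t₁ t₂ ht hd hM
    obtain ⟨res', dirty', R₁, W₁, R₂, W₂, F, G, h1, h2, h3, h4, h5, h6, h7, h8⟩ :=
      ih t₁ t₂ ht (hd.trans (Finset.subset_insert _ _))
        (by rwa [Finset.card_insert_of_notMem hl])
    rw [Finset.card_insert_of_notMem hl] at h6
    exact ⟨res', dirty', R₁ + 1, W₁, R₂, W₂, F, G, h1, h2, by omega, h4, h5, by omega,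
      (Finset.subset_insert _ _).trans h7, h8⟩
  | @drop res dirty t R W l hl hld h ih =>
    intro t₁ t₂ ht hd hM
    have hcard := Finset.card_erase_add_one hl
    obtain ⟨res', dirty', R₁, W₁, R₂, W₂, F, G, h1, h2, h3, h4, h5, h6, h7, h8⟩ :=
      ih t₁ t₂ ht (Finset.subset_erase.2 ⟨hd, hld⟩)
        ((Nat.mul_le_mul_right _ (Finset.card_le_card (Finset.erase_subset _ _))).trans hM)
    refine ⟨res', dirty', R₁, W₁, R₂, W₂, F, insert l G, h1, h2, h3, h4, h5, ?_, ?_, ?_⟩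
    · have := Finset.card_insert_le l G
      omega
    · exact Finset.subset_insert_iff.2 h7
    · exact fun x hx y hy => Finset.mem_insert_of_mem (h8 x hx y hy)
  | @writeBack res dirty t R W l hl hld h ih =>
    intro t₁ t₂ ht hd hM
    have hcard := Finset.card_erase_add_one hl
    obtain ⟨res', dirty', R₁, W₁, R₂, W₂, F, G, h1, h2, h3, h4, ⟨h5, h5', h5''⟩, h6, h7, h8⟩ :=
      ih t₁ t₂ ht (Finset.erase_subset_erase _ hd)
        ((Nat.mul_le_mul_right _ (Finset.card_le_card (Finset.erase_subset _ _))).trans hM)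
    refine ⟨res', dirty', R₁, W₁ + 1, R₂, W₂, insert l F, insert l G, h1, h2, h3, by omega,
      ⟨?_, ?_, ?_⟩, ?_, ?_, ?_⟩
    · have := Finset.card_insert_le l F
      omega
    · exact Finset.subset_insert_iff.2 h5'
    · exact fun x hx => Finset.mem_insert_of_mem (h5'' x hx)
    · have := Finset.card_insert_le l G
      omega
    · exact Finset.subset_insert_iff.2 h7
    · exact fun x hx y hy => Finset.mem_insert_of_mem (h8 x hx y hy)
  | @exec res dirty t R W a hs ht' h ih =>
    intro t₁ t₂ ht hd hM
    rcases t₁ with _ | ⟨b, t₁⟩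
    · rw [List.nil_append] at ht
      exact ⟨res, dirty, 0, 0, R, W, dirty, res, ⟨hd, hM⟩, ht ▸ .exec a hs ht' h, by omega,
        by omega, ⟨by omega, subset_rfl, by simp⟩, by omega, subset_rfl, by simp⟩
    · rw [List.cons_append, List.cons.injEq] at ht
      obtain ⟨rfl, ht⟩ := ht
      obtain ⟨res', dirty', R₁, W₁, R₂, W₂, F, G, h1, h2, h3, h4, ⟨h5, h5', h5''⟩, h6, h7, h8⟩ :=
        ih t₁ t₂ ht (Finset.insert_subset ht' hd) hM
      refine ⟨res', dirty', R₁, W₁, R₂, W₂, F, G, h1, h2, h3, h4,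
        ⟨h5, (Finset.subset_insert _ _).trans h5', ?_⟩, h6, h7, ?_⟩
      · intro x hx
        rcases List.mem_cons.1 hx with rfl | hx
        exacts [h5' (Finset.mem_insert_self _ _), h5'' x hx]
      · intro x hx y hy
        rcases List.mem_cons.1 hx with rfl | hx
        exacts [h7 (hs y hy), h8 x hx y hy]

theorem cacheRun_targets {M B : ℕ} {res dirty : Finset ℕ} {t : List Instr} {R W : ℕ}
    (h : CacheRun M B res dirty t R W) :
    ∃ F : Finset ℕ, F.card ≤ W ∧ dirty ⊆ F ∧ ∀ x ∈ t, x.target / B ∈ F := by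
  induction h with
  | finish => exact ⟨∅, by simp⟩
  | load l _ _ _ ih => exact ih
  | drop l _ _ _ ih => exact ih
  | writeBack l _ _ _ ih =>
    obtain ⟨F, h1, h2, h3⟩ := ih
    exact ⟨insert l F, (Finset.card_insert_le _ _).trans (by omega),
      Finset.subset_insert_iff.2 h2, fun x hx => Finset.mem_insert_of_mem (h3 x hx)⟩
  | exec a _ _ _ ih =>
    obtain ⟨F, h1, h2, h3⟩ := ih
    refine ⟨F, h1, (Finset.subset_insert _ _).trans h2, fun x hx => ?_⟩
    rcases List.mem_cons.1 hx with rfl | hx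
    exacts [h2 (Finset.mem_insert_self _ _), h3 x hx]

/-! ### The discrete Loomis–Whitney inequality -/

/-- Group the cells by `(i, j)`. By Cauchy–Schwarz, `E.card ^ 2` is at most the number of groups
times the number of pairs within a group. Such a pair `(i, k, j)`, `(i, k', j)` is determined by
`(i, k)` and `(k', j)`. -/
theorem loomis_whitney (E : Finset (ℕ × ℕ × ℕ)) :
    E.card ^ 2 ≤ (E.image fun e => (e.1, e.2.2)).card *
      ((E.image fun e => (e.1, e.2.1)).card * (E.image fun e => (e.2.1, e.2.2)).card) := by
  set T := E.image fun e => (e.1, e.2.2) with hT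
  have h1 : E.card = ∑ p ∈ T, (E.filter fun e => (e.1, e.2.2) = p).card :=
    Finset.card_eq_sum_card_fiberwise fun e he => Finset.mem_image_of_mem _ he
  have h2 : (∑ p ∈ T, (E.filter fun e => (e.1, e.2.2) = p).card) ^ 2 ≤
      T.card * ∑ p ∈ T, (E.filter fun e => (e.1, e.2.2) = p).card ^ 2 := sq_sum_le_card_mul_sum_sq
  set Q := (E ×ˢ E).filter fun q => (q.1.1, q.1.2.2) = (q.2.1, q.2.2.2) with hQ
  have h3 : Q.card = ∑ p ∈ T, (E.filter fun e => (e.1, e.2.2) = p).card ^ 2 := by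
    rw [Finset.card_eq_sum_card_fiberwise (f := fun q : (ℕ × ℕ × ℕ) × (ℕ × ℕ × ℕ) =>
      (q.1.1, q.1.2.2)) (t := T)]
    · refine Finset.sum_congr rfl fun p _ => ?_
      rw [sq, ← Finset.card_product]
      congr 1
      ext q
      simp only [hQ, Finset.mem_filter, Finset.mem_product]
      constructor
      · rintro ⟨⟨⟨a, b⟩, c⟩, d⟩
        exact ⟨⟨a, d⟩, b, c ▸ d⟩
      · rintro ⟨⟨a, d⟩, b, c⟩
        exact ⟨⟨⟨a, b⟩, d.trans c.symm⟩, d⟩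
    · intro q hq
      simp only [hQ, Finset.coe_filter, Finset.mem_product] at hq
      exact Finset.mem_image_of_mem (fun e : ℕ × ℕ × ℕ => (e.1, e.2.2)) hq.1.1
  have h4 : Q.card ≤ (E.image fun e => (e.1, e.2.1)).card *
      (E.image fun e => (e.2.1, e.2.2)).card := by
    rw [← Finset.card_product]
    refine Finset.card_le_card_of_injOn (fun q => ((q.1.1, q.1.2.1), (q.2.2.1, q.2.2.2))) ?_ ?_
    · intro q hq
      simp only [hQ, Finset.coe_filter, Finset.mem_product] at hq
      exact Finset.mem_product.2 ⟨Finset.mem_image_of_mem (fun e : ℕ × ℕ × ℕ => (e.1, e.2.1)) hq.1.1,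
        Finset.mem_image_of_mem (fun e : ℕ × ℕ × ℕ => (e.2.1, e.2.2)) hq.1.2⟩
    · rintro ⟨⟨i, k, j⟩, ⟨i', k', j'⟩⟩ hq ⟨⟨x, y, z⟩, ⟨x', y', z'⟩⟩ hq' h
      simp only [hQ, Finset.coe_filter, Finset.mem_product, Set.mem_ofPred_eq, Prod.mk.injEq]
        at hq hq' h ⊢
      omega
  rw [h1]
  refine h2.trans (Nat.mul_le_mul_left _ ?_)
  rw [← h3]
  exact h4

/-! ### Tracing the results through the memory -/

/-- Sets of triples, where combining is the union. -/
abbrev TokVal : Type := (Set (ℕ × ℕ × ℕ))ᵒᵈ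

/-- The tokens of the entry `(i, j)`: those of its cells, or that of an initial value. -/
def tokens (i j : ℕ) : Set (ℕ × ℕ × ℕ) :=
  {τ | τ.1 = i ∧ τ.2.2 = j ∧ ((j = i + 1 ∧ τ.2.1 = i) ∨ (i < τ.2.1 ∧ τ.2.1 < j))}

def tokD (i j : ℕ) : TokVal := OrderDual.toDual (tokens i j)

open Classical in
/-- A cell produces its own token from correct inputs, and an illegal token otherwise. -/
noncomputable def tokG (i k j : ℕ) (x y : TokVal) : TokVal :=
  OrderDual.toDual (if i < k ∧ k < j ∧ x = tokD i k ∧ y = tokD k j then {(i, k, j)} else {(0, 0, 0)})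

theorem tok_solution (n : ℕ) : IsParenSolution n tokG (fun i => tokD i (i + 1)) tokD := by
  refine ⟨fun i _ => rfl, fun i j h hj => ?_⟩
  refine le_antisymm (Finset.le_inf' _ _ fun k hk => ?_) ?_
  · rw [Finset.mem_Ioo] at hk
    rw [tokG, if_pos ⟨hk.1, hk.2, rfl, rfl⟩]
    refine OrderDual.toDual_le_toDual.2 ?_
    rintro τ rfl
    exact ⟨rfl, rfl, Or.inr hk⟩
  · intro τ hτ
    obtain ⟨h1, h2, h3⟩ := hτ
    have hk : i < τ.2.1 ∧ τ.2.1 < j := by omega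
    have := Finset.inf'_le (fun k => tokG i k j (tokD i k) (tokD k j)) (Finset.mem_Ioo.2 hk)
    refine this ?_
    rw [tokG, if_pos ⟨hk.1, hk.2, rfl, rfl⟩]
    subst h1 h2
    exact Set.mem_singleton _

/-- The tokens in a word. -/
def content (a : WithTop TokVal) : Set (ℕ × ℕ × ℕ) := {τ | ∃ x : TokVal, a = x ∧ τ ∈ OrderDual.ofDual x}

theorem content_coe (x : TokVal) : content x = OrderDual.ofDual x := by
  ext τ
  constructor
  · rintro ⟨y, h, hτ⟩
    rwa [WithTop.coe_eq_coe.1 h]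
  · exact fun h => ⟨x, rfl, h⟩

theorem content_top : content ⊤ = ∅ := by
  ext τ
  simp [content]

theorem content_inf (a b : WithTop TokVal) : content (a ⊓ b) = content a ∪ content b := by
  induction a using WithTop.recTopCoe with
  | top => rw [top_inf_eq, content_top, Set.empty_union]
  | coe a =>
    induction b using WithTop.recTopCoe with
    | top => rw [inf_top_eq, content_top, Set.union_empty]
    | coe b =>
      rw [← WithTop.coe_inf, content_coe, content_coe, content_coe]
      rfl

/-- The token `τ` is in the word `w`, which has only tokens of the entry `(i, j)`. -/
def Live (m : ℕ → WithTop TokVal) (τ : ℕ × ℕ × ℕ) (i j w : ℕ) : Prop :=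
  τ ∈ content (m w) ∧ content (m w) ⊆ tokens i j

/-- Combining is union, so the words that form a word with tokens of one entry only have the same
property: purity passes backwards. The illegal token belongs to no entry, so a new live token can
only come from an evaluation on exact inputs. -/
theorem Live.of_exec {m : ℕ → WithTop TokVal} {a : Instr} {τ : ℕ × ℕ × ℕ} {i j w : ℕ}
    (h : Live (a.exec tokG m) τ i j w) :
    (∃ w₀, Live m τ i j w₀ ∧ (w₀ = w ∨ w₀ ∈ a.sources)) ∨
    (∃ x y, a = .cell τ.1 τ.2.1 τ.2.2 x y w ∧ m x = tokD τ.1 τ.2.1 ∧ m y = tokD τ.2.1 τ.2.2 ∧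
      τ.1 < τ.2.1) := by
  by_cases hw : w = a.target
  swap
  · have e : a.exec tokG m w = m w := by
      cases a <;> exact Function.update_of_ne hw _ _
    unfold Live at h
    rw [e] at h
    exact Or.inl ⟨w, h, Or.inl rfl⟩
  subst hw
  have hτ := h.2 h.1
  cases a with
  | cell i' k j' x y z =>
    have e : (Instr.cell i' k j' x y z).exec tokG m z = m z ⊓ WithTop.map₂ (tokG i' k j') (m x) (m y) :=
      Function.update_self _ _ _
    simp only [Live, Instr.target, e, content_inf] at h ⊢
    obtain ⟨h1, h2⟩ := h
    rw [Set.union_subset_iff] at h2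
    rcases h1 with h1 | ⟨v, hv, h1⟩
    · exact Or.inl ⟨z, ⟨h1, h2.1⟩, Or.inl rfl⟩
    · right
      obtain ⟨u, u', hu, hu', rfl⟩ : ∃ u u' : TokVal, m x = (u : WithTop TokVal) ∧
          m y = (u' : WithTop TokVal) ∧ tokG i' k j' u u' = v := by
        rcases eq_or_ne (m x) ⊤ with hx | hx
        · rw [hx, WithTop.map₂_top_left] at hv
          exact absurd hv WithTop.top_ne_coe
        rcases eq_or_ne (m y) ⊤ with hy | hy
        · rw [hy, WithTop.map₂_top_right] at hv
          exact absurd hv WithTop.top_ne_coe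
        obtain ⟨u, hx⟩ := WithTop.ne_top_iff_exists.1 hx
        obtain ⟨u', hy⟩ := WithTop.ne_top_iff_exists.1 hy
        rw [← hx, ← hy, WithTop.map₂_coe_coe] at hv
        exact ⟨u, u', hx.symm, hy.symm, WithTop.coe_eq_coe.1 hv⟩
      unfold tokG at h1
      split_ifs at h1 with hc
      · obtain ⟨c1, c2, rfl, rfl⟩ := hc
        obtain rfl : τ = (i', k, j') := h1
        exact ⟨x, y, rfl, hu, hu', c1⟩
      · obtain rfl : τ = (0, 0, 0) := h1
        obtain ⟨t1, t2, t3⟩ := hτ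
        simp only at t1 t2 t3
        omega
  | merge x z =>
    have e : (Instr.merge x z).exec tokG m z = m z ⊓ m x := Function.update_self _ _ _
    simp only [Live, Instr.target, e, content_inf] at h
    obtain ⟨h1, h2⟩ := h
    rw [Set.union_subset_iff] at h2
    left
    rcases h1 with h1 | h1
    · exact ⟨z, ⟨h1, h2.1⟩, Or.inl rfl⟩
    · exact ⟨x, ⟨h1, h2.2⟩, Or.inr (by simp [Instr.sources])⟩
  | copy x z =>
    have e : (Instr.copy x z).exec tokG m z = m x := Function.update_self _ _ _
    simp only [Live, Instr.target, e] at h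
    exact Or.inl ⟨x, h, Or.inr (by simp [Instr.sources])⟩

/-- Tracing back one instruction at a time, the token either never moved or starts from a word that
some instruction of `t` reads. -/
theorem Live.of_foldl {t : List Instr} {m : ℕ → WithTop TokVal} {τ : ℕ × ℕ × ℕ} {i j w : ℕ}
    (h : Live (t.foldl (Instr.exec tokG) m) τ i j w)
    (hl : ∀ a ∈ t, τ.1 < τ.2.1 → a.label ≠ some τ) :
    ∃ w₀, Live m τ i j w₀ ∧ (w₀ = w ∨ ∃ a ∈ t, w₀ ∈ a.sources) := by
  induction t generalizing m with
  | nil => exact ⟨w, h, Or.inl rfl⟩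
  | cons a t ih =>
    obtain ⟨w₁, h1, h2⟩ := ih h fun b hb => hl b (List.mem_cons_of_mem _ hb)
    rcases h1.of_exec with ⟨w₀, h3, h4⟩ | ⟨x, y, ha, -, -, hlt⟩
    · refine ⟨w₀, h3, ?_⟩
      rcases h4 with rfl | h4
      · exact h2.imp_right fun ⟨b, hb, h⟩ => ⟨b, List.mem_cons_of_mem _ hb, h⟩
      · exact Or.inr ⟨a, List.mem_cons_self, h4⟩
    · refine absurd ?_ (hl a List.mem_cons_self hlt)
      rw [ha]
      rfl

/-- The memory of token sets after executing `t`. -/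
noncomputable def tokMem (n : ℕ) (t : List Instr) : ℕ → WithTop TokVal :=
  t.foldl (Instr.exec tokG) (initMem n fun i => tokD i (i + 1))

theorem tokMem_append (n : ℕ) (t t' : List Instr) :
    tokMem n (t ++ t') = t'.foldl (Instr.exec tokG) (tokMem n t) := List.foldl_append

theorem not_live_init {n : ℕ} {τ : ℕ × ℕ × ℕ} {i j w : ℕ} (h : Live (tokMem n []) τ i j w) :
    ¬ τ.1 < τ.2.1 := by
  obtain ⟨⟨x, hx, hτ⟩, -⟩ := h
  simp only [tokMem, List.foldl_nil, initMem] at hx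
  split_ifs at hx
  · obtain rfl := WithTop.coe_eq_coe.1 hx
    obtain ⟨h1, h2, h3⟩ := hτ
    omega
  · exact absurd hx WithTop.top_ne_coe

theorem foldl_exec_of_ne {V : Type} [SemilatticeInf V] {g : ℕ → ℕ → ℕ → V → V → V}
    {t : List Instr} {m : ℕ → WithTop V} {w : ℕ} (h : ∀ a ∈ t, a.target ≠ w) :
    t.foldl (Instr.exec g) m w = m w := by
  induction t generalizing m with
  | nil => rfl
  | cons a t ih =>
    rw [List.foldl_cons, ih fun b hb => h b (List.mem_cons_of_mem _ hb)]
    have := (h a List.mem_cons_self).symm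
    cases a <;> exact Function.update_of_ne this _ _

theorem mem_tokens {i k j : ℕ} (hk : i < k) (hj : k < j) : (i, k, j) ∈ tokens i j :=
  ⟨rfl, rfl, Or.inr ⟨hk, hj⟩⟩

/-- This turns counting entries into counting words, whatever temporary storage the program uses. -/
theorem Live.unique {m : ℕ → WithTop TokVal} {τ τ' : ℕ × ℕ × ℕ} {i j i' j' w : ℕ}
    (h : Live m τ i j w) (h' : Live m τ' i' j' w) : i = i' ∧ j = j' := by
  obtain ⟨h1, h2, -⟩ := h.2 h.1
  obtain ⟨h3, h4, -⟩ := h'.2 h.1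
  exact ⟨h1.symm.trans h3, h2.symm.trans h4⟩

theorem live_of_eq {m : ℕ → WithTop TokVal} {τ : ℕ × ℕ × ℕ} {i j w : ℕ}
    (h : m w = tokD i j) (hτ : τ ∈ tokens i j) : Live m τ i j w := by
  have e : content (m w) = tokens i j := by rw [h, content_coe]; rfl
  unfold Live
  rw [e]
  exact ⟨hτ, subset_rfl⟩

theorem live_end {n : ℕ} {P : SP Instr} (hP : Computes n P) {i j : ℕ} {τ : ℕ × ℕ × ℕ}
    (hij : i < j) (hj : j ≤ n) (hτ : τ ∈ tokens i j) :
    Live (tokMem n P.ops) τ i j (addr n i j) :=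
  live_of_eq (hP.2 TokVal tokG _ _ (tok_solution n) i j hij hj) hτ

/-- An evaluated cell is evaluated neither before nor after, and its token is then alive. -/
theorem live_after {n : ℕ} {P : SP Instr} (hP : Computes n P) {pre seg post : List Instr}
    (h : P.ops = pre ++ (seg ++ post)) {i k j : ℕ} (hk : i < k) (hkj : k < j) (hj : j ≤ n)
    {a : Instr} (ha : a ∈ seg) (hal : a.label = some (i, k, j)) :
    (∀ b ∈ pre, b.label ≠ some (i, k, j)) ∧
    ∃ w, Live (tokMem n (pre ++ seg)) (i, k, j) i j w := by
  have hc := hP.1 i k j hk hkj hj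
  rw [h, List.filterMap_append, List.filterMap_append, List.count_append, List.count_append] at hc
  have h1 : 0 < (seg.filterMap Instr.label).count (i, k, j) :=
    List.count_pos_iff.2 (List.mem_filterMap.2 ⟨a, ha, hal⟩)
  refine ⟨fun b hb hbl => ?_, ?_⟩
  · have : 0 < (pre.filterMap Instr.label).count (i, k, j) :=
      List.count_pos_iff.2 (List.mem_filterMap.2 ⟨b, hb, hbl⟩)
    omega
  · have hl := live_end hP (hk.trans hkj) hj (mem_tokens hk hkj)
    rw [h, ← List.append_assoc, tokMem_append] at hl
    obtain ⟨w, hw, -⟩ := hl.of_foldl fun b hb _ hbl => by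
      have : 0 < (post.filterMap Instr.label).count (i, k, j) :=
        List.count_pos_iff.2 (List.mem_filterMap.2 ⟨b, hb, hbl⟩)
      omega
    exact ⟨w, hw⟩

/-- Before its evaluation the token of the cell is alive nowhere, as it is absent from the initial
memory. So this instruction creates it, which requires exact inputs. -/
theorem cell_inputs {n : ℕ} {P : SP Instr} (hP : Computes n P) {t₁ t₂ : List Instr}
    {a : Instr} (h : P.ops = t₁ ++ a :: t₂) {i k j : ℕ} (hk : i < k) (hkj : k < j) (hj : j ≤ n)
    (hal : a.label = some (i, k, j)) :
    ∃ x ∈ a.sources, ∃ y ∈ a.sources,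
      tokMem n t₁ x = tokD i k ∧ tokMem n t₁ y = tokD k j := by
  obtain ⟨h1, w, hw⟩ := live_after hP (pre := t₁) (seg := [a]) (post := t₂) h hk hkj hj
    List.mem_cons_self hal
  rw [tokMem_append] at hw
  rcases Live.of_exec hw with ⟨w₀, h2, -⟩ | ⟨x, y, rfl, hx, hy, -⟩
  · exfalso
    rw [← List.nil_append t₁, tokMem_append] at h2
    obtain ⟨w₁, h3, -⟩ := h2.of_foldl fun b hb _ => h1 b hb
    exact not_live_init h3 hk
  · exact ⟨x, by simp [Instr.sources], y, by simp [Instr.sources], hx, hy⟩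

/-- The words of the lines in `F`. -/
def words (B : ℕ) (F : Finset ℕ) : Finset ℕ := F.biUnion fun l => Finset.Ico (l * B) (l * B + B)

theorem card_words_le (B : ℕ) (F : Finset ℕ) : (words B F).card ≤ F.card * B :=
  Finset.card_biUnion_le_card_mul _ _ _ fun l _ => by simp

theorem mem_words {B : ℕ} {F : Finset ℕ} (hB : 0 < B) {w : ℕ} (h : w / B ∈ F) : w ∈ words B F := by
  refine Finset.mem_biUnion.2 ⟨w / B, h, Finset.mem_Ico.2 ⟨Nat.div_mul_le_self w B, ?_⟩⟩
  have := Nat.lt_mul_div_succ w hB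
  rw [mul_comm, Nat.succ_mul] at this
  exact this

theorem card_le_of_live {m : ℕ → WithTop TokVal} {B : ℕ} (hB : 0 < B) {F : Finset ℕ}
    {S : Finset (ℕ × ℕ)} (h : ∀ p ∈ S, ∃ τ w, Live m τ p.1 p.2 w ∧ w / B ∈ F) :
    S.card ≤ F.card * B := by
  choose! τ w hw using h
  refine (Finset.card_le_card_of_injOn w (fun p hp => mem_words hB (hw p hp).2) ?_).trans
    (card_words_le B F)
  intro p hp q hq hpq
  have := (hw p hp).1
  rw [hpq] at this
  exact Prod.ext_iff.2 (this.unique (hw q hq).1)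

/-! ### Cells evaluated in a segment of the execution. -/

section Segment

variable {n B : ℕ} {P : SP Instr} {pre seg post : List Instr} {F G : Finset ℕ}

/-- The cells evaluated in `t`. -/
def labels (n : ℕ) (t : List Instr) : Finset (ℕ × ℕ × ℕ) :=
  (t.filterMap Instr.label).toFinset.filter fun e => e.1 < e.2.1 ∧ e.2.1 < e.2.2 ∧ e.2.2 ≤ n

theorem mem_labels {t : List Instr} {e : ℕ × ℕ × ℕ} :
    e ∈ labels n t ↔ (∃ a ∈ t, a.label = some e) ∧ e.1 < e.2.1 ∧ e.2.1 < e.2.2 ∧ e.2.2 ≤ n := by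
  simp [labels]

/-- After the segment, the token of a cell evaluated in it is alive in some word. If no instruction
of the segment wrote to the line of that word, the token would have been there before its creation.
-/
theorem card_outputs_le (hP : Computes n P) (hB : 0 < B) (h : P.ops = pre ++ (seg ++ post))
    (hF : ∀ x ∈ seg, x.target / B ∈ F) :
    ((labels n seg).image fun e => (e.1, e.2.2)).card ≤ F.card * B := by
  refine card_le_of_live (m := tokMem n (pre ++ seg)) hB fun p hp => ?_
  obtain ⟨⟨i, k, j⟩, he, rfl⟩ := Finset.mem_image.1 hp
  obtain ⟨⟨a, ha, hal⟩, hk, hkj, hj⟩ := mem_labels.1 he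
  obtain ⟨h1, w, hw⟩ := live_after hP h hk hkj hj ha hal
  refine ⟨_, w, hw, ?_⟩
  by_contra hwF
  have e : tokMem n (pre ++ seg) w = tokMem n pre w := by
    rw [tokMem_append]
    exact foldl_exec_of_ne fun a ha haw => hwF (haw ▸ hF a ha)
  have h2 : Live (tokMem n pre) (i, k, j) i j w := by
    unfold Live at hw ⊢
    rwa [e] at hw
  rw [← List.nil_append pre, tokMem_append] at h2
  obtain ⟨w₁, h3, -⟩ := h2.of_foldl fun b hb _ => h1 b hb
  exact not_live_init h3 hk

/-- An entry used as operand is either itself worked on in the segment, and counted by the outputs,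
or some token of it was alive before the segment in a word that the segment reads. -/
theorem card_inputs_le (hP : Computes n P) (hB : 0 < B) (h : P.ops = pre ++ (seg ++ post))
    (hF : ∀ x ∈ seg, x.target / B ∈ F) (hG : ∀ x ∈ seg, ∀ y ∈ x.sources, y / B ∈ G)
    {S : Finset (ℕ × ℕ)}
    (hS : ∀ p ∈ S, p.1 < p.2 ∧ ∃ t₁ a t₂ x, seg = t₁ ++ a :: t₂ ∧ x ∈ a.sources ∧
      tokMem n (pre ++ t₁) x = tokD p.1 p.2 ∧ p.2 ≤ n) :
    S.card ≤ F.card * B + G.card * B := by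
  have h1 := card_outputs_le hP hB h hF
  set T := (labels n seg).image fun e => (e.1, e.2.2) with hT
  have h2 : (S \ T).card ≤ G.card * B := by
    refine card_le_of_live (m := tokMem n pre) hB fun p hp => ?_
    obtain ⟨hpS, hpT⟩ := Finset.mem_sdiff.1 hp
    obtain ⟨hlt, t₁, a, t₂, x, hseg, hx, hmx, hn⟩ := hS p hpS
    have hsub : ∀ b ∈ t₁, b ∈ seg := fun b hb => hseg ▸ List.mem_append_left _ hb
    -- A token not created in the segment: the initial one for adjacent indices, otherwise that of
    -- any cell of the entry, since no cell of an entry outside `T` is evaluated here.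
    have key : ∃ τ ∈ tokens p.1 p.2, ∀ b ∈ t₁, τ.1 < τ.2.1 → b.label ≠ some τ := by
      by_cases hp1 : p.2 = p.1 + 1
      · exact ⟨(p.1, p.1, p.2), ⟨rfl, rfl, Or.inl ⟨hp1, rfl⟩⟩, fun b _ hlt => absurd hlt (lt_irrefl _)⟩
      · refine ⟨(p.1, p.1 + 1, p.2), mem_tokens (by omega) (by omega), fun b hb _ hbl => hpT ?_⟩
        refine Finset.mem_image.2 ⟨(p.1, p.1 + 1, p.2), mem_labels.2 ⟨⟨b, hsub b hb, hbl⟩, ?_⟩, rfl⟩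
        simp only
        omega
    obtain ⟨τ, hτ, hb⟩ := key
    have hl := live_of_eq hmx hτ
    rw [tokMem_append] at hl
    obtain ⟨w, hw, h3⟩ := hl.of_foldl hb
    refine ⟨τ, w, hw, ?_⟩
    rcases h3 with rfl | ⟨b, hb, hwb⟩
    · exact hG a (by simp [hseg]) _ hx
    · exact hG b (hsub b hb) _ hwb
  have h3 := Finset.card_le_card_sdiff_add_card (s := S) (t := T)
  omega

theorem card_labels_sq_le (hP : Computes n P) (hB : 0 < B) (h : P.ops = pre ++ (seg ++ post))
    (hF : ∀ x ∈ seg, x.target / B ∈ F) (hG : ∀ x ∈ seg, ∀ y ∈ x.sources, y / B ∈ G) :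
    (labels n seg).card ^ 2 ≤ F.card * B * (F.card * B + G.card * B) ^ 2 := by
  have key : ∀ e ∈ labels n seg, ∃ t₁ a t₂, seg = t₁ ++ a :: t₂ ∧ ∃ x ∈ a.sources, ∃ y ∈ a.sources,
      tokMem n (pre ++ t₁) x = tokD e.1 e.2.1 ∧ tokMem n (pre ++ t₁) y = tokD e.2.1 e.2.2 := by
    rintro ⟨i, k, j⟩ he
    obtain ⟨⟨a, ha, hal⟩, hk, hkj, hj⟩ := mem_labels.1 he
    obtain ⟨t₁, t₂, rfl⟩ := List.append_of_mem ha
    exact ⟨t₁, a, t₂, rfl, cell_inputs hP (t₁ := pre ++ t₁) (t₂ := t₂ ++ post)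
      (by simpa using h) hk hkj hj hal⟩
  have h1 := card_outputs_le hP hB h hF
  have h2 : ((labels n seg).image fun e => (e.1, e.2.1)).card ≤ F.card * B + G.card * B := by
    refine card_inputs_le hP hB h hF hG fun p hp => ?_
    obtain ⟨e, he, rfl⟩ := Finset.mem_image.1 hp
    obtain ⟨t₁, a, t₂, hs, x, hx, y, hy, h3, h4⟩ := key e he
    have := (mem_labels.1 he).2
    exact ⟨this.1, t₁, a, t₂, x, hs, hx, h3, by simp only; omega⟩
  have h3 : ((labels n seg).image fun e => (e.2.1, e.2.2)).card ≤ F.card * B + G.card * B := by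
    refine card_inputs_le hP hB h hF hG fun p hp => ?_
    obtain ⟨e, he, rfl⟩ := Finset.mem_image.1 hp
    obtain ⟨t₁, a, t₂, hs, x, hx, y, hy, h3, h4⟩ := key e he
    have := (mem_labels.1 he).2
    exact ⟨this.2.1, t₁, a, t₂, y, hs, hy, h4, this.2.2⟩
  refine (loomis_whitney _).trans (Nat.mul_le_mul h1 ?_)
  rw [sq]
  exact Nat.mul_le_mul h2 h3

/-- An instruction evaluates at most one cell, so the count takes every intermediate value. -/
theorem exists_prefix_labels {t : List Instr} {v : ℕ} (h : v ≤ (labels n t).card) :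
    ∃ s r, t = s ++ r ∧ (labels n s).card = v := by
  induction t using List.reverseRecOn with
  | nil => exact ⟨[], [], rfl, by simpa [labels, eq_comm] using h⟩
  | append_singleton t a ih =>
    rcases h.eq_or_lt with h | h
    · exact ⟨t ++ [a], [], by simp, h.symm⟩
    · have : (labels n (t ++ [a])).card ≤ (labels n t).card + 1 := by
        have hsub : labels n (t ++ [a]) ⊆ labels n t ∪ (a.label.toFinset) := by
          intro e he
          obtain ⟨⟨b, hb, hbl⟩, h2⟩ := mem_labels.1 he
          rcases List.mem_append.1 hb with hb | hb
          · exact Finset.mem_union_left _ (mem_labels.2 ⟨⟨b, hb, hbl⟩, h2⟩)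
          · obtain rfl := List.mem_singleton.1 hb
            exact Finset.mem_union_right _ (by simp [hbl])
        refine (Finset.card_le_card hsub).trans ((Finset.card_union_le _ _).trans ?_)
        have : a.label.toFinset.card ≤ 1 := by cases a.label <;> simp
        omega
      obtain ⟨s, r, rfl, hs⟩ := ih (by omega)
      exact ⟨s, r ++ [a], by simp, hs⟩

theorem card_labels_append_le (s r : List Instr) :
    (labels n (s ++ r)).card ≤ (labels n s).card + (labels n r).card := by
  have hsub : labels n (s ++ r) ⊆ labels n s ∪ labels n r := by
    intro e he
    obtain ⟨⟨b, hb, hbl⟩, h2⟩ := mem_labels.1 he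
    rcases List.mem_append.1 hb with hb | hb
    · exact Finset.mem_union_left _ (mem_labels.2 ⟨⟨b, hb, hbl⟩, h2⟩)
    · exact Finset.mem_union_right _ (mem_labels.2 ⟨⟨b, hb, hbl⟩, h2⟩)
  exact (Finset.card_le_card hsub).trans (Finset.card_union_le _ _)

/-- Writes in a small cache and reads in a large one cannot both be few. -/
theorem labels_le_of_cacheRun {M₁ M₂ v : ℕ} (hP : Computes n P) (hB : 0 < B) (hM₁ : 0 < M₁)
    (hM : M₁ ≤ M₂) (hv : 32 * M₁ * M₂ ^ 2 < v ^ 2) :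
    ∀ (N : ℕ) (pre t : List Instr) (res₁ dirty₁ res₂ dirty₂ : Finset ℕ) (R₁ W₁ R₂ W₂ : ℕ),
      P.ops = pre ++ t → dirty₁ ⊆ res₁ → res₁.card * B ≤ M₁ → dirty₂ ⊆ res₂ → res₂.card * B ≤ M₂ →
      CacheRun M₁ B res₁ dirty₁ t R₁ W₁ → CacheRun M₂ B res₂ dirty₂ t R₂ W₂ →
      N * v ≤ (labels n t).card → (N : ℝ) ≤ (B : ℝ) * W₁ / M₁ + (B : ℝ) * R₂ / M₂ := by
  intro N
  have hM₁' : (0 : ℝ) < M₁ := by exact_mod_cast hM₁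
  have hM₂' : (0 : ℝ) < M₂ := by exact_mod_cast hM₁.trans_le hM
  induction N with
  | zero =>
    intros
    rw [Nat.cast_zero]
    positivity
  | succ N ih =>
    intro pre t res₁ dirty₁ res₂ dirty₂ R₁ W₁ R₂ W₂ ht hd₁ hr₁ hd₂ hr₂ run₁ run₂ hN
    rw [Nat.add_mul, one_mul] at hN
    obtain ⟨seg, post, rfl, hseg⟩ := exists_prefix_labels (n := n) (t := t) (v := v) (by omega)
    have happ := card_labels_append_le (n := n) seg post
    obtain ⟨res₁', dirty₁', Ra, Wa, Rb, Wb, F, -, ⟨hd₁', hr₁'⟩, run₁', -, hW, ⟨hF, -, hFt⟩, -⟩ :=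
      cacheRun_split run₁ seg post rfl hd₁ hr₁
    obtain ⟨res₂', dirty₂', Rc, Wc, Rd, Wd, -, G, ⟨hd₂', hr₂'⟩, run₂', hR, -, -, hG, -, hGt⟩ :=
      cacheRun_split run₂ seg post rfl hd₂ hr₂
    have hrest := ih (pre ++ seg) post res₁' dirty₁' res₂' dirty₂' Rb Wb Rd Wd (by simpa using ht)
      hd₁' hr₁' hd₂' hr₂' run₁' run₂' (by omega)
    have hcard := card_labels_sq_le hP hB ht hFt hGt
    rw [hseg] at hcard
    -- Otherwise the segment writes to at most `2 * M₁` words and reads from at most `2 * M₂`, so it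
    -- has at most `√(2 * M₁ * (4 * M₂) ^ 2)` cells. This is the origin of the `32` in `hv`.
    have hgain : M₁ < B * Wa ∨ M₂ < B * Rc := by
      by_contra! hcon
      obtain ⟨hc1, hc2⟩ := hcon
      have h1 : F.card * B ≤ 2 * M₁ := by
        have := Finset.card_le_card hd₁'
        nlinarith
      have h2 : G.card * B ≤ 2 * M₂ := by nlinarith
      have h3 : F.card * B * (F.card * B + G.card * B) ^ 2 ≤ 2 * M₁ * (4 * M₂) ^ 2 :=
        Nat.mul_le_mul h1 (Nat.pow_le_pow_left (by omega) 2)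
      have h4 : 2 * M₁ * (4 * M₂) ^ 2 = 32 * M₁ * M₂ ^ 2 := by ring
      omega
    have e1 : (W₁ : ℝ) = Wa + Wb := by exact_mod_cast hW.symm
    have e2 : (R₂ : ℝ) = Rc + Rd := by exact_mod_cast hR.symm
    have h5 : (1 : ℝ) ≤ (B : ℝ) * Wa / M₁ + (B : ℝ) * Rc / M₂ := by
      rcases hgain with h | h
      · have : (1 : ℝ) ≤ (B : ℝ) * Wa / M₁ := (one_le_div hM₁').2 (by exact_mod_cast h.le)
        have : (0 : ℝ) ≤ (B : ℝ) * Rc / M₂ := by positivity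
        linarith
      · have : (1 : ℝ) ≤ (B : ℝ) * Rc / M₂ := (one_le_div hM₂').2 (by exact_mod_cast h.le)
        have : (0 : ℝ) ≤ (B : ℝ) * Wa / M₁ := by positivity
        linarith
    have e3 : (B : ℝ) * W₁ / M₁ + (B : ℝ) * R₂ / M₂ =
        ((B : ℝ) * Wa / M₁ + (B : ℝ) * Rc / M₂) + ((B : ℝ) * Wb / M₁ + (B : ℝ) * Rd / M₂) := by
      rw [e1, e2]
      ring
    push_cast
    linarith

end Segment

/-! ### Number of cells, work, and unavoidable writes. -/

theorem cube_le_card_labels {n m : ℕ} {P : SP Instr} (hP : Computes n P)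
    (hm : 3 * m ≤ n + 1) : m ^ 3 ≤ (labels n P.ops).card := by
  have hsub : Finset.Ico 0 m ×ˢ Finset.Ico m (2 * m) ×ˢ Finset.Ico (2 * m) (3 * m) ⊆
      labels n P.ops := by
    rintro ⟨i, k, j⟩ he
    simp only [Finset.mem_product, Finset.mem_Ico] at he
    have hlt : i < k ∧ k < j ∧ j ≤ n := by omega
    refine mem_labels.2 ⟨?_, hlt⟩
    have hc := hP.1 i k j hlt.1 hlt.2.1 hlt.2.2
    exact List.mem_filterMap.1 (List.count_pos_iff.1 (by omega))
  have := Finset.card_le_card hsub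
  simp only [Finset.card_product, Nat.card_Ico] at this
  have e : m ^ 3 = (m - 0) * ((2 * m - m) * (3 * m - 2 * m)) := by
    rw [Nat.sub_zero, show 2 * m - m = m by omega, show 3 * m - 2 * m = m by omega]
    ring
  omega

theorem length_ops_le {α : Type} (p : SP α) : p.ops.length ≤ p.work := by
  induction p with
  | done => simp [SP.ops]
  | op a => simp [SP.ops, SP.work]
  | seq p q hp hq => simp only [SP.ops, SP.work, List.length_append]; omega
  | par p q hp hq => simp only [SP.ops, SP.work, List.length_append]; omega

theorem cube_le_work {n m : ℕ} {P : SP Instr} (hP : Computes n P)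
    (hm : 3 * m ≤ n + 1) : m ^ 3 ≤ P.work := by
  refine (cube_le_card_labels hP hm).trans (le_trans ?_ (length_ops_le P))
  refine (Finset.card_filter_le _ _).trans ((List.toFinset_card_le _).trans ?_)
  exact List.length_filterMap_le _ _

/-- All results are written. -/
theorem le_writes {n M B R W : ℕ} {P : SP Instr} (hP : Computes n P) (hB : 0 < B)
    (hn : 2 ≤ n) (h : CacheRun M B ∅ ∅ P.ops R W) : n ^ 2 ≤ 16 * (W * B) := by
  obtain ⟨F, hF, -, hFt⟩ := cacheRun_targets h
  set m := (n + 1) / 2 with hm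
  -- For `i < m < j` the indices are not adjacent, so the result is not part of the input and its
  -- line must be written.
  have hsub : ((Finset.Ico 0 m ×ˢ Finset.Ico (m + 1) (n + 1)).image fun p => addr n p.1 p.2) ⊆
      words B F := by
    intro w hw
    obtain ⟨⟨i, j⟩, hp, rfl⟩ := Finset.mem_image.1 hw
    simp only [Finset.mem_product, Finset.mem_Ico] at hp
    by_contra hwF
    have hl := live_end hP (i := i) (j := j) (by omega) (by omega)
      (mem_tokens (k := i + 1) (by omega) (by omega))
    have e : tokMem n P.ops (addr n i j) = tokMem n [] (addr n i j) :=
      foldl_exec_of_ne fun a ha haw => hwF (mem_words hB (haw ▸ hFt a ha))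
    have hl' : Live (tokMem n []) (i, i + 1, j) i j (addr n i j) := by
      unfold Live at hl ⊢
      rwa [e] at hl
    exact not_live_init hl' (Nat.lt_succ_self i)
  have h1 := Finset.card_le_card hsub
  rw [Finset.card_image_of_injOn, Finset.card_product, Nat.card_Ico, Nat.card_Ico] at h1
  · have h2 := h1.trans ((card_words_le B F).trans (Nat.mul_le_mul_right B hF))
    have h3 : n ≤ 2 * (m - 0) := by omega
    have h4 : n ≤ 4 * (n + 1 - (m + 1)) := by omega
    nlinarith [Nat.mul_le_mul h3 h4]
  · rintro ⟨i, j⟩ hp ⟨i', j'⟩ hp' h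
    simp only [Finset.coe_product, Set.mem_prod, Finset.coe_Ico, Set.mem_Ico] at hp hp' h
    exact Prod.ext_iff.2 (addr_inj (by omega) (by omega) h)

/-! ## The cost bounds -/

theorem ofReal_runCost {ω : ℝ} (hω : 0 ≤ ω) (R W : ℕ) :
    ENNReal.ofReal (R + ω * W) = (R : ℝ≥0∞) + ENNReal.ofReal ω * (W : ℝ≥0∞) := by
  rw [ENNReal.ofReal_add (by positivity) (by positivity), ENNReal.ofReal_mul hω,
    ENNReal.ofReal_natCast, ENNReal.ofReal_natCast]

theorem le_asymCacheCost {ω X : ℝ} (hω : 0 ≤ ω) {M B : ℕ} {P : SP Instr}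
    (h : ∀ R W : ℕ, CacheRun M B ∅ ∅ P.ops R W → X ≤ R + ω * W) :
    ENNReal.ofReal X ≤ asymCacheCost ω M B P := by
  refine le_iInf fun R => le_iInf fun W => le_iInf fun hr => ?_
  rw [← ofReal_runCost hω]
  exact ENNReal.ofReal_le_ofReal (h R W hr)

theorem asymCacheCost_le {ω X : ℝ} (hω : 0 ≤ ω) {M B R W : ℕ} {P : SP Instr}
    (h : CacheRun M B ∅ ∅ P.ops R W) (hX : R + ω * W ≤ X) :
    asymCacheCost ω M B P ≤ ENNReal.ofReal X := by
  refine (iInf_le_of_le R (iInf_le_of_le W (iInf_le_of_le h le_rfl))).trans ?_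
  rw [← ofReal_runCost hω]
  exact ENNReal.ofReal_le_ofReal hX

theorem exists_run_of_asymCacheCost_lt {ω X : ℝ} (hω : 0 ≤ ω) {M B : ℕ} {P : SP Instr}
    (h : asymCacheCost ω M B P < ENNReal.ofReal X) :
    ∃ R W : ℕ, CacheRun M B ∅ ∅ P.ops R W ∧ R + ω * W < X := by
  by_contra! hcon
  exact (le_asymCacheCost hω hcon).not_gt h

theorem symCacheCost_eq (M B : ℕ) (P : SP Instr) : symCacheCost M B P = asymCacheCost 1 M B P := by
  simp [symCacheCost, asymCacheCost]

/-- The execution is cut into segments of `v` cells; the summand `1` accounts for the incomplete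
last one. The value of `v` satisfies `32 * M₁ * M₂ ^ 2 < v ^ 2` because `√M₁` is below the integer
square root plus one. -/
theorem cube_le_of_cacheRun {n M₁ M₂ B R₁ W₁ R₂ W₂ : ℕ} {P : SP Instr} (hP : Computes n P)
    (hn : 2 ≤ n) (hB : 0 < B) (hM₁ : 0 < M₁) (hM : M₁ ≤ M₂)
    (run₁ : CacheRun M₁ B ∅ ∅ P.ops R₁ W₁) (run₂ : CacheRun M₂ B ∅ ∅ P.ops R₂ W₂) :
    (n : ℝ) ^ 3 ≤ 768 * (M₂ * √(M₁ : ℝ) * ((B : ℝ) * W₁ / M₁ + (B : ℝ) * R₂ / M₂ + 1)) := by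
  set v := 6 * M₂ * (Nat.sqrt M₁ + 1) with hv
  set m := (n + 1) / 3 with hm
  have hM₂ : 0 < M₂ := hM₁.trans_le hM
  have hv' : 32 * M₁ * M₂ ^ 2 < v ^ 2 := by
    have h1 := Nat.lt_succ_sqrt M₁
    have h2 : 0 < M₂ ^ 2 := by positivity
    have h3 : v ^ 2 = 36 * ((Nat.sqrt M₁ + 1) * (Nat.sqrt M₁ + 1)) * M₂ ^ 2 := by rw [hv]; ring
    rw [h3]
    exact Nat.mul_lt_mul_of_pos_right (by simp only [Nat.succ_eq_add_one] at h1; omega) h2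
  have hvpos : 0 < v := by positivity
  have h1 := labels_le_of_cacheRun hP hB hM₁ hM hv' (m ^ 3 / v) [] P.ops ∅ ∅ ∅ ∅ R₁ W₁ R₂ W₂ rfl
    subset_rfl (by simp) subset_rfl (by simp) run₁ run₂
    ((Nat.div_mul_le_self _ _).trans (cube_le_card_labels hP (by omega)))
  have h2 : (m : ℝ) ^ 3 ≤ v * ((m ^ 3 / v : ℕ) + 1 : ℝ) := by
    have := (Nat.lt_mul_div_succ (m ^ 3) hvpos).le
    exact_mod_cast this
  have h3 : (n : ℝ) ≤ 4 * m := by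
    have : n ≤ 4 * m := by omega
    exact_mod_cast this
  have h4 : (v : ℝ) ≤ 12 * (M₂ * √(M₁ : ℝ)) := by
    have e1 : (1 : ℝ) ≤ √(M₁ : ℝ) := Real.one_le_sqrt.2 (by exact_mod_cast hM₁)
    have e2 : (Nat.sqrt M₁ : ℝ) ≤ √(M₁ : ℝ) := Real.nat_sqrt_le_real_sqrt
    rw [hv]
    push_cast
    have e3 : (0 : ℝ) ≤ M₂ := Nat.cast_nonneg _
    nlinarith [mul_le_mul_of_nonneg_left (add_le_add e2 e1) e3]
  set Z : ℝ := (B : ℝ) * W₁ / M₁ + (B : ℝ) * R₂ / M₂ with hZ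
  have hZ0 : 0 ≤ Z := by positivity
  calc (n : ℝ) ^ 3 ≤ (4 * m) ^ 3 := pow_le_pow_left₀ (by positivity) h3 3
    _ = 64 * (m : ℝ) ^ 3 := by ring
    _ ≤ 64 * (v * ((m ^ 3 / v : ℕ) + 1 : ℝ)) := by gcongr
    _ ≤ 64 * (12 * (M₂ * √(M₁ : ℝ)) * (Z + 1)) := by gcongr
    _ = _ := by ring

section Bounds

variable {ω σ : ℝ}

/-- No program is good both for a cache of `M` words and for one of `σ² M` words. -/
theorem exists_cacheSize_le (hσ : 1 ≤ σ) (hω : ω = σ ^ 3) {n : ℕ} (hn : 2 ≤ n) {P : SP Instr}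
    (hP : Computes n P) {M B : ℕ} (hM : 0 < M) (hB : 0 < B) :
    ∃ M' : ℕ, M ≤ M' ∧ M' ≤ ⌈σ ^ 2 * (M : ℝ)⌉₊ ∧
      ENNReal.ofReal (1 / 5000 * (σ * (n : ℝ) ^ 3 / ((B : ℝ) * √(M' : ℝ))))
        ≤ asymCacheCost ω M' B P := by
  by_contra! hcon
  have hσ0 : 0 < σ := by linarith
  have hω0 : 0 ≤ ω := by rw [hω]; positivity
  have hMr : (1 : ℝ) ≤ M := by exact_mod_cast hM
  have hBr : (0 : ℝ) < B := by exact_mod_cast hB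
  have hnr : (0 : ℝ) < n := by exact_mod_cast (by omega : 0 < n)
  have hσ2 : 1 ≤ σ ^ 2 := one_le_pow₀ hσ
  set M₂ := ⌈σ ^ 2 * (M : ℝ)⌉₊ with hM₂
  have hle : σ ^ 2 * (M : ℝ) ≤ M₂ := Nat.le_ceil _
  have hMM : M ≤ M₂ := by
    have : (M : ℝ) ≤ M₂ := (le_mul_of_one_le_left (by linarith) hσ2).trans hle
    exact_mod_cast this
  have hM₂le : (M₂ : ℝ) ≤ 2 * σ ^ 2 * M := by
    have := (Nat.ceil_lt_add_one (show 0 ≤ σ ^ 2 * (M : ℝ) by positivity)).le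
    nlinarith
  clear_value M₂
  -- Only the writes of the run at `M` and the reads of the run at `M₂` will be used.
  obtain ⟨R₁, W₁, run₁, h1⟩ := exists_run_of_asymCacheCost_lt hω0 (hcon M le_rfl hMM)
  obtain ⟨R₂, W₂, run₂, h2⟩ := exists_run_of_asymCacheCost_lt hω0 (hcon M₂ hMM le_rfl)
  set q := √(M : ℝ) with hq
  have hq1 : 1 ≤ q := Real.one_le_sqrt.2 hMr
  have hqq : q ^ 2 = M := Real.sq_sqrt (by linarith)
  have hq0 : 0 < q := by linarith
  clear_value q
  have hM₂0 : (0 : ℝ) < M₂ := by exact_mod_cast hM.trans_le hMM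
  have hq2 : σ * q ≤ √(M₂ : ℝ) := by
    refine Real.le_sqrt_of_sq_le ?_
    rw [mul_pow, hqq]
    exact hle
  have hW : (B : ℝ) * W₁ * (σ ^ 2 * q) ≤ 1 / 5000 * (n : ℝ) ^ 3 := by
    have h3 : ω * W₁ ≤ 1 / 5000 * (σ * (n : ℝ) ^ 3 / (B * q)) := by
      have : (0 : ℝ) ≤ R₁ := Nat.cast_nonneg _
      linarith
    rw [← mul_div_assoc, le_div_iff₀ (by positivity), hω] at h3
    refine le_of_mul_le_mul_left ?_ hσ0
    linarith
  have hR : (B : ℝ) * R₂ * q ≤ 1 / 5000 * (n : ℝ) ^ 3 := by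
    have h3 : (R₂ : ℝ) ≤ 1 / 5000 * (σ * (n : ℝ) ^ 3 / (B * √(M₂ : ℝ))) := by
      have : (0 : ℝ) ≤ ω * W₂ := by positivity
      linarith
    have h4 : σ * (n : ℝ) ^ 3 / (B * √(M₂ : ℝ)) ≤ σ * (n : ℝ) ^ 3 / (B * (σ * q)) := by gcongr
    have h5 : σ * (n : ℝ) ^ 3 / (B * (σ * q)) = (n : ℝ) ^ 3 / (B * q) := by field_simp
    have h6 : (R₂ : ℝ) ≤ 1 / 5000 * ((n : ℝ) ^ 3 / (B * q)) := by linarith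
    rw [← mul_div_assoc, le_div_iff₀ (by positivity)] at h6
    linarith
  have h3 := cube_le_of_cacheRun hP hn hB hM hMM run₁ run₂
  rw [← hq] at h3
  have h4 : M₂ * q * ((B : ℝ) * W₁ / M + (B : ℝ) * R₂ / M₂ + 1) =
      M₂ / M * ((B : ℝ) * W₁ * q) + (B : ℝ) * R₂ * q + M₂ * q := by
    field_simp
  have h5 : M₂ / M * ((B : ℝ) * W₁ * q) ≤ 2 * (1 / 5000 * (n : ℝ) ^ 3) := by
    calc M₂ / M * ((B : ℝ) * W₁ * q) ≤ 2 * σ ^ 2 * ((B : ℝ) * W₁ * q) := by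
          gcongr
          exact (div_le_iff₀ (by linarith)).2 hM₂le
      _ = 2 * ((B : ℝ) * W₁ * (σ ^ 2 * q)) := by ring
      _ ≤ _ := by gcongr
  have h6 : M₂ * q ≤ 2 * (σ ^ 2 * q) * q ^ 2 := by
    calc M₂ * q ≤ 2 * σ ^ 2 * M * q := by gcongr
      _ = _ := by rw [hqq]; ring
  -- The incomplete segment costs `M₂ * q`, which is at most `2 * σ ^ 2 * q ^ 3`. Writing all
  -- results takes order `n ^ 2` words; compared with the assumed bound on the writes this forces `σ
  -- ^ 2 * q ≤ n / 300`, so the term is negligible.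
  have hwr : (n : ℝ) ^ 2 ≤ 16 * ((W₁ : ℝ) * B) := by
    exact_mod_cast le_writes hP hB hn run₁
  have h7 : σ ^ 2 * q ≤ n / 300 := by
    have : (n : ℝ) ^ 2 * (σ ^ 2 * q) ≤ (n : ℝ) ^ 2 * (n / 300) := by
      have := mul_le_mul_of_nonneg_right hwr (show 0 ≤ σ ^ 2 * q by positivity)
      linarith [pow_pos hnr 3]
    exact le_of_mul_le_mul_left this (by positivity)
  have h8 : q ≤ n / 300 := (le_mul_of_one_le_left hq0.le hσ2).trans h7
  have h9 : 2 * (σ ^ 2 * q) * q ^ 2 ≤ 2 * (n / 300) * (n / 300) ^ 2 := by gcongr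
  have h10 : 2 * ((n : ℝ) / 300) * (n / 300) ^ 2 = 2 / 27000000 * (n : ℝ) ^ 3 := by ring
  rw [h4] at h3
  linarith [pow_pos hnr 3]

theorem le_symCacheCost {n : ℕ} (hn : 2 ≤ n) {P : SP Instr}
    (hP : Computes n P) {M B : ℕ} (hM : 0 < M) (hB : 0 < B) :
    ENNReal.ofReal (1 / 5000 * ((n : ℝ) ^ 3 / ((B : ℝ) * √(M : ℝ)))) ≤ symCacheCost M B P := by
  obtain ⟨M', h1, h2, h3⟩ := exists_cacheSize_le le_rfl (by norm_num) hn hP hM hB (ω := 1)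
  rw [one_pow, one_mul, Nat.ceil_natCast] at h2
  obtain rfl := le_antisymm h1 h2
  rw [symCacheCost_eq]
  simpa using h3

variable {n M B : ℕ}

theorem asymCacheCost_triProg_le (hσ : 1 ≤ σ) (hω : ω = σ ^ 3) (hn : 2 ≤ n) (hB : 0 < B)
    (h3 : 3 * B ≤ M) (ht : B ^ 2 ≤ M) (hMn : ω * √(M : ℝ) ≤ n) :
    asymCacheCost ω M B (triProg n (σ ^ 2) 0 (n + 1)) ≤
      ENNReal.ofReal (50000000 * (σ * (n : ℝ) ^ 3 / ((B : ℝ) * √(M : ℝ)))) := by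
  have hω1 : 1 ≤ ω := by rw [hω]; exact one_le_pow₀ hσ
  have hσ0 : 0 < σ := by linarith
  set q := √(M : ℝ) with hq
  have hM : 0 < M := by omega
  have hq0 : 0 < q := Real.sqrt_pos.2 (by exact_mod_cast hM)
  have hBr : (0 : ℝ) < B := by exact_mod_cast hB
  have hnr : (0 : ℝ) < n := by exact_mod_cast (by omega : 0 < n)
  have hqn : q ≤ n := by nlinarith
  obtain ⟨R, W, l, run, hl, hR, hW⟩ := exists_cacheRun hσ hn hB h3 ht hqn
  rw [← hq] at hl hR hW
  refine asymCacheCost_le (by linarith) run ?_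
  set x := (n : ℝ) / q with hx
  have hxω : ω ≤ x := (le_div_iff₀ hq0).2 hMn
  have hx0 : 0 < x := by positivity
  -- Cubed, this combines `(σ ^ 3) ^ 2 ≤ x ^ 2`, from `ω * √M ≤ n`, with `(l + 1) ^ 3 ≤ 8000 * x`.
  have hlx : σ ^ 2 * (l + 1 : ℝ) ≤ 20 * x := by
    refine le_of_pow_le_pow_left₀ (n := 3) (by norm_num) (by positivity) ?_
    calc (σ ^ 2 * (l + 1 : ℝ)) ^ 3 = (σ ^ 3) ^ 2 * (l + 1 : ℝ) ^ 3 := by ring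
      _ ≤ x ^ 2 * (8000 * x) := by
        rw [← hω]
        gcongr
      _ = _ := by ring
  have hY : (n : ℝ) ^ 3 / (B * q) = (n : ℝ) ^ 2 / B * x := by rw [hx]; field_simp
  set Y := (n : ℝ) ^ 3 / (B * q) with hYdef
  have hY0 : 0 < Y := by positivity
  have hl2 : (n : ℝ) ^ 2 * (l + 1) / B * σ ^ 2 ≤ 20 * Y := by
    calc (n : ℝ) ^ 2 * (l + 1) / B * σ ^ 2 = (n : ℝ) ^ 2 / B * (σ ^ 2 * (l + 1)) := by ring
      _ ≤ (n : ℝ) ^ 2 / B * (20 * x) := by gcongr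
      _ = 20 * Y := by rw [hY]; ring
  set Λ := (n : ℝ) ^ 2 * (l + 1) / B with hΛ
  have hΛ0 : 0 ≤ Λ := by positivity
  have hσ2 : 1 ≤ σ ^ 2 := one_le_pow₀ hσ
  have hΛY : Λ ≤ 20 * (σ * Y) := by
    nlinarith [mul_le_mul_of_nonneg_left hσ2 hΛ0, mul_le_mul_of_nonneg_right hσ hY0.le]
  have hωW : ω * W ≤ 1000000 * (σ * Y + 20 * (σ * Y)) := by
    calc ω * W ≤ ω * (1000000 * (1 / σ ^ 2 * Y + Λ)) := by gcongr
      _ = 1000000 * (σ * Y + σ * (Λ * σ ^ 2)) := by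
        rw [hω]
        field_simp
      _ ≤ 1000000 * (σ * Y + σ * (20 * Y)) := by gcongr
      _ = _ := by ring
  have e : σ * (n : ℝ) ^ 3 / (B * q) = σ * Y := by rw [hYdef, mul_div_assoc]
  rw [e]
  have : 0 < σ * Y := by positivity
  linarith

/-- The ratio of cache sizes (up to squaring) at which reads become cheap. -/
def scaleConst : ℕ := 6144000000

/-- Here the bound is at the given `M`, not at some size of a range. The algorithm reads little at a
suitable larger size `M₂`, so in `cube_le_of_cacheRun` the writes at `M` have to account for `n ^
3`. -/
theorem le_asymCacheCost_triProg (hσ : 1 ≤ σ) (hω : ω = σ ^ 3) (hn : 2 ≤ n) (hB : 0 < B)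
    (h3 : 3 * B ≤ M) (ht : B ^ 2 ≤ M) (hMn : ω * √(M : ℝ) ≤ n) :
    ENNReal.ofReal (1 / (5000 * (scaleConst : ℝ) ^ 2) *
      (σ * (n : ℝ) ^ 3 / ((B : ℝ) * √(M : ℝ)))) ≤
    asymCacheCost ω M B (triProg n (σ ^ 2) 0 (n + 1)) := by
  have hω1 : 1 ≤ ω := by rw [hω]; exact one_le_pow₀ hσ
  have hσ0 : 0 < σ := by linarith
  have hσ2 : 1 ≤ σ ^ 2 := one_le_pow₀ hσ
  set q := √(M : ℝ) with hq
  have hM : 0 < M := by omega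
  have hMr : (1 : ℝ) ≤ M := by exact_mod_cast hM
  have hq0 : 0 < q := Real.sqrt_pos.2 (by exact_mod_cast hM)
  have hqq : q ^ 2 = M := Real.sq_sqrt (by linarith)
  have hBr : (0 : ℝ) < B := by exact_mod_cast hB
  have hnr : (0 : ℝ) < n := by exact_mod_cast (by omega : 0 < n)
  have hP : Computes n (triProg n (σ ^ 2) 0 (n + 1)) := triProg_computes hσ2
  obtain ⟨k, hk⟩ : ∃ k : ℝ, k = (scaleConst : ℝ) := ⟨_, rfl⟩
  have hkv : k = 6144000000 := by rw [hk, scaleConst]; norm_num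
  have hk0 : 0 < k := by rw [hkv]; norm_num
  rw [← hk]
  set Y := (n : ℝ) ^ 3 / (B * q) with hYdef
  have hY0 : 0 < Y := by positivity
  have e : σ * (n : ℝ) ^ 3 / (B * q) = σ * Y := by rw [hYdef, mul_div_assoc]
  rw [e]
  rcases le_total σ k with hσk | hσk
  -- For bounded `σ` the symmetric bound suffices, up to the constant `k ^ 2`.
  · refine le_trans ?_ ((le_symCacheCost hn hP hM hB).trans ?_)
    · refine ENNReal.ofReal_le_ofReal ?_
      rw [← hq, ← hYdef]
      have h1 : σ ≤ k ^ 2 := by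
        rw [hkv] at hσk ⊢
        norm_num at hσk ⊢
        linarith
      calc 1 / (5000 * k ^ 2) * (σ * Y) ≤ 1 / (5000 * k ^ 2) * (k ^ 2 * Y) := by gcongr
        _ = 1 / 5000 * Y := by field_simp
    · rw [symCacheCost_eq]
      refine iInf_mono fun R => iInf_mono fun W => iInf_mono fun _ => ?_
      gcongr
  refine le_asymCacheCost (by linarith) fun R₁ W₁ run₁ => ?_
  set s := ⌈σ ^ 2⌉₊ with hs
  have hs1 : σ ^ 2 ≤ s := Nat.le_ceil _
  have hs2 : (s : ℝ) ≤ 2 * σ ^ 2 := by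
    have := (Nat.ceil_lt_add_one (show 0 ≤ σ ^ 2 by positivity)).le
    linarith
  set M₂ := scaleConst ^ 2 * s * M with hM₂
  have hM₂r : (M₂ : ℝ) = k ^ 2 * s * M := by rw [hM₂, hk]; push_cast; ring
  have hs0 : 0 < s := Nat.ceil_pos.2 (by positivity)
  have hMM : M ≤ M₂ := Nat.le_mul_of_pos_left _ (Nat.mul_pos (by norm_num [scaleConst]) hs0)
  set q₂ := √(M₂ : ℝ) with hq₂
  have hq₂0 : 0 < q₂ := Real.sqrt_pos.2 (by exact_mod_cast hM.trans_le hMM)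
  have hlow : k * σ * q ≤ q₂ := by
    refine Real.le_sqrt_of_sq_le ?_
    rw [mul_pow, mul_pow, hqq, hM₂r]
    gcongr
  -- For `k ≤ σ` the side of the larger cache, at most `2 * k * σ * q`, is still at most `ω * q ≤
  -- n`, so the read bound applies there.
  have hσ3k : 2 * k * σ ≤ ω := by
    have : 2 * k ≤ σ ^ 2 := by nlinarith
    rw [hω, pow_succ]
    gcongr
  have hq₂n : q₂ ≤ n := by
    have h1 : q₂ ≤ 2 * k * σ * q := by
      refine Real.sqrt_le_iff.2 ⟨by positivity, ?_⟩
      have : (2 * k * σ * q) ^ 2 = k ^ 2 * (4 * σ ^ 2) * M := by rw [← hqq]; ring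
      rw [this, hM₂r]
      gcongr
      linarith [sq_nonneg σ]
    exact h1.trans ((mul_le_mul_of_nonneg_right hσ3k hq0.le).trans hMn)
  obtain ⟨R₂, W₂, l, run₂, hl, hR, -⟩ :=
    exists_cacheRun hσ hn hB (h3.trans hMM) (ht.trans hMM) hq₂n
  rw [← hq₂] at hl hR
  set x := (n : ℝ) / q₂ with hx
  have hx1 : 1 ≤ x := (one_le_div hq₂0).2 hq₂n
  have hlx : (l + 1 : ℝ) ≤ 20 * x := by
    refine le_of_pow_le_pow_left₀ (n := 3) (by norm_num) (by positivity) ?_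
    have : x ≤ x ^ 3 := le_self_pow₀ hx1 (by norm_num)
    rw [mul_pow]
    linarith
  have hxk : k * σ * x ≤ n / q := by
    rw [hx, ← mul_div_assoc, div_le_div_iff₀ hq₂0 hq0]
    nlinarith
  have hY : Y = (n : ℝ) ^ 2 / B * (n / q) := by rw [hYdef]; field_simp
  have hR1 : k * (σ * ((n : ℝ) ^ 3 / (B * q₂))) ≤ Y := by
    calc k * (σ * ((n : ℝ) ^ 3 / (B * q₂))) = (n : ℝ) ^ 2 / B * (k * σ * x) := by
          rw [hx]
          field_simp
      _ ≤ Y := by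
          rw [hY]
          gcongr
  have hR2 : k * ((n : ℝ) ^ 2 * (l + 1) / B) ≤ Y := by
    calc k * ((n : ℝ) ^ 2 * (l + 1) / B) = (n : ℝ) ^ 2 / B * (k * (l + 1)) := by ring
      _ ≤ (n : ℝ) ^ 2 / B * (k * σ * x) := by
          have : (l + 1 : ℝ) ≤ σ * x := hlx.trans (by gcongr; linarith)
          rw [mul_assoc k]
          gcongr
      _ ≤ Y := by
          rw [hY]
          gcongr
  have hRk : k * R₂ ≤ 2000000 * Y := by
    have := mul_le_mul_of_nonneg_left hR hk0.le
    linarith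
  have hRq : 768 * ((B : ℝ) * R₂ * q) ≤ (n : ℝ) ^ 3 / 4 := by
    -- Here the value of `k` is used: `k = 2000000 * 3072`, where `3072 = 4 * 768` leaves a quarter
    -- of `n ^ 3` for the reads.
    have h1 : (R₂ : ℝ) ≤ Y / 3072 := by rw [hkv] at hRk; linarith
    have h2 : (B : ℝ) * q * Y = (n : ℝ) ^ 3 := by rw [hYdef]; field_simp
    have h3 : (B : ℝ) * q * R₂ ≤ B * q * (Y / 3072) := by gcongr
    linarith
  have hMq : 768 * (M₂ * q) ≤ (n : ℝ) ^ 3 / 4 := by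
    have h1 : (M₂ : ℝ) * q ≤ 2 * k ^ 2 * σ ^ 2 * q ^ 3 := by
      rw [hM₂r, ← hqq]
      calc k ^ 2 * s * q ^ 2 * q = k ^ 2 * q ^ 3 * s := by ring
        _ ≤ k ^ 2 * q ^ 3 * (2 * σ ^ 2) := by gcongr
        _ = _ := by ring
    have h2 : (σ ^ 3 * q) ^ 3 ≤ (n : ℝ) ^ 3 := by
      rw [← hω]
      exact pow_le_pow_left₀ (by positivity) hMn 3
    -- The incomplete segment takes another quarter: `σ ^ 7 * σ ^ 2 = ω ^ 3`, and `ω * q ≤ n`.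
    have h4 : 6144 * k ^ 2 ≤ σ ^ 7 := by
      calc 6144 * k ^ 2 ≤ k ^ 7 := by rw [hkv]; norm_num
        _ ≤ σ ^ 7 := pow_le_pow_left₀ hk0.le hσk 7
    calc 768 * (M₂ * q) ≤ 768 * (2 * k ^ 2 * σ ^ 2 * q ^ 3) := by gcongr
      _ = 6144 * k ^ 2 * (σ ^ 2 * q ^ 3) / 4 := by ring
      _ ≤ σ ^ 7 * (σ ^ 2 * q ^ 3) / 4 := by gcongr
      _ = (σ ^ 3 * q) ^ 3 / 4 := by ring
      _ ≤ _ := by gcongr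
  have hmain := cube_le_of_cacheRun hP hn hB hM hMM run₁ run₂
  rw [← hq] at hmain
  have hM₂0 : (0 : ℝ) < M₂ := by exact_mod_cast hM.trans_le hMM
  have h4 : M₂ * q * ((B : ℝ) * W₁ / M + (B : ℝ) * R₂ / M₂ + 1) =
      k ^ 2 * s * ((B : ℝ) * W₁ * q) + (B : ℝ) * R₂ * q + M₂ * q := by
    have : (B : ℝ) * R₂ / M₂ * M₂ = B * R₂ := by field_simp
    have h5 : (B : ℝ) * W₁ / M * M = B * W₁ := by field_simp
    calc M₂ * q * ((B : ℝ) * W₁ / M + (B : ℝ) * R₂ / M₂ + 1) =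
        M₂ * q * ((B : ℝ) * W₁ / M) + q * ((B : ℝ) * R₂ / M₂ * M₂) + M₂ * q := by ring
      _ = k ^ 2 * s * q * ((B : ℝ) * W₁ / M * M) + q * ((B : ℝ) * R₂ / M₂ * M₂) + M₂ * q := by
          rw [hM₂r]
          ring
      _ = _ := by
          rw [this, h5]
          ring
  rw [h4] at hmain
  have h5 : (n : ℝ) ^ 3 ≤ 3072 * k ^ 2 * σ ^ 2 * ((B : ℝ) * W₁ * q) := by
    have : k ^ 2 * s * ((B : ℝ) * W₁ * q) ≤ k ^ 2 * (2 * σ ^ 2) * ((B : ℝ) * W₁ * q) := by gcongr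
    linarith
  have h6 : Y ≤ 3072 * k ^ 2 * σ ^ 2 * W₁ := by
    rw [hYdef, div_le_iff₀ (by positivity)]
    linarith
  have h7 : 1 / (5000 * k ^ 2) * (σ * Y) ≤ ω * W₁ := by
    calc 1 / (5000 * k ^ 2) * (σ * Y) ≤
        1 / (5000 * k ^ 2) * (σ * (3072 * k ^ 2 * σ ^ 2 * W₁)) := by gcongr
      _ = 3072 / 5000 * (σ ^ 3 * W₁) := by field_simp
      _ ≤ ω * W₁ := by
        rw [hω]
        have : 0 ≤ σ ^ 3 * W₁ := by positivity
        linarith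
  have : (0 : ℝ) ≤ R₁ := Nat.cast_nonneg _
  linarith

end Bounds

/-! ### Work and span of the whole program, and conclusion. -/

theorem triProg_work_bounds {n : ℕ} {ρ : ℝ} (hρ : 1 ≤ ρ) (hn : 2 ≤ n) :
    1 / 64 * (n : ℝ) ^ 3 ≤ ((triProg n ρ 0 (n + 1)).work : ℝ) ∧
    ((triProg n ρ 0 (n + 1)).work : ℝ) ≤ 7 * (n : ℝ) ^ 3 := by
  constructor
  · have h1 : (((n + 1) / 3 : ℕ) : ℝ) ^ 3 ≤ ((triProg n ρ 0 (n + 1)).work : ℝ) := by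
      exact_mod_cast cube_le_work (triProg_computes hρ) (show 3 * ((n + 1) / 3) ≤ n + 1 by omega)
    have h2 : (n : ℝ) ≤ 4 * ((n + 1) / 3 : ℕ) := by
      exact_mod_cast (by omega : n ≤ 4 * ((n + 1) / 3))
    have h3 := pow_le_pow_left₀ (Nat.cast_nonneg n) h2 3
    rw [mul_pow] at h3
    linarith
  · have h1 : ((triProg n ρ 0 (n + 1)).work : ℝ) ≤ 2 * ((n : ℝ) + 1) ^ 3 := by
      exact_mod_cast triProg_work hρ 0 (n + 1) (n := n)
    have h2 : ((n : ℝ) + 1) ≤ 3 / 2 * n := by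
      have : (2 : ℝ) ≤ n := by exact_mod_cast hn
      linarith
    have h3 := pow_le_pow_left₀ (by positivity) h2 3
    rw [mul_pow] at h3
    have : (0 : ℝ) ≤ (n : ℝ) ^ 3 := by positivity
    linarith

/-- The least power `2 ^ l ≥ n + 1` is at most `4 * n`, and `(2 ^ l) ^ log₂ 3 = 3 ^ l`. The factor
`4` becomes `9`, and `153 = 17 * 9`. -/
theorem triProg_span_le {n : ℕ} {ρ : ℝ} (hρ : 1 ≤ ρ) (hn : 2 ≤ n) :
    ((triProg n ρ 0 (n + 1)).span : ℝ) ≤ 153 * (n : ℝ) ^ Real.logb 2 3 := by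
  set l := Nat.clog 2 (n + 1) with hl
  have h1 := triProg_span hρ 0 (n + 1) (n := n) l (Nat.le_pow_clog (by norm_num) _)
  have h2 : 2 ^ l ≤ 4 * n := by
    have h3 := Nat.pow_pred_clog_lt_self (b := 2) (by norm_num) (show 1 < n + 1 by omega)
    rw [← hl] at h3
    have h4 : 0 < l := Nat.clog_pos (by norm_num) (by omega)
    have h5 : 2 ^ l = 2 * 2 ^ l.pred := by
      rw [← pow_succ', Nat.pred_eq_sub_one, Nat.sub_add_cancel h4]
    omega
  have e : ∀ j : ℕ, ((2 : ℝ) ^ j) ^ Real.logb 2 3 = 3 ^ j := fun j => by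
    rw [← Real.rpow_natCast, ← Real.rpow_mul (by norm_num), mul_comm, Real.rpow_mul (by norm_num),
      Real.rpow_logb (by norm_num) (by norm_num) (by norm_num), Real.rpow_natCast]
  have h3 : (3 : ℝ) ^ l ≤ 9 * (n : ℝ) ^ Real.logb 2 3 := by
    calc (3 : ℝ) ^ l = ((2 : ℝ) ^ l) ^ Real.logb 2 3 := (e l).symm
      _ ≤ ((2 : ℝ) ^ 2 * n) ^ Real.logb 2 3 := by
        refine Real.rpow_le_rpow (by positivity) ?_ (Real.logb_nonneg (by norm_num) (by norm_num))
        norm_num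
        exact_mod_cast h2
      _ = _ := by
        rw [Real.mul_rpow (by positivity) (by positivity), e]
        norm_num
  calc ((triProg n ρ 0 (n + 1)).span : ℝ) ≤ 17 * 3 ^ l := by exact_mod_cast h1
    _ ≤ 17 * (9 * (n : ℝ) ^ Real.logb 2 3) := by gcongr
    _ = _ := by ring

theorem exists_root {ω : ℝ} (hω : 1 ≤ ω) :
    1 ≤ ω ^ (1 / 3 : ℝ) ∧ ω = (ω ^ (1 / 3 : ℝ)) ^ 3 ∧ ω ^ (2 / 3 : ℝ) = (ω ^ (1 / 3 : ℝ)) ^ 2 := by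
  have h0 : 0 ≤ ω := by linarith
  refine ⟨Real.one_le_rpow hω (by norm_num), ?_, ?_⟩
  · rw [← Real.rpow_natCast, ← Real.rpow_mul h0]
    norm_num
  · rw [← Real.rpow_natCast, ← Real.rpow_mul h0]
    norm_num

theorem asymmetric_upper {ω c : ℝ} (hω : 1 ≤ ω)
    (hc : c ≤ 1 / (5000 * (scaleConst : ℝ) ^ 2)) :
    ∃ A : DivideConquer, A.IsCBCO 9 ∧ ∀ n : ℕ, 2 ≤ n → ∃ P : SP Instr,
      A.Runs n P ∧ Computes n P ∧ RaceFree P ∧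
      (∀ w : ℕ → ℕ → ℕ → ℝ, ComputesFor n P (fun i k j (x y : ℝ) => x + y + w i k j)) ∧
      c * (n : ℝ) ^ 3 ≤ (P.work : ℝ) ∧ (P.work : ℝ) ≤ 50000000 * (n : ℝ) ^ 3 ∧
      (P.span : ℝ) ≤ 50000000 * (n : ℝ) ^ (Real.logb 2 3) ∧
      ∀ M B : ℕ, 0 < B → 3 * B ≤ M → B ^ 2 ≤ M → ω * √(M : ℝ) ≤ (n : ℝ) →
        ENNReal.ofReal (c * (ω ^ (1 / 3 : ℝ) * (n : ℝ) ^ 3 / ((B : ℝ) * √(M : ℝ))))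
          ≤ asymCacheCost ω M B P ∧
        asymCacheCost ω M B P
          ≤ ENNReal.ofReal (50000000 * (ω ^ (1 / 3 : ℝ) * (n : ℝ) ^ 3 / ((B : ℝ) * √(M : ℝ)))) := by
  obtain ⟨hσ, hσω, -⟩ := exists_root hω
  set σ := ω ^ (1 / 3 : ℝ) with hσdef
  have hρ : 1 ≤ σ ^ 2 := one_le_pow₀ hσ
  refine ⟨algorithm (σ ^ 2), algorithm_isCBCO _, fun n hn => ⟨triProg n (σ ^ 2) 0 (n + 1),
    algorithm_runs hρ n, triProg_computes hρ, triProg_raceFree hρ 0 (n + 1) (by omega),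
    fun w => (triProg_computes hρ).2 ℝ _, ?_, ?_, ?_, fun M B hB h3 ht hMn => ⟨?_, ?_⟩⟩⟩
  · refine le_trans ?_ (triProg_work_bounds hρ hn).1
    gcongr
    refine hc.trans ?_
    norm_num [scaleConst]
  · refine (triProg_work_bounds hρ hn).2.trans ?_
    gcongr
    norm_num
  · refine (triProg_span_le hρ hn).trans ?_
    gcongr
    norm_num
  · refine le_trans (ENNReal.ofReal_le_ofReal ?_)
      (le_asymCacheCost_triProg hσ hσω hn hB h3 ht hMn)
    gcongr
  · exact asymCacheCost_triProg_le hσ hσω hn hB h3 ht hMn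

end Paren

theorem mainTheorem6 :
    ∃ (c C : ℝ) (F : ℕ), 0 < c ∧ 0 < C ∧
    -- symmetric setting: an algorithm with the claimed costs
    (∃ A : DivideConquer, A.IsCBCO F ∧ ∀ n : ℕ, 2 ≤ n → ∃ P : SP Instr,
      A.Runs n P ∧ Computes n P ∧ RaceFree P ∧
      (∀ w : ℕ → ℕ → ℕ → ℝ, ComputesFor n P (fun i k j (x y : ℝ) => x + y + w i k j)) ∧
      c * (n : ℝ) ^ 3 ≤ (P.work : ℝ) ∧ (P.work : ℝ) ≤ C * (n : ℝ) ^ 3 ∧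
      (P.span : ℝ) ≤ C * (n : ℝ) ^ (Real.logb 2 3) ∧
      ∀ M B : ℕ, 0 < B → 3 * B ≤ M → B ^ 2 ≤ M → √(M : ℝ) ≤ (n : ℝ) →
        ENNReal.ofReal (c * ((n : ℝ) ^ 3 / ((B : ℝ) * √(M : ℝ)))) ≤ symCacheCost M B P ∧
        symCacheCost M B P ≤ ENNReal.ofReal (C * ((n : ℝ) ^ 3 / ((B : ℝ) * √(M : ℝ))))) ∧
    -- symmetric setting: no algorithm, even one that knows `M` and `B`, is better
    (∀ n : ℕ, 2 ≤ n → ∀ P : SP Instr, Computes n P → ∀ M B : ℕ, 0 < M → 0 < B →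
      ENNReal.ofReal (c * ((n : ℝ) ^ 3 / ((B : ℝ) * √(M : ℝ)))) ≤ symCacheCost M B P) ∧
    -- asymmetric setting: an algorithm with the claimed costs
    (∀ ω : ℝ, 1 ≤ ω → ∃ A : DivideConquer, A.IsCBCO F ∧ ∀ n : ℕ, 2 ≤ n → ∃ P : SP Instr,
      A.Runs n P ∧ Computes n P ∧ RaceFree P ∧
      (∀ w : ℕ → ℕ → ℕ → ℝ, ComputesFor n P (fun i k j (x y : ℝ) => x + y + w i k j)) ∧
      c * (n : ℝ) ^ 3 ≤ (P.work : ℝ) ∧ (P.work : ℝ) ≤ C * (n : ℝ) ^ 3 ∧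
      (P.span : ℝ) ≤ C * (n : ℝ) ^ (Real.logb 2 3) ∧
      ∀ M B : ℕ, 0 < B → 3 * B ≤ M → B ^ 2 ≤ M → ω * √(M : ℝ) ≤ (n : ℝ) →
        ENNReal.ofReal (c * (ω ^ (1 / 3 : ℝ) * (n : ℝ) ^ 3 / ((B : ℝ) * √(M : ℝ))))
          ≤ asymCacheCost ω M B P ∧
        asymCacheCost ω M B P
          ≤ ENNReal.ofReal (C * (ω ^ (1 / 3 : ℝ) * (n : ℝ) ^ 3 / ((B : ℝ) * √(M : ℝ))))) ∧
    -- asymmetric setting: no cache-oblivious algorithm (`P` is fixed before the cache size `M'`),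
    -- in particular none in the CBCO paradigm, is better, at any scale of cache sizes
    (∀ ω : ℝ, 1 ≤ ω → ∀ n : ℕ, 2 ≤ n → ∀ P : SP Instr, Computes n P →
      ∀ M B : ℕ, 0 < M → 0 < B → ∃ M' : ℕ, M ≤ M' ∧ M' ≤ ⌈ω ^ (2 / 3 : ℝ) * (M : ℝ)⌉₊ ∧
        ENNReal.ofReal (c * (ω ^ (1 / 3 : ℝ) * (n : ℝ) ^ 3 / ((B : ℝ) * √(M' : ℝ))))
          ≤ asymCacheCost ω M' B P) := by
  have hc0 : (0 : ℝ) < 1 / (5000 * (Paren.scaleConst : ℝ) ^ 2) := by norm_num [Paren.scaleConst]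
  have hc1 : 1 / (5000 * (Paren.scaleConst : ℝ) ^ 2) ≤ 1 / 5000 := by norm_num [Paren.scaleConst]
  generalize hc : 1 / (5000 * (Paren.scaleConst : ℝ) ^ 2) = c at hc0 hc1
  refine ⟨c, 50000000, 9, hc0, by norm_num, ?_, ?_, fun ω hω => Paren.asymmetric_upper hω hc.ge, ?_⟩
  -- The symmetric algorithm is the case `ω = 1`, with aspect threshold `1`.
  · have h := Paren.asymmetric_upper le_rfl hc.ge
    simpa only [one_mul, Real.one_rpow, ← Paren.symCacheCost_eq] using h
  · intro n hn P hP M B hM hB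
    refine le_trans (ENNReal.ofReal_le_ofReal ?_) (Paren.le_symCacheCost hn hP hM hB)
    gcongr
  · intro ω hω n hn P hP M B hM hB
    obtain ⟨hσ, hσω, hσ2⟩ := Paren.exists_root hω
    obtain ⟨M', h1, h2, h3⟩ := Paren.exists_cacheSize_le hσ hσω hn hP hM hB
    rw [hσ2]
    refine ⟨M', h1, h2, le_trans (ENNReal.ofReal_le_ofReal ?_) h3⟩
    gcongr
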